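/- Let $a(t)=\sum_{n\ge1}a_{2n}t^{2n}$ be an even real-analytic function near $t=0$, let $L>0$, and consider the symmetric billiard table bounded near the $x$-axis by the curves $\gamma_0(t)=(a(t),t)$ and $\gamma_1(t)=(L-a(t),t)$. Let $R(s)$ be the radius of curvature of $\gamma_0$ as a function of arc length $s$ (with $s=0$ at $t=0$), and write $R=R(0)$, $R''=R''(0)$, $R^{(4)}=R^{(4)}(0)$. Assume $R>0$ and $0<L/R<2$. Let $F$ be the one-step billiard map near the period-two orbit along the $x$-axis, in the area-preserving coordinates $(s,u)$, $u=-\cos\theta$, where $s$ is arc length along the counterclockwise boundary measured from the point on the $x$-axis and $\theta$ is the angle from the tangent to the outgoing ray; by symmetry $F$ is a map germ of the plane fixing the origin, with linear part having eigenvalues $\lambda,\bar\lambda$, $\lambda=\frac LR-1-\frac iR\sqrt{L(2R-L)}$. Choose $\eta>0$ such that in the coordinates $(x,y)=(s/\eta,\eta u)$ the linear part of $F$ is a rotation, and define $c_{03}$ by $z_1=\lambda\big(z+\sum_{j+k=3}c_{jk}z^jw^k\big)+\cdots$, where $z=x+iy$, $w=x-iy$. If $L/R\notin\{\frac12,1,\frac32\}$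 (equivalently $\lambda^4\ne1$ and $\lambda^6\neq 1$), the second twist coefficient $\tau_2$ is the number such that, for some $\theta_0,\tau_1$, the map $F$ is, in suitable smooth symplectic coordinates near the fixed point, the rotation by the angle $\theta_0+\tau_1r^2+\tau_2r^4$ up to $O(r^6)$. Then the billiard map germ $F$ exists, $c_{03}$ depends only on $(L,R,R'')$, and, when $L/R\notin\{\frac12,1,\frac32\}$, $\tau_2$ exists, is unique and depends only on $(L,R,R'',R^{(4)})$; more precisely, there are functions $c_{03}(L,R,R'')$ and $\tau_2(L,R,R'',R^{(4)})$ which give these quantities for all such tables and have the following properties. Call a function on the locus $\{L>0,\ R>0,\ 2R-L>0\}$ regular if it is a quotient of polynomials in $\sqrt L,\sqrt{2R-L},L,R,R'',R^{(4)}$ whose denominator has no zero on this locus. (a) On the locus, for $L\ne R$, $$\tau_2=-\frac{3R^4c_{03}^2}{4\sqrt L\,(2R-L)^{5/2}(R-L)}+\rho(L,R,R'',R^{(4)}),$$ with a (complex-valued) regular function $\rho$, where $c_{03}=c_{03}(L,R,R'')$. The same formula holds, with a real-valued regular function $\rho$, if $c_{03}$ is replaced by its value $c_{03}(R,R,R'')$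 at resonance. (b) $\tau_2$ has a simple pole along $L=R$ exactly on the locus where $c_{03}\ne0$: for all $R>0$ and all $R'',R^{(4)}$, the function $\tau_2$ is, near the point $(R,R,R'',R^{(4)})$ and off $L=R$, of the form $g/(R-L)$ with $g$ analytic and non-zero at that point if and only if $c_{03}(R,R,R'')\neq0$. -/

import Mathlib

open Filter Topology Asymptotics
open scoped ContDiff

noncomputable section

namespace Billiard

/-! ## Plane curves `x = a(t)`, `y = t`, and derivatives along the arc length -/

/-- Speed of the curves `t ↦ (± a t + const, t)`. -/
def speed (a : ℝ → ℝ) (t : ℝ) : ℝ := Real.sqrt (1 + deriv a t ^ 2)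

/-- Signed arc length measured from the parameter value `0`. -/
def arcLength (a : ℝ → ℝ) (t : ℝ) : ℝ := ∫ τ in (0 : ℝ)..t, speed a τ

/-- Radius of curvature of the curve `t ↦ (a t, t)`, as a function of `t`
(positive where the curve bends towards the positive `x` direction). -/
def radius (a : ℝ → ℝ) (t : ℝ) : ℝ := speed a t ^ 3 / deriv (deriv a) t

/-- The derivative `d/ds` with respect to arc length `s` of a quantity along the curve that is
given as a function of the parameter `t`. -/
def arcDeriv (a : ℝ → ℝ) (f : ℝ → ℝ) (t : ℝ) : ℝ := deriv f t / speed a t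

/-! ## Symmetric billiard tables -/

/-- A symmetric table: it is bounded near the `x`-axis by the two curves
`t ↦ (a t, t)` and `t ↦ (L - a t, t)`, where `a` is an even real-analytic function near `0`
which vanishes at `0`, so that `a t = a₂ t² + a₄ t⁴ + ⋯`. -/
structure SymmetricTable where
  L : ℝ
  a : ℝ → ℝ
  L_pos : 0 < L
  analytic : AnalyticAt ℝ a 0
  even : ∀ᶠ t in 𝓝 (0 : ℝ), a (-t) = a t
  zero : a 0 = 0

namespace SymmetricTable

/-- `Q.Rad k` is the `k`-th derivative `R⁽ᵏ⁾(0)` of the radius of curvature with respect to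
arc length, at the point `γ₀(0) = (0, 0)`. -/
def Rad (Q : SymmetricTable) (k : ℕ) : ℝ := ((arcDeriv Q.a)^[k] (radius Q.a)) 0

/-- The left boundary curve. -/
def γ₀ (Q : SymmetricTable) (t : ℝ) : ℝ × ℝ := (Q.a t, t)

/-- The right boundary curve. -/
def γ₁ (Q : SymmetricTable) (t : ℝ) : ℝ × ℝ := (Q.L - Q.a t, t)

/-- Unit tangent of the left curve. The boundary of the table is oriented counterclockwise,
so the left curve is run through downwards. -/
def T₀ (Q : SymmetricTable) (t : ℝ) : ℝ × ℝ :=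
  (-(deriv Q.a t) / speed Q.a t, -1 / speed Q.a t)

/-- Unit tangent of the right curve, which is run through upwards. -/
def T₁ (Q : SymmetricTable) (t : ℝ) : ℝ × ℝ :=
  (-(deriv Q.a t) / speed Q.a t, 1 / speed Q.a t)

/-- The period-two orbit along the `x`-axis is elliptic for the one-step map: `0 < L / R < 2`
(with `0 < L` being part of the table). -/
def IsElliptic (Q : SymmetricTable) : Prop := 0 < Q.Rad 0 ∧ Q.L < 2 * Q.Rad 0

/-- `λ⁴ ≠ 1` -/
def A1 (Q : SymmetricTable) : Prop := Q.L / Q.Rad 0 ≠ 1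

/-- `λ⁶ ≠ 1` -/
def A2 (Q : SymmetricTable) : Prop := Q.L / Q.Rad 0 ≠ 1 / 2 ∧ Q.L / Q.Rad 0 ≠ 3 / 2

end SymmetricTable

/-- Euclidean dot product in the plane. -/
def dot (p q : ℝ × ℝ) : ℝ := p.1 * q.1 + p.2 * q.2

/-- A ray starts at `γ₀ t` with unit velocity `v`, hits the right curve at `γ₁ t₁` after
some positive time, and is reflected there with outgoing velocity `v₁`
(the mirror image of `v` in the tangent line). -/
def BilliardStep (Q : SymmetricTable) (t : ℝ) (v : ℝ × ℝ) (t₁ : ℝ) (v₁ : ℝ × ℝ) : Prop :=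
  dot v v = 1 ∧ (∃ l : ℝ, 0 < l ∧ Q.γ₁ t₁ = Q.γ₀ t + l • v) ∧
    v₁ = (2 * dot v (Q.T₁ t₁)) • Q.T₁ t₁ - v

/-- `F` is the billiard map near the point `P = (0,0)`, in the coordinates `(s, u)`: `s` is the
arc length along the (counterclockwise) boundary, measured on each of the two curves from its
point on the `x`-axis, and `u = -cos θ` with `θ` the angle from the unit tangent to the outgoing
velocity. This determines `F` in a neighbourhood of `(0,0)`. By the symmetry of the table the map
from the right curve to the left one has the same expression. -/
def IsBilliardMap (Q : SymmetricTable) (F : ℝ × ℝ → ℝ × ℝ) : Prop :=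
  ∀ ε : ℝ, 0 < ε → ∀ᶠ p in 𝓝 (0 : ℝ × ℝ), ∃ (t t₁ : ℝ) (v v₁ : ℝ × ℝ),
    |t| < ε ∧ |t₁| < ε ∧ BilliardStep Q t v t₁ v₁ ∧
    p = (-arcLength Q.a t, -dot (Q.T₀ t) v) ∧
    F p = (arcLength Q.a t₁, -dot (Q.T₁ t₁) v₁)

/-! ## Twist coefficients -/

/-- The rotation of the plane whose angle at distance `r` from the origin is
`θ + τ₁ r² + τ₂ r⁴`. -/
def twistMap (θ τ₁ τ₂ : ℝ) (p : ℝ × ℝ) : ℝ × ℝ :=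
  let q := p.1 ^ 2 + p.2 ^ 2
  let Θ := θ + τ₁ * q + τ₂ * q ^ 2
  (p.1 * Real.cos Θ - p.2 * Real.sin Θ, p.1 * Real.sin Θ + p.2 * Real.cos Θ)

/-- `h` is a smooth symplectic (area- and orientation-preserving) change of coordinates near
the origin that fixes the origin. -/
def IsSymplecticGerm (h : ℝ × ℝ → ℝ × ℝ) : Prop :=
  h 0 = 0 ∧ ContDiffAt ℝ ∞ h 0 ∧ ∀ᶠ p in 𝓝 (0 : ℝ × ℝ), (fderiv ℝ h p).det = 1

/-- The map `f` has a Birkhoff normal form at its fixed point `0` with first two twist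
coefficients `τ₁`, `τ₂`: in suitable symplectic coordinates it is
`twistMap θ τ₁ τ₂` up to terms of order higher than five. Since `h` and its local inverse are
Lipschitz near the origin, the condition is the same as
`h⁻¹ ∘ f ∘ h = twistMap θ τ₁ τ₂ + O(r⁶)`. -/
def HasTwistCoefficients (f : ℝ × ℝ → ℝ × ℝ) (τ₁ τ₂ : ℝ) : Prop :=
  ∃ (θ : ℝ) (h : ℝ × ℝ → ℝ × ℝ), IsSymplecticGerm h ∧
    (fun p => f (h p) - h (twistMap θ τ₁ τ₂ p)) =O[𝓝 (0 : ℝ × ℝ)] (fun p => ‖p‖ ^ 6)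

/-- `τ₂` is the second twist coefficient of `f` at the fixed point `0`. -/
def IsSecondTwistCoefficient (f : ℝ × ℝ → ℝ × ℝ) (τ₂ : ℝ) : Prop :=
  ∃ τ₁ : ℝ, HasTwistCoefficients f τ₁ τ₂

/-! ## The coefficient `c₀₃` -/

/-- The Taylor coefficient of `sʲ uᵏ` of a function of `(s, u)` at the origin. -/
def taylorCoeff (g : ℝ × ℝ → ℝ) (j k : ℕ) : ℝ :=
  iteratedDeriv j (fun s => iteratedDeriv k (fun u => g (s, u)) 0) 0 /
    ((j.factorial : ℝ) * (k.factorial : ℝ))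

/-- The scaling factor `η` for which `(x, y) = (s / η, η u)` turns the linear part of `F` into a
rotation (when `F` is a billiard map at an elliptic point). -/
def eta (F : ℝ × ℝ → ℝ × ℝ) : ℝ :=
  (-(taylorCoeff (fun p => (F p).1) 0 1) / taylorCoeff (fun p => (F p).2) 1 0) ^ (1 / 4 : ℝ)

/-- Taylor coefficients of the first component of `F` in the coordinates `(x, y)`. -/
def aCoeff (F : ℝ × ℝ → ℝ × ℝ) (j k : ℕ) : ℝ :=
  eta F ^ ((j : ℤ) - (k : ℤ) - 1) * taylorCoeff (fun p => (F p).1) j k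

/-- Taylor coefficients of the second component of `F` in the coordinates `(x, y)`. -/
def bCoeff (F : ℝ × ℝ → ℝ × ℝ) (j k : ℕ) : ℝ :=
  eta F ^ ((j : ℤ) - (k : ℤ) + 1) * taylorCoeff (fun p => (F p).2) j k

/-- The eigenvalue `λ` of the linear part of `F`. -/
def eigenvalue (F : ℝ × ℝ → ℝ × ℝ) : ℂ :=
  (taylorCoeff (fun p => (F p).1) 1 0 : ℂ) - Complex.I *
    (Real.sqrt (-(taylorCoeff (fun p => (F p).1) 0 1) *
      taylorCoeff (fun p => (F p).2) 1 0) : ℂ)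

/-- The coefficient `c₀₃` in `z₁ = λ (z + ∑ cⱼₖ zʲ wᵏ)`, where `z = x + i y`, `w = x - i y`. -/
def c03 (F : ℝ × ℝ → ℝ × ℝ) : ℂ :=
  (starRingEnd ℂ) (eigenvalue F) / 8 *
    ((aCoeff F 3 0 : ℂ) + Complex.I * (bCoeff F 3 0 : ℂ)
      + Complex.I * (aCoeff F 2 1 : ℂ) - (bCoeff F 2 1 : ℂ)
      - (aCoeff F 1 2 : ℂ) - Complex.I * (bCoeff F 1 2 : ℂ)
      - Complex.I * (aCoeff F 0 3 : ℂ) + (bCoeff F 0 3 : ℂ))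

/-! ## Functions of `(L, R, R'', R⁽⁴⁾)` -/

/-- The six functions `√L, √(2R - L), L, R, R'', R⁽⁴⁾`. -/
def generators (p : ℝ × ℝ × ℝ × ℝ) : Fin 6 → ℝ :=
  ![Real.sqrt p.1, Real.sqrt (2 * p.2.1 - p.1), p.1, p.2.1, p.2.2.1, p.2.2.2]

/-- The open locus `L > 0`, `R > 0`, `2 R - L > 0`. -/
def locus : Set (ℝ × ℝ × ℝ × ℝ) := {p | 0 < p.1 ∧ 0 < p.2.1 ∧ 0 < 2 * p.2.1 - p.1}

/-- `ρ` is a regular function on the locus: a quotient of polynomials in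
`√L, √(2R - L), L, R, R'', R⁽⁴⁾` whose denominator vanishes nowhere on the locus. -/
def IsRegular {𝕜 : Type} [RCLike 𝕜] (ρ : ℝ × ℝ × ℝ × ℝ → 𝕜) : Prop :=
  ∃ A B : MvPolynomial (Fin 6) 𝕜, ∀ p ∈ locus,
    MvPolynomial.eval (fun i => (generators p i : 𝕜)) B ≠ 0 ∧
    ρ p = MvPolynomial.eval (fun i => (generators p i : 𝕜)) A /
      MvPolynomial.eval (fun i => (generators p i : 𝕜)) B

/-- The function `T` (whose values on `L = R` are irrelevant) has a simple pole along the
hypersurface `L = R` at the point `p₀` of it: near `p₀` it is an analytic function that does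
not vanish at `p₀`, divided by `R - L`. -/
def HasSimplePoleAt (T : ℝ × ℝ × ℝ × ℝ → ℝ) (p₀ : ℝ × ℝ × ℝ × ℝ) : Prop :=
  ∃ g : ℝ × ℝ × ℝ × ℝ → ℝ, AnalyticAt ℝ g p₀ ∧ g p₀ ≠ 0 ∧
    ∀ᶠ p in 𝓝 p₀, p.1 ≠ p.2.1 → T p = g p / (p.2.1 - p.1)

end Billiard

end

/-!
The chord length between the two boundary curves, as a function of the arc lengths `s`, `t` of
its end points, is a generating function of the billiard map: if a ray starts at `s` with
momentum `u` and hits the other curve at `t`, to leave it with momentum `v`, then `u = h (s, t)`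
and `v = -h (t, s)`, where `h` is the derivative of the chord length. Since `∂h/∂t = 1 / L ≠ 0`
at the origin, the inverse function theorem gives the germ of the map
(`SymmetricTable.exists_billiardGerm`). The table enters only through the jet of `h`, which is
computed from the Frenet equations of the boundary curve (`exists_curveExpansion`,
`CurveExpansion.momentum`). Its coefficients `GenCoeffs` are rational in `L, R, R'', R⁽⁴⁾`, and
those of order up to four do not involve `R⁽⁴⁾`. This gives `c₀₃` (`c03_eq`).

A normal form with respect to a twist map `T` consists of functions `X`, `Y` with
`h (X, X ∘ T) = Y` up to order five. Comparison of coefficients in `z = x + i y` and its conjugate `w` leads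
to homological equations, which are solvable since `λ⁴ ≠ 1` and `λ⁶ ≠ 1`; the resonant terms
determine the twist coefficients (`exists_normalForm`). The second equation of a conjugacy,
`h (X ∘ T, X) = -Y ∘ T`, is free: a reflection conjugates `T` to its inverse
(`NormalForm.momentum_eq'`). The map `(X, Y)` is symplectic up to order four, because its
Jacobian determinant is the Poisson bracket `{X, Y}`, this bracket is invariant under `T` by the
generating function property, and a polynomial of degree four that is invariant under `T`
depends only on `z w` (`NormalForm.bracket_eq_one`). It is made exactly symplectic by
composition with the inverse of `(x, y) ↦ (x, ∫₀^y {X, Y})` (`exists_symplectic_correction`).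

The second twist coefficient is unique since a symplectic germ that conjugates two twist maps up
to order five must be `z ↦ u z + b z² w + ⋯`; if the second coefficients were different, the
argument of `z` along an orbit would drift at different rates under the two maps, which is
excluded by following an orbit for a sufficiently long time (`drift_eq_zero`, `twist_rigidity`).

The resulting formula for `τ₂` has the single factor `C = L / R - 1` in its denominator that
vanishes on the locus, in the term `3 N² / (64 β⁴ C S⁵)` (`secondTwist_eq`). At `C = 0` the
number `N` is `-2` times the combination of coefficients in `c₀₃`, so that this term and the
multiple of `c₀₃²` have the same polar part. The quotients of the differences by `R - L` are
explicit (`polarPart_identity`, `mul_resonantQuotient`), and the pole is simple exactly where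
`N ≠ 0` (`hasSimplePoleAt_secondTwist_iff`).
-/

open scoped ComplexConjugate


namespace Billiard

/-! ### Jets of order five with respect to a gauge function -/

section Jets

variable {α 𝕜 : Type*} [NormedField 𝕜] {l : Filter α} {r : α → ℝ}

/-- `f = O(r ^ n)` along the filter `l`, for a gauge function `r` (usually a norm). -/
def Ord (l : Filter α) (r : α → ℝ) (n : ℕ) (f : α → 𝕜) : Prop := f =O[l] fun x => r x ^ n

namespace Ord

variable {m n : ℕ} {f g : α → 𝕜}

theorem add (hf : Ord l r n f) (hg : Ord l r n g) : Ord l r n (fun x => f x + g x) :=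
  IsBigO.add hf hg

theorem sub (hf : Ord l r n f) (hg : Ord l r n g) : Ord l r n (fun x => f x - g x) :=
  IsBigO.sub hf hg

theorem neg (hf : Ord l r n f) : Ord l r n (fun x => -f x) := IsBigO.neg_left hf

theorem mul (hf : Ord l r m f) (hg : Ord l r n g) : Ord l r (m + n) (fun x => f x * g x) := by
  simpa only [Ord, pow_add] using IsBigO.mul hf hg

theorem const (c : 𝕜) : Ord l r 0 (fun _ => c) := by
  simpa [Ord] using isBigO_const_const c (one_ne_zero (α := ℝ)) l

theorem const_mul (c : 𝕜) (hf : Ord l r n f) : Ord l r n (fun x => c * f x) :=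
  IsBigO.const_mul_left hf c

theorem zero : Ord l r n (fun _ => (0 : 𝕜)) := isBigO_zero _ _

theorem mono (hf : Ord l r m f) (hr : Ord l r 0 r) (h : n ≤ m) : Ord l r n f := by
  obtain ⟨k, rfl⟩ := Nat.exists_eq_add_of_le h
  refine IsBigO.trans hf ?_
  have h1 : (fun x => r x ^ k) =O[l] (fun _ => (1 : ℝ)) := by
    simpa using IsBigO.pow (show r =O[l] fun _ => (1 : ℝ) by simpa [Ord] using hr) k
  simpa [pow_add] using (isBigO_refl (fun x => r x ^ n) l).mul h1

theorem mul_le {k : ℕ} (hf : Ord l r m f) (hr : Ord l r 0 r) (hg : Ord l r n g) (h : k ≤ m + n) :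
    Ord l r k (fun x => f x * g x) := (hf.mul hg).mono hr h

theorem pow (hf : Ord l r n f) (k : ℕ) : Ord l r (n * k) (fun x => f x ^ k) := by
  simpa only [Ord, pow_mul] using IsBigO.pow hf k

theorem congr' (hf : Ord l r n f) (h : f =ᶠ[l] g) : Ord l r n g := IsBigO.congr' hf h .rfl

theorem of_eq (hf : Ord l r n f) (h : ∀ x, f x = g x) : Ord l r n g := by
  simpa only [← funext h] using hf

theorem comp {β : Type*} {l' : Filter β} {φ : β → α} (hf : Ord l r n f) (hφ : Tendsto φ l' l) :
    Ord l' (fun x => r (φ x)) n (fun x => f (φ x)) := IsBigO.comp_tendsto hf hφ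

theorem gauge {r' : α → ℝ} (hf : Ord l r n f) (h : Ord l r' 1 r) : Ord l r' n f :=
  IsBigO.trans hf (by simpa using IsBigO.pow h n)

end Ord

/-- `f₁ + f₃ + f₅` is the expansion of `f` to order five into terms of odd order. -/
structure OddJet (l : Filter α) (r : α → ℝ) (f f₁ f₃ f₅ : α → 𝕜) : Prop where
  o1 : Ord l r 1 f₁
  o3 : Ord l r 3 f₃
  o5 : Ord l r 5 f₅
  rem : Ord l r 6 (fun x => f x - (f₁ x + f₃ x + f₅ x))

/-- `f₀ + f₂ + f₄` is the expansion of `f` to order five into terms of even order. -/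
structure EvenJet (l : Filter α) (r : α → ℝ) (f f₀ f₂ f₄ : α → 𝕜) : Prop where
  o0 : Ord l r 0 f₀
  o2 : Ord l r 2 f₂
  o4 : Ord l r 4 f₄
  rem : Ord l r 6 (fun x => f x - (f₀ x + f₂ x + f₄ x))

variable {f f₀ f₁ f₂ f₃ f₄ f₅ g g₀ g₁ g₂ g₃ g₄ g₅ : α → 𝕜}

namespace OddJet

theorem ord (hr : Ord l r 0 r) (hf : OddJet l r f f₁ f₃ f₅) : Ord l r 1 f := by
  refine (((hf.rem.mono hr (by norm_num : 1 ≤ 6)).add hf.o1).add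
    ((hf.o3.mono hr (by norm_num : 1 ≤ 3)).add (hf.o5.mono hr (by norm_num : 1 ≤ 5)))).of_eq ?_
  intro x; ring

theorem ord₅ (hr : Ord l r 0 r) (hf : OddJet l r f f₁ f₃ f₅) :
    Ord l r 5 (fun x => f x - (f₁ x + f₃ x)) := by
  refine ((hf.rem.mono hr (by norm_num : 5 ≤ 6)).add hf.o5).of_eq ?_
  intro x; ring

theorem add (hf : OddJet l r f f₁ f₃ f₅) (hg : OddJet l r g g₁ g₃ g₅) :
    OddJet l r (fun x => f x + g x) (fun x => f₁ x + g₁ x) (fun x => f₃ x + g₃ x)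
      (fun x => f₅ x + g₅ x) :=
  ⟨hf.o1.add hg.o1, hf.o3.add hg.o3, hf.o5.add hg.o5,
    (hf.rem.add hg.rem).of_eq fun x => by ring⟩

theorem neg (hf : OddJet l r f f₁ f₃ f₅) :
    OddJet l r (fun x => -f x) (fun x => -f₁ x) (fun x => -f₃ x) (fun x => -f₅ x) :=
  ⟨hf.o1.neg, hf.o3.neg, hf.o5.neg, hf.rem.neg.of_eq fun x => by ring⟩

theorem const_mul (c : 𝕜) (hf : OddJet l r f f₁ f₃ f₅) :
    OddJet l r (fun x => c * f x) (fun x => c * f₁ x) (fun x => c * f₃ x) (fun x => c * f₅ x) :=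
  ⟨hf.o1.const_mul c, hf.o3.const_mul c, hf.o5.const_mul c,
    (hf.rem.const_mul c).of_eq fun x => by ring⟩

theorem mul (hr : Ord l r 0 r) (hf : OddJet l r f f₁ f₃ f₅) (hg : OddJet l r g g₁ g₃ g₅) :
    EvenJet l r (fun x => f x * g x) (fun _ => 0) (fun x => f₁ x * g₁ x)
      (fun x => f₁ x * g₃ x + f₃ x * g₁ x) := by
  refine ⟨.zero, hf.o1.mul hg.o1, (hf.o1.mul hg.o3).add (hf.o3.mul hg.o1), ?_⟩
  have h1 := hf.rem.mul_le hr (hg.ord hr) (k := 6) (by norm_num)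
  have h2 := (((hf.o1.mono hr zero_le_one).add (hf.o3.mono hr (Nat.zero_le 3))).add
    (hf.o5.mono hr (Nat.zero_le 5))).mul_le hr hg.rem (k := 6) (by norm_num)
  have h3 := hf.o1.mul_le hr hg.o5 (k := 6) (by norm_num)
  have h4 := hf.o3.mul_le hr (hg.o3.add (hg.o5.mono hr (by norm_num : 3 ≤ 5))) (k := 6)
    (by norm_num)
  have h5 := hf.o5.mul_le hr ((hg.o1.add (hg.o3.mono hr (by norm_num : 1 ≤ 3))).add
    (hg.o5.mono hr (by norm_num : 1 ≤ 5))) (k := 6) (by norm_num)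
  exact ((((h1.add h2).add h3).add h4).add h5).of_eq fun x => by ring

theorem congr (hf : OddJet l r f f₁ f₃ f₅) (h : f =ᶠ[l] g) : OddJet l r g f₁ f₃ f₅ :=
  ⟨hf.o1, hf.o3, hf.o5, hf.rem.congr' (h.mono fun x hx => by simp only [hx])⟩

/-- Replaces the homogeneous parts by expressions that are equal to them. -/
theorem cast (hf : OddJet l r f f₁ f₃ f₅) (h₁ : ∀ x, f₁ x = g₁ x) (h₃ : ∀ x, f₃ x = g₃ x)
    (h₅ : ∀ x, f₅ x = g₅ x) : OddJet l r f g₁ g₃ g₅ := by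
  obtain rfl := funext h₁; obtain rfl := funext h₃; obtain rfl := funext h₅; exact hf

end OddJet

namespace EvenJet

theorem ord (hr : Ord l r 0 r) (hf : EvenJet l r f f₀ f₂ f₄) : Ord l r 0 f := by
  refine (((hf.rem.mono hr (Nat.zero_le 6)).add hf.o0).add
    ((hf.o2.mono hr (Nat.zero_le 2)).add (hf.o4.mono hr (Nat.zero_le 4)))).of_eq ?_
  intro x; ring

theorem ord₂ (hr : Ord l r 0 r) (hf : EvenJet l r f f₀ f₂ f₄) :
    Ord l r 2 (fun x => f x - f₀ x) := by
  refine ((hf.rem.mono hr (by norm_num : 2 ≤ 6)).add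
    (hf.o2.add (hf.o4.mono hr (by norm_num : 2 ≤ 4)))).of_eq ?_
  intro x; ring

theorem const (c : 𝕜) : EvenJet l r (fun _ => c) (fun _ => c) (fun _ => 0) (fun _ => 0) :=
  ⟨.const c, .zero, .zero, Ord.zero.of_eq fun x => by ring⟩

theorem add (hf : EvenJet l r f f₀ f₂ f₄) (hg : EvenJet l r g g₀ g₂ g₄) :
    EvenJet l r (fun x => f x + g x) (fun x => f₀ x + g₀ x) (fun x => f₂ x + g₂ x)
      (fun x => f₄ x + g₄ x) :=
  ⟨hf.o0.add hg.o0, hf.o2.add hg.o2, hf.o4.add hg.o4,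
    (hf.rem.add hg.rem).of_eq fun x => by ring⟩

theorem sub (hf : EvenJet l r f f₀ f₂ f₄) (hg : EvenJet l r g g₀ g₂ g₄) :
    EvenJet l r (fun x => f x - g x) (fun x => f₀ x - g₀ x) (fun x => f₂ x - g₂ x)
      (fun x => f₄ x - g₄ x) :=
  ⟨hf.o0.sub hg.o0, hf.o2.sub hg.o2, hf.o4.sub hg.o4,
    (hf.rem.sub hg.rem).of_eq fun x => by ring⟩

theorem const_mul (c : 𝕜) (hf : EvenJet l r f f₀ f₂ f₄) :
    EvenJet l r (fun x => c * f x) (fun x => c * f₀ x) (fun x => c * f₂ x) (fun x => c * f₄ x) :=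
  ⟨hf.o0.const_mul c, hf.o2.const_mul c, hf.o4.const_mul c,
    (hf.rem.const_mul c).of_eq fun x => by ring⟩

theorem mul (hr : Ord l r 0 r) (hf : EvenJet l r f f₀ f₂ f₄) (hg : EvenJet l r g g₀ g₂ g₄) :
    EvenJet l r (fun x => f x * g x) (fun x => f₀ x * g₀ x) (fun x => f₀ x * g₂ x + f₂ x * g₀ x)
      (fun x => f₀ x * g₄ x + f₂ x * g₂ x + f₄ x * g₀ x) := by
  refine ⟨hf.o0.mul hg.o0, (hf.o0.mul_le hr hg.o2 (by norm_num)).add (hf.o2.mul hg.o0),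
    ((hf.o0.mul_le hr hg.o4 (by norm_num)).add (hf.o2.mul hg.o2)).add (hf.o4.mul hg.o0), ?_⟩
  have h1 := hf.rem.mul_le hr (hg.ord hr) (k := 6) (by norm_num)
  have h2 := ((hf.o0.add (hf.o2.mono hr (Nat.zero_le 2))).add
    (hf.o4.mono hr (Nat.zero_le 4))).mul_le hr hg.rem (k := 6) (by norm_num)
  have h3 := hf.o2.mul_le hr hg.o4 (k := 6) (by norm_num)
  have h4 := hf.o4.mul_le hr (hg.o2.add (hg.o4.mono hr (by norm_num : 2 ≤ 4))) (k := 6)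
    (by norm_num)
  exact (((h1.add h2).add h3).add h4).of_eq fun x => by ring

theorem mul_odd (hr : Ord l r 0 r) (hf : EvenJet l r f f₀ f₂ f₄) (hg : OddJet l r g g₁ g₃ g₅) :
    OddJet l r (fun x => f x * g x) (fun x => f₀ x * g₁ x) (fun x => f₀ x * g₃ x + f₂ x * g₁ x)
      (fun x => f₀ x * g₅ x + f₂ x * g₃ x + f₄ x * g₁ x) := by
  refine ⟨hf.o0.mul_le hr hg.o1 (by norm_num),
    (hf.o0.mul_le hr hg.o3 (by norm_num)).add (hf.o2.mul hg.o1),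
    ((hf.o0.mul_le hr hg.o5 (by norm_num)).add (hf.o2.mul hg.o3)).add (hf.o4.mul hg.o1), ?_⟩
  have h1 := hf.rem.mul_le hr (hg.ord hr) (k := 6) (by norm_num)
  have h2 := ((hf.o0.add (hf.o2.mono hr (Nat.zero_le 2))).add
    (hf.o4.mono hr (Nat.zero_le 4))).mul_le hr hg.rem (k := 6) (by norm_num)
  have h3 := hf.o2.mul_le hr hg.o5 (k := 6) (by norm_num)
  have h4 := hf.o4.mul_le hr (hg.o3.add (hg.o5.mono hr (by norm_num : 3 ≤ 5))) (k := 6)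
    (by norm_num)
  exact (((h1.add h2).add h3).add h4).of_eq fun x => by ring

theorem congr (hf : EvenJet l r f f₀ f₂ f₄) (h : f =ᶠ[l] g) : EvenJet l r g f₀ f₂ f₄ :=
  ⟨hf.o0, hf.o2, hf.o4, hf.rem.congr' (h.mono fun x hx => by simp only [hx])⟩

/-- Replaces the homogeneous parts by expressions that are equal to them. -/
theorem cast (hf : EvenJet l r f f₀ f₂ f₄) (h₀ : ∀ x, f₀ x = g₀ x) (h₂ : ∀ x, f₂ x = g₂ x)
    (h₄ : ∀ x, f₄ x = g₄ x) : EvenJet l r f g₀ g₂ g₄ := by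
  obtain rfl := funext h₀; obtain rfl := funext h₂; obtain rfl := funext h₄; exact hf

theorem tendsto {a : 𝕜} (hr : Tendsto r l (𝓝 0)) (h0 : Ord l r 0 r)
    (hf : EvenJet l r f (fun _ => a) f₂ f₄) : Tendsto f l (𝓝 a) := by
  have h : Tendsto (fun x => f x - a) l (𝓝 0) :=
    IsBigO.trans_tendsto (hf.ord₂ h0) (by simpa using hr.pow 2)
  simpa using h.add_const a

/-- The reciprocal of an expansion with non-zero constant term. -/
theorem inv (hr : Tendsto r l (𝓝 0)) (h0 : Ord l r 0 r) {a : 𝕜} (ha : a ≠ 0)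
    (hf : EvenJet l r f (fun _ => a) f₂ f₄) :
    EvenJet l r (fun x => (f x)⁻¹) (fun _ => a⁻¹) (fun x => -(a⁻¹ ^ 2 * f₂ x))
      (fun x => a⁻¹ ^ 3 * (f₂ x * f₂ x) - a⁻¹ ^ 2 * f₄ x) := by
  have hb2 : Ord l r 2 (fun x => -(a⁻¹ ^ 2 * f₂ x)) := (hf.o2.const_mul _).neg
  have hb4 : Ord l r 4 (fun x => a⁻¹ ^ 3 * (f₂ x * f₂ x) - a⁻¹ ^ 2 * f₄ x) :=
    ((hf.o2.mul hf.o2).const_mul _).sub (hf.o4.const_mul _)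
  have hg : EvenJet l r (fun x => a⁻¹ + -(a⁻¹ ^ 2 * f₂ x)
      + (a⁻¹ ^ 3 * (f₂ x * f₂ x) - a⁻¹ ^ 2 * f₄ x)) (fun _ => a⁻¹)
      (fun x => -(a⁻¹ ^ 2 * f₂ x)) (fun x => a⁻¹ ^ 3 * (f₂ x * f₂ x) - a⁻¹ ^ 2 * f₄ x) :=
    ⟨.const _, hb2, hb4, Ord.zero.of_eq fun x => by ring⟩
  have hprod := (hf.mul h0 hg).rem
  have hlim := hf.tendsto hr h0
  have hne : ∀ᶠ x in l, f x ≠ 0 := hlim.eventually_ne ha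
  have hinv : Ord l r 0 (fun x => (f x)⁻¹) := by
    simpa [Ord] using (hlim.inv₀ ha).isBigO_one ℝ
  refine ⟨.const _, hb2, hb4, ((hinv.mul_le h0 hprod.neg (k := 6) (by norm_num)).congr' ?_)⟩
  filter_upwards [hne] with x hx
  field_simp
  ring

end EvenJet

/-- The expansion of `f ^ (-1/2)` for a real function `f` with expansion `1 + f₂ + f₄`. -/
theorem EvenJet.inv_sqrt (hr : Tendsto r l (𝓝 0)) (h0 : Ord l r 0 r) {f f₂ f₄ : α → ℝ}
    (hf : EvenJet l r f (fun _ => 1) f₂ f₄) :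
    EvenJet l r (fun x => (Real.sqrt (f x))⁻¹) (fun _ => 1) (fun x => -(1 / 2 * f₂ x))
      (fun x => 3 / 8 * (f₂ x * f₂ x) - 1 / 2 * f₄ x) := by
  have hb2 : Ord l r 2 (fun x => -(1 / 2 * f₂ x)) := (hf.o2.const_mul _).neg
  have hb4 : Ord l r 4 (fun x => 3 / 8 * (f₂ x * f₂ x) - 1 / 2 * f₄ x) :=
    ((hf.o2.mul hf.o2).const_mul _).sub (hf.o4.const_mul _)
  have hg : EvenJet l r (fun x => 1 + -(1 / 2 * f₂ x)
      + (3 / 8 * (f₂ x * f₂ x) - 1 / 2 * f₄ x)) (fun _ => 1)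
      (fun x => -(1 / 2 * f₂ x)) (fun x => 3 / 8 * (f₂ x * f₂ x) - 1 / 2 * f₄ x) :=
    ⟨.const _, hb2, hb4, Ord.zero.of_eq fun x => by ring⟩
  have hprod := (hf.mul h0 (hg.mul h0 hg)).rem
  have hlim := hf.tendsto hr h0
  have hglim := hg.tendsto hr h0
  have hpos : ∀ᶠ x in l, 0 < f x := hlim.eventually_const_lt one_pos
  have hgpos := hglim.eventually_const_lt one_pos
  have hs : Tendsto (fun x => Real.sqrt (f x)) l (𝓝 1) := by
    simpa using hlim.sqrt
  -- `f⁻¹ᐟ² - g = (1 - f g²) / (f (f⁻¹ᐟ² + g))`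
  have hd : Ord l r 0 (fun x => (f x * ((Real.sqrt (f x))⁻¹ + (1 + -(1 / 2 * f₂ x)
      + (3 / 8 * (f₂ x * f₂ x) - 1 / 2 * f₄ x))))⁻¹) := by
    have := (hlim.mul ((hs.inv₀ one_ne_zero).add hglim)).inv₀ (by norm_num)
    simpa [Ord] using this.isBigO_one ℝ
  refine ⟨.const _, hb2, hb4, ((hd.mul_le h0 hprod.neg (k := 6) (by norm_num)).congr' ?_)⟩
  filter_upwards [hpos, hgpos] with x hx hgx
  set G := 1 + -(1 / 2 * f₂ x) + (3 / 8 * (f₂ x * f₂ x) - 1 / 2 * f₄ x) with hG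
  set q := Real.sqrt (f x) with hq
  have hqpos : 0 < q := Real.sqrt_pos.2 hx
  have hqq : f x = q * q := (Real.mul_self_sqrt hx.le).symm
  rw [hqq]
  have : q⁻¹ + G ≠ 0 := by positivity
  have h1 : 1 + q * G ≠ 0 := by positivity
  field_simp
  simp only [hG]
  ring

end Jets

end Billiard

namespace Billiard

/-! ### Integration of order estimates, and smooth local inverses -/

section Calculus

theorem Ord.of_fderiv {E F : Type*} [NormedAddCommGroup E] [NormedSpace ℝ E]
    [NormedAddCommGroup F] [NormedSpace ℝ F] {f : E → F} {n : ℕ}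
    (hd : ∀ᶠ x in 𝓝 (0 : E), DifferentiableAt ℝ f x)
    (h : fderiv ℝ f =O[𝓝 0] fun x => ‖x‖ ^ n) (h0 : f 0 = 0) :
    f =O[𝓝 0] fun x => ‖x‖ ^ (n + 1) := by
  have := isBigO_norm_rpow_add_one_of_fderiv_of_apply_eq_zero (a := (0 : E)) (f := f)
    (r := (n : ℝ)) (by positivity) hd (by simpa using h) h0
  refine this.congr_right fun x => ?_
  rw [sub_zero, ← Real.rpow_natCast]
  push_cast
  rfl

theorem Ord.of_hasDerivAt {e e' : ℝ → ℝ} {n : ℕ}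
    (h : ∀ᶠ s in 𝓝 (0 : ℝ), HasDerivAt e (e' s) s) (he : Ord (𝓝 0) (fun s : ℝ => s) n e')
    (h0 : e 0 = 0) : Ord (𝓝 0) (fun s : ℝ => s) (n + 1) e := by
  have h1 : fderiv ℝ e =O[𝓝 0] fun x => ‖x‖ ^ n := by
    have h3 : fderiv ℝ e =O[𝓝 0] e' := by
      refine IsBigO.of_bound 1 ?_
      filter_upwards [h] with s hs
      have h2 : fderiv ℝ e s = ContinuousLinearMap.toSpanSingleton ℝ (e' s) :=
        hs.hasFDerivAt.fderiv
      simp [h2]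
    refine (h3.trans he).trans (IsBigO.of_bound 1 (by simp))
  refine (Ord.of_fderiv (h.mono fun s hs => hs.differentiableAt) h1 h0).trans ?_
  exact (IsBigO.of_bound 1 (by simp))

theorem contDiffAt_infty_of_hasDerivAt {f f' : ℝ → ℝ} {x : ℝ}
    (h : ∀ᶠ y in 𝓝 x, HasDerivAt f (f' y) y) (hf' : ContDiffAt ℝ ∞ f' x) :
    ContDiffAt ℝ ∞ f x := by
  refine contDiffAt_infty.2 fun n => ?_
  refine ContDiffAt.of_le (m := n) (n := n + 1) ?_ (by exact_mod_cast Nat.le_succ n)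
  refine contDiffAt_succ_iff_hasFDerivAt.2
    ⟨fun y => ContinuousLinearMap.toSpanSingleton ℝ (f' y), ⟨_, h, fun y hy => hy.hasFDerivAt⟩, ?_⟩
  have : ContDiff ℝ n (fun c : ℝ => ContinuousLinearMap.toSpanSingleton ℝ c) :=
    ((ContinuousLinearMap.toSpanSingletonLE ℝ ℝ ℝ).toLinearMap.toContinuousLinearMap).contDiff
  exact this.contDiffAt.comp x (contDiffAt_infty.1 hf' n)

/-- A smooth map germ with invertible derivative has a smooth inverse. -/
theorem exists_smooth_inverse {E : Type*} [NormedAddCommGroup E] [NormedSpace ℝ E]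
    [FiniteDimensional ℝ E] {f : E → E} (hf : ContDiffAt ℝ ∞ f 0) (h0 : f 0 = 0)
    (hdet : (fderiv ℝ f 0).det ≠ 0) :
    ∃ g : E → E, ContDiffAt ℝ ∞ g 0 ∧ g 0 = 0 ∧ (∀ᶠ x in 𝓝 0, f (g x) = x) ∧
      ∀ᶠ x in 𝓝 0, g (f x) = x := by
  have : CompleteSpace E := FiniteDimensional.complete ℝ E
  let f' : E ≃L[ℝ] E := (fderiv ℝ f 0).toContinuousLinearEquivOfDetNeZero hdet
  have hf' : HasFDerivAt f (f' : E →L[ℝ] E) 0 := by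
    have := (hf.differentiableAt (by simp)).hasFDerivAt
    simpa [f'] using this
  have hn : (∞ : WithTop ℕ∞) ≠ 0 := by simp
  have hs := hf.hasStrictFDerivAt' hf' hn
  refine ⟨hf.localInverse hf' hn, ?_, ?_, ?_, ?_⟩
  · simpa [h0] using hf.to_localInverse hf' hn
  · simpa [h0] using hf.localInverse_apply_image hf' hn
  · have := hs.eventually_right_inverse
    rwa [h0] at this
  · exact hs.eventually_left_inverse

end Calculus

/-! ### The boundary curve parametrized by arc length -/

section Curve

variable {a : ℝ → ℝ}

theorem speed_pos (a : ℝ → ℝ) (t : ℝ) : 0 < speed a t := Real.sqrt_pos.2 (by positivity)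

theorem speed_sq (a : ℝ → ℝ) (t : ℝ) : speed a t ^ 2 = 1 + deriv a t ^ 2 :=
  Real.sq_sqrt (by positivity)

theorem analyticAt_speed {t : ℝ} (ha : AnalyticAt ℝ a t) : AnalyticAt ℝ (speed a) t := by
  have h1 : AnalyticAt ℝ (fun t => 1 + deriv a t ^ 2) t := analyticAt_const.add (ha.deriv.pow 2)
  exact ((h1.contDiffAt (n := ω)).sqrt (by positivity)).analyticAt

theorem analyticAt_arcDeriv {f : ℝ → ℝ} {t : ℝ} (ha : AnalyticAt ℝ a t) (hf : AnalyticAt ℝ f t) :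
    AnalyticAt ℝ (arcDeriv a f) t :=
  hf.deriv.div (analyticAt_speed ha) (speed_pos a t).ne'

theorem hasDerivAt_arcLength (ha : AnalyticAt ℝ a 0) :
    ∀ᶠ t in 𝓝 (0 : ℝ), HasDerivAt (arcLength a) (speed a t) t := by
  have hev : ∀ᶠ t in 𝓝 (0 : ℝ), ContinuousAt (speed a) t :=
    ha.eventually_analyticAt.mono fun t ht => (analyticAt_speed ht).continuousAt
  obtain ⟨ε, hε, hball⟩ := Metric.eventually_nhds_iff_ball.1 hev
  filter_upwards [Metric.ball_mem_nhds 0 hε] with t ht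
  have hsub : Set.uIcc 0 t ⊆ Metric.ball (0 : ℝ) ε := by
    rw [← segment_eq_uIcc]
    exact (convex_ball _ _).segment_subset (Metric.mem_ball_self hε) ht
  have hcont : ContinuousOn (speed a) (Metric.ball 0 ε) :=
    fun y hy => (hball y hy).continuousWithinAt
  exact intervalIntegral.integral_hasDerivAt_right (hcont.mono hsub).intervalIntegrable
    (hcont.stronglyMeasurableAtFilter Metric.isOpen_ball _ ht) (hball t ht)

theorem contDiffAt_arcLength (ha : AnalyticAt ℝ a 0) : ContDiffAt ℝ ∞ (arcLength a) 0 :=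
  contDiffAt_infty_of_hasDerivAt (hasDerivAt_arcLength ha) (analyticAt_speed ha).contDiffAt

@[simp]
theorem arcLength_zero (a : ℝ → ℝ) : arcLength a 0 = 0 := by simp [arcLength]

/-- The inverse function `σ` of the arc length. -/
theorem exists_arcParam (ha : AnalyticAt ℝ a 0) :
    ∃ σ : ℝ → ℝ, σ 0 = 0 ∧ ContinuousAt σ 0 ∧ (∀ᶠ s in 𝓝 (0 : ℝ), arcLength a (σ s) = s) ∧
      ∀ᶠ s in 𝓝 (0 : ℝ), HasDerivAt σ (speed a (σ s))⁻¹ s := by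
  have hd : HasDerivAt (arcLength a) (speed a 0) 0 := (hasDerivAt_arcLength ha).self_of_nhds
  have hdet : (fderiv ℝ (arcLength a) 0).det ≠ 0 := by
    have : fderiv ℝ (arcLength a) 0 = speed a 0 • ContinuousLinearMap.id ℝ ℝ := by
      rw [hd.hasFDerivAt.fderiv]; ext; simp
    rw [this, ContinuousLinearMap.det]
    simp [(speed_pos a 0).ne']
  obtain ⟨σ, hσ, hσ0, hr, -⟩ := exists_smooth_inverse (contDiffAt_arcLength ha)
    (arcLength_zero a) hdet
  refine ⟨σ, hσ0, hσ.continuousAt, hr, ?_⟩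
  have hσt : Tendsto σ (𝓝 0) (𝓝 0) := by simpa [hσ0] using hσ.continuousAt.tendsto
  have hc : ∀ᶠ s in 𝓝 (0 : ℝ), ContinuousAt σ s :=
    ((hσ.of_le (m := 1) (by simp)).eventually (by simp)).mono fun s hs => hs.continuousAt
  filter_upwards [hc, hσt.eventually (hasDerivAt_arcLength ha), hr.eventually_nhds]
    with s h1 h2 h3
  exact HasDerivAt.of_local_left_inverse h1 h2 (speed_pos _ _).ne' h3

/-- Along the arc length parametrization, `arcDeriv` is the derivative. -/
theorem hasDerivAt_comp_arcParam {f σ : ℝ → ℝ} (hf : AnalyticAt ℝ f 0) (h0 : σ 0 = 0)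
    (hc : ContinuousAt σ 0) (hσ : ∀ᶠ s in 𝓝 (0 : ℝ), HasDerivAt σ (speed a (σ s))⁻¹ s) :
    ∀ᶠ s in 𝓝 (0 : ℝ), HasDerivAt (fun s => f (σ s)) (arcDeriv a f (σ s)) s := by
  have hσt : Tendsto σ (𝓝 0) (𝓝 0) := by simpa [h0] using hc.tendsto
  filter_upwards [hσ, hσt.eventually hf.eventually_analyticAt] with s h1 h2
  have := h2.differentiableAt.hasDerivAt.comp s h1
  simpa [arcDeriv, div_eq_mul_inv] using! this

end Curve

end Billiard

namespace Billiard

/-! ### Expansion of the curve in the arc length -/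

section CurveJets

/-- The germ of `f` at `0` satisfies `f (-t) = ε * f t`. -/
def HasParity (ε : ℝ) (f : ℝ → ℝ) : Prop := ∀ᶠ t in 𝓝 (0 : ℝ), f (-t) = ε * f t

theorem HasParity.deriv {ε : ℝ} {f : ℝ → ℝ} (hf : HasParity ε f) :
    HasParity (-ε) (deriv f) := by
  filter_upwards [Filter.Eventually.eventually_nhds hf] with t ht
  have h1 : _root_.deriv (fun t => f (-t)) t = _root_.deriv (fun t => ε * f t) t :=
    Filter.EventuallyEq.deriv_eq ht
  rw [deriv_comp_neg, deriv_const_mul_field] at h1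
  linarith

theorem HasParity.apply_zero {f : ℝ → ℝ} (hf : HasParity (-1) f) : f 0 = 0 := by
  have := hf.self_of_nhds
  rw [neg_zero] at this
  linarith

variable {a : ℝ → ℝ}

theorem HasParity.speed (ha : HasParity 1 a) : HasParity 1 (speed a) := by
  filter_upwards [ha.deriv] with t ht
  simp [Billiard.speed, ht]

theorem HasParity.radius (ha : HasParity 1 a) : HasParity 1 (radius a) := by
  filter_upwards [ha.speed, ha.deriv.deriv] with t h1 h2
  simp [Billiard.radius, h1, h2]

theorem HasParity.arcDeriv {ε : ℝ} {f : ℝ → ℝ} (ha : HasParity 1 a) (hf : HasParity ε f) :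
    HasParity (-ε) (arcDeriv a f) := by
  filter_upwards [ha.speed, hf.deriv] with t h1 h2
  simp only [Billiard.arcDeriv, h1, h2]
  ring

theorem hasParity_iterate_arcDeriv (ha : HasParity 1 a) (k : ℕ) :
    HasParity ((-1) ^ k) ((arcDeriv a)^[k] (radius a)) := by
  induction k with
  | zero => simpa using ha.radius
  | succ k ih =>
    rw [Function.iterate_succ_apply', pow_succ, mul_neg_one]
    exact ha.arcDeriv ih

theorem analyticAt_radius (ha : AnalyticAt ℝ a 0) (h2 : deriv (deriv a) 0 ≠ 0) :
    AnalyticAt ℝ (radius a) 0 :=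
  ((analyticAt_speed ha).pow 3).div ha.deriv.deriv h2

theorem analyticAt_iterate_arcDeriv (ha : AnalyticAt ℝ a 0) (h2 : deriv (deriv a) 0 ≠ 0) (k : ℕ) :
    AnalyticAt ℝ ((arcDeriv a)^[k] (radius a)) 0 := by
  induction k with
  | zero => exact analyticAt_radius ha h2
  | succ k ih => rw [Function.iterate_succ_apply']; exact analyticAt_arcDeriv ha ih

theorem hasDerivAt_monomial (c : ℝ) (n : ℕ) (s : ℝ) :
    HasDerivAt (fun s => c / (n + 1) * s ^ (n + 1)) (c * s ^ n) s := by
  have := (hasDerivAt_pow (n + 1) s).const_mul (c / (n + 1))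
  convert! this using 1
  push_cast
  field_simp

theorem Ord.pow_id (n : ℕ) : Ord (𝓝 (0 : ℝ)) (fun s : ℝ => s) n (fun s : ℝ => s ^ n) :=
  isBigO_refl _ _

theorem ord_id_zero : Ord (𝓝 (0 : ℝ)) (fun s : ℝ => s) 0 (fun s : ℝ => s) := by
  simpa [Ord] using (continuous_id.tendsto (0 : ℝ)).isBigO_one ℝ

theorem ord_zero_of_continuousAt {f : ℝ → ℝ} (hf : ContinuousAt f 0) :
    Ord (𝓝 (0 : ℝ)) (fun s : ℝ => s) 0 f := by
  simpa [Ord] using hf.tendsto.isBigO_one ℝ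

/-- The radius of curvature is even in the arc length, so that its expansion is determined by
the derivatives of order zero, two and four. -/
theorem radius_expansion (ha : AnalyticAt ℝ a 0) (hpar : HasParity 1 a)
    (h2 : deriv (deriv a) 0 ≠ 0) {σ : ℝ → ℝ} (h0 : σ 0 = 0)
    (hc : ContinuousAt σ 0) (hσ : ∀ᶠ s in 𝓝 (0 : ℝ), HasDerivAt σ (speed a (σ s))⁻¹ s) :
    Ord (𝓝 (0 : ℝ)) (fun s : ℝ => s) 6 (fun s => radius a (σ s) - (radius a 0
      + ((arcDeriv a)^[2] (radius a)) 0 / 2 * s ^ 2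
      + ((arcDeriv a)^[4] (radius a)) 0 / 24 * s ^ 4)) := by
  set ρ : ℕ → ℝ → ℝ := fun k s => ((arcDeriv a)^[k] (radius a)) (σ s) with hρ
  have hd (k : ℕ) : ∀ᶠ s in 𝓝 (0 : ℝ), HasDerivAt (ρ k) (ρ (k + 1) s) s := by
    have := hasDerivAt_comp_arcParam (analyticAt_iterate_arcDeriv ha h2 k) h0 hc hσ
    simpa only [hρ, Function.iterate_succ_apply'] using this
  have hodd (k : ℕ) (hk : Odd k) : ρ k 0 = 0 := by
    have := hasParity_iterate_arcDeriv hpar k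
    rw [hk.neg_one_pow] at this
    simpa [hρ, h0] using this.apply_zero
  have e6 : Ord (𝓝 (0 : ℝ)) (fun s : ℝ => s) 0 (ρ 6) :=
    ord_zero_of_continuousAt (hd 6).self_of_nhds.continuousAt
  have e5 := Ord.of_hasDerivAt (hd 5) e6 (hodd 5 (by decide))
  have e4 : Ord (𝓝 (0 : ℝ)) (fun s : ℝ => s) 2 (fun s => ρ 4 s - ρ 4 0) :=
    Ord.of_hasDerivAt ((hd 4).mono fun s hs => hs.sub_const _) e5 (sub_self _)
  have e3 : Ord (𝓝 (0 : ℝ)) (fun s : ℝ => s) 3 (fun s => ρ 3 s - ρ 4 0 * s) :=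
    Ord.of_hasDerivAt ((hd 3).mono fun s hs => by
      simpa using hs.fun_sub ((hasDerivAt_id' s).const_mul (ρ 4 0))) e4
      (by simp [hodd 3 (by decide)])
  have e2 : Ord (𝓝 (0 : ℝ)) (fun s : ℝ => s) 4 (fun s => ρ 2 s - ρ 2 0 - ρ 4 0 / 2 * s ^ 2) :=
    Ord.of_hasDerivAt ((hd 2).mono fun s hs => by
      have := (hs.sub_const (ρ 2 0)).fun_sub (hasDerivAt_monomial (ρ 4 0) 1 s)
      norm_num at this; exact this) e3 (by simp)
  have e1 : Ord (𝓝 (0 : ℝ)) (fun s : ℝ => s) 5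
      (fun s => ρ 1 s - ρ 2 0 * s - ρ 4 0 / 6 * s ^ 3) :=
    Ord.of_hasDerivAt ((hd 1).mono fun s hs => by
      have := (hs.fun_sub ((hasDerivAt_id' s).const_mul (ρ 2 0))).fun_sub
        (hasDerivAt_monomial (ρ 4 0 / 2) 2 s)
      convert! this using 1
      · ext s; push_cast; ring
      · ring) e2 (by simp [hodd 1 (by decide)])
  have e0 : Ord (𝓝 (0 : ℝ)) (fun s : ℝ => s) 6
      (fun s => ρ 0 s - ρ 0 0 - ρ 2 0 / 2 * s ^ 2 - ρ 4 0 / 24 * s ^ 4) :=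
    Ord.of_hasDerivAt ((hd 0).mono fun s hs => by
      have := ((hs.sub_const (ρ 0 0)).fun_sub (hasDerivAt_monomial (ρ 2 0) 1 s)).fun_sub
        (hasDerivAt_monomial (ρ 4 0 / 6) 3 s)
      convert! this using 1
      · ext s; push_cast; ring
      · rw [zero_add]; ring) e1 (by simp)
  refine e0.of_eq fun s => ?_
  simp only [hρ, h0, Function.iterate_zero, id]
  ring

theorem hasDerivAt_speed {t : ℝ} (ha : AnalyticAt ℝ a t) :
    HasDerivAt (speed a) (deriv a t * deriv (deriv a) t / speed a t) t := by
  have h1 : HasDerivAt (fun t => 1 + deriv a t ^ 2) (2 * deriv a t * deriv (deriv a) t) t := by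
    simpa using (ha.deriv.differentiableAt.hasDerivAt.fun_pow 2).const_add 1
  refine (h1.sqrt (by positivity)).congr_deriv ?_
  change _ / (2 * speed a t) = _
  have hs := speed_pos a t
  field_simp

/-- The derivative of `a' / √(1 + a'²)`, the sine of the angle of the tangent, along the curve. -/
theorem arcDeriv_sin {t : ℝ} (ha : AnalyticAt ℝ a t) :
    arcDeriv a (fun t => deriv a t / speed a t) t = (radius a t)⁻¹ * (speed a t)⁻¹ := by
  have hs := speed_pos a t
  have h1 := ha.deriv.differentiableAt.hasDerivAt
  have h2 := hasDerivAt_speed ha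
  have h3 := (h1.div h2 hs.ne').deriv
  simp only [arcDeriv, radius]
  rw [show deriv (fun t => deriv a t / speed a t) t = _ from h3]
  have h4 := speed_sq a t
  field_simp
  linear_combination deriv (deriv a) t * h4

/-- The derivative of `1 / √(1 + a'²)`, the cosine of the angle of the tangent, along the
curve. -/
theorem arcDeriv_cos {t : ℝ} (ha : AnalyticAt ℝ a t) :
    arcDeriv a (fun t => (speed a t)⁻¹) t = -((radius a t)⁻¹ * (deriv a t / speed a t)) := by
  have hs := speed_pos a t
  have h1 := ha.deriv.differentiableAt.hasDerivAt
  have h2 := hasDerivAt_speed ha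
  have h3 := (h2.inv hs.ne').deriv
  simp only [arcDeriv, radius]
  rw [show deriv (fun t => (speed a t)⁻¹) t = _ from h3]
  field_simp

end CurveJets

end Billiard

namespace Billiard

/-! ### Coefficients of the boundary curve -/

section CurveJets

/-- Expansion of the solution of `S' = κ C`, `C' = -κ S`, `S 0 = 0`, `C 0 = 1` for an even
coefficient `κ`, by comparing it repeatedly with the polynomial solution. -/
theorem frame_expansion {κ S C : ℝ → ℝ} {k₀ k₂ k₄ a₁ a₃ a₅ c₂ c₄ : ℝ}
    (hκ : Ord (𝓝 (0 : ℝ)) (fun s : ℝ => s) 6 (fun s => κ s - (k₀ + k₂ * s ^ 2 + k₄ * s ^ 4)))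
    (hS : ∀ᶠ s in 𝓝 (0 : ℝ), HasDerivAt S (κ s * C s) s)
    (hC : ∀ᶠ s in 𝓝 (0 : ℝ), HasDerivAt C (-(κ s * S s)) s) (hS0 : S 0 = 0) (hC0 : C 0 = 1)
    (ha₁ : a₁ = k₀) (hc₂ : 2 * c₂ = -(k₀ * a₁)) (ha₃ : 3 * a₃ = k₂ + k₀ * c₂)
    (hc₄ : 4 * c₄ = -(k₀ * a₃ + k₂ * a₁)) (ha₅ : 5 * a₅ = k₄ + k₂ * c₂ + k₀ * c₄) :
    Ord (𝓝 (0 : ℝ)) (fun s : ℝ => s) 6 (fun s => S s - (a₁ * s + a₃ * s ^ 3 + a₅ * s ^ 5)) ∧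
    Ord (𝓝 (0 : ℝ)) (fun s : ℝ => s) 6 (fun s => C s - (1 + c₂ * s ^ 2 + c₄ * s ^ 4)) := by
  have hr := ord_id_zero
  have cont {p : ℝ → ℝ} (hp : Continuous p) : Ord (𝓝 (0 : ℝ)) (fun s : ℝ => s) 0 p :=
    ord_zero_of_continuousAt hp.continuousAt
  have κ0 : Ord (𝓝 (0 : ℝ)) (fun s : ℝ => s) 0 κ :=
    ((hκ.mono hr (Nat.zero_le 6)).add (cont (p := fun s => k₀ + k₂ * s ^ 2 + k₄ * s ^ 4)
      (by fun_prop))).of_eq fun s => by ring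
  set eS : ℝ → ℝ := fun s => S s - (a₁ * s + a₃ * s ^ 3 + a₅ * s ^ 5) with heS
  set eC : ℝ → ℝ := fun s => C s - (1 + c₂ * s ^ 2 + c₄ * s ^ 4) with heC
  have dS : ∀ᶠ s in 𝓝 (0 : ℝ), HasDerivAt eS
      (κ s * C s - (a₁ + 3 * a₃ * s ^ 2 + 5 * a₅ * s ^ 4)) s := by
    filter_upwards [hS] with s hs
    refine (hs.fun_sub ((((hasDerivAt_id' s).const_mul a₁).fun_add
      ((hasDerivAt_pow 3 s).const_mul a₃)).fun_add
      ((hasDerivAt_pow 5 s).const_mul a₅))).congr_deriv ?_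
    push_cast; ring
  have dC : ∀ᶠ s in 𝓝 (0 : ℝ), HasDerivAt eC
      (-(κ s * S s) - (2 * c₂ * s + 4 * c₄ * s ^ 3)) s := by
    filter_upwards [hC] with s hs
    refine (hs.fun_sub ((((hasDerivAt_pow 2 s).const_mul c₂).const_add 1).fun_add
      ((hasDerivAt_pow 4 s).const_mul c₄))).congr_deriv ?_
    push_cast; ring
  have step (n : ℕ) (hn : n ≤ 5) (h1 : Ord (𝓝 (0 : ℝ)) (fun s : ℝ => s) n eS)
      (h2 : Ord (𝓝 (0 : ℝ)) (fun s : ℝ => s) n eC) :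
      Ord (𝓝 (0 : ℝ)) (fun s : ℝ => s) (n + 1) eS ∧
      Ord (𝓝 (0 : ℝ)) (fun s : ℝ => s) (n + 1) eC := by
    constructor
    · refine Ord.of_hasDerivAt dS ?_ (by simp [heS, hS0])
      have t1 := κ0.mul_le hr h2 (k := n) (by omega)
      have t2 := (cont (p := fun s => 1 + c₂ * s ^ 2 + c₄ * s ^ 4) (by fun_prop)).mul_le hr hκ
        (k := n) (by omega)
      have t3 := (cont (p := fun s => (k₂ * c₄ + k₄ * c₂) + k₄ * c₄ * s ^ 2)
        (by fun_prop)).mul_le hr (Ord.pow_id 6) (k := n) (by omega)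
      refine ((t1.add t2).add t3).of_eq fun s => ?_
      simp only [heC]
      linear_combination ha₁ + s ^ 2 * ha₃ + s ^ 4 * ha₅
    · refine Ord.of_hasDerivAt dC ?_ (by simp [heC, hC0])
      have t1 := κ0.mul_le hr h1 (k := n) (by omega)
      have t2 := (cont (p := fun s => a₁ * s + a₃ * s ^ 3 + a₅ * s ^ 5) (by fun_prop)).mul_le hr hκ
        (k := n) (by omega)
      have t3 := (cont (p := fun s => (k₀ * a₅ + k₂ * a₃ + k₄ * a₁)
        + (k₂ * a₅ + k₄ * a₃) * s ^ 2 + k₄ * a₅ * s ^ 4)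
        (by fun_prop)).mul_le hr (Ord.pow_id 5) (k := n) (by omega)
      refine (((t1.add t2).add t3).neg).of_eq fun s => ?_
      simp only [heS]
      linear_combination s * hc₂ + s ^ 3 * hc₄
  have h0 : Ord (𝓝 (0 : ℝ)) (fun s : ℝ => s) 0 eS ∧ Ord (𝓝 (0 : ℝ)) (fun s : ℝ => s) 0 eC :=
    ⟨ord_zero_of_continuousAt dS.self_of_nhds.continuousAt,
      ord_zero_of_continuousAt dC.self_of_nhds.continuousAt⟩
  have h1 := step 0 (by norm_num) h0.1 h0.2
  have h2 := step 1 (by norm_num) h1.1 h1.2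
  have h3 := step 2 (by norm_num) h2.1 h2.2
  have h4 := step 3 (by norm_num) h3.1 h3.2
  have h5 := step 4 (by norm_num) h4.1 h4.2
  exact step 5 (by norm_num) h5.1 h5.2

/-- A curve `(A s, σ s)`, parametrized by its arc length, with unit tangent `(S s, C s)`, whose
radius of curvature is `R + P s² / 2 + Q s⁴ / 24 + O(s⁶)`. -/
structure CurveExpansion (R P Q : ℝ) (A σ S C : ℝ → ℝ) : Prop where
  A_rem : Ord (𝓝 (0 : ℝ)) (fun s : ℝ => s) 6 (fun s => A s - (1 / (2 * R) * s ^ 2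
    + (-1 / (24 * R ^ 3) - P / (24 * R ^ 2)) * s ^ 4))
  σ_rem : Ord (𝓝 (0 : ℝ)) (fun s : ℝ => s) 6 (fun s => σ s - (s + -1 / (6 * R ^ 2) * s ^ 3
    + (1 / (120 * R ^ 4) + P / (30 * R ^ 3)) * s ^ 5))
  S_rem : Ord (𝓝 (0 : ℝ)) (fun s : ℝ => s) 6 (fun s => S s - (1 / R * s
    + (-1 / (6 * R ^ 3) - P / (6 * R ^ 2)) * s ^ 3
    + (1 / (120 * R ^ 5) + P / (12 * R ^ 4) + P ^ 2 / (20 * R ^ 3) - Q / (120 * R ^ 2)) * s ^ 5))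
  C_rem : Ord (𝓝 (0 : ℝ)) (fun s : ℝ => s) 6 (fun s => C s - (1 + -1 / (2 * R ^ 2) * s ^ 2
    + (1 / (24 * R ^ 4) + P / (6 * R ^ 3)) * s ^ 4))

/-- The boundary curve in the arc length parameter: its tangent solves the Frenet equations, whose
curvature is the reciprocal of the expansion of the radius, and is then integrated. -/
theorem exists_curveExpansion {a : ℝ → ℝ} (ha : AnalyticAt ℝ a 0) (hpar : HasParity 1 a)
    (ha0 : a 0 = 0) (hR : 0 < radius a 0) :
    ∃ σ : ℝ → ℝ, σ 0 = 0 ∧ ContinuousAt σ 0 ∧ (∀ᶠ s in 𝓝 (0 : ℝ), arcLength a (σ s) = s) ∧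
      CurveExpansion (radius a 0) (((arcDeriv a)^[2] (radius a)) 0)
        (((arcDeriv a)^[4] (radius a)) 0) (fun s => a (σ s)) σ
        (fun s => deriv a (σ s) / speed a (σ s)) (fun s => (speed a (σ s))⁻¹) := by
  have h2 : deriv (deriv a) 0 ≠ 0 := fun h => by simp [radius, h] at hR
  obtain ⟨σ, h0, hc, hinv, hσ⟩ := exists_arcParam ha
  refine ⟨σ, h0, hc, hinv, ?_⟩
  have hr := ord_id_zero
  have hexp := radius_expansion ha hpar h2 h0 hc hσ
  set R := radius a 0 with hRdef
  set P := ((arcDeriv a)^[2] (radius a)) 0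
  set Q := ((arcDeriv a)^[4] (radius a)) 0
  have hjet : EvenJet (𝓝 (0 : ℝ)) (fun s : ℝ => s) (fun s => radius a (σ s)) (fun _ => R)
      (fun s => P / 2 * s ^ 2) (fun s => Q / 24 * s ^ 4) :=
    ⟨.const _, (Ord.pow_id 2).const_mul _, (Ord.pow_id 4).const_mul _, hexp⟩
  have hκ := (hjet.inv tendsto_id hr hR.ne').rem
  have hd0 : deriv a 0 = 0 := by
    have := hpar.deriv.apply_zero
    simpa using this
  have hs0 : speed a 0 = 1 := by simp [speed, hd0]
  have hσt : Tendsto σ (𝓝 0) (𝓝 0) := by simpa [h0] using hc.tendsto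
  have hana := hσt.eventually ha.eventually_analyticAt
  have hsp := analyticAt_speed ha
  have hS : ∀ᶠ s in 𝓝 (0 : ℝ), HasDerivAt (fun s => deriv a (σ s) / speed a (σ s))
      ((radius a (σ s))⁻¹ * (speed a (σ s))⁻¹) s := by
    filter_upwards [hasDerivAt_comp_arcParam (ha.deriv.div hsp (speed_pos a 0).ne') h0 hc hσ, hana]
      with s h h'
    exact h.congr_deriv (arcDeriv_sin h')
  have hC : ∀ᶠ s in 𝓝 (0 : ℝ), HasDerivAt (fun s => (speed a (σ s))⁻¹)
      (-((radius a (σ s))⁻¹ * (deriv a (σ s) / speed a (σ s)))) s := by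
    filter_upwards [hasDerivAt_comp_arcParam (hsp.inv (speed_pos a 0).ne') h0 hc hσ, hana]
      with s h h'
    exact h.congr_deriv (arcDeriv_cos h')
  have hframe := frame_expansion (κ := fun s => (radius a (σ s))⁻¹) (k₀ := 1 / R)
    (k₂ := -P / (2 * R ^ 2)) (k₄ := -Q / (24 * R ^ 2) + P ^ 2 / (4 * R ^ 3))
    (a₁ := 1 / R) (a₃ := -1 / (6 * R ^ 3) - P / (6 * R ^ 2))
    (a₅ := 1 / (120 * R ^ 5) + P / (12 * R ^ 4) + P ^ 2 / (20 * R ^ 3) - Q / (120 * R ^ 2))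
    (c₂ := -1 / (2 * R ^ 2)) (c₄ := 1 / (24 * R ^ 4) + P / (6 * R ^ 3))
    (hκ.of_eq fun s => by field_simp; ring) hS hC (by simp [h0, hd0]) (by simp [h0, hs0]) rfl
    (by field_simp) (by field_simp; ring) (by field_simp; ring) (by field_simp; ring)
  refine ⟨?_, ?_, hframe.1, hframe.2⟩
  · refine Ord.of_hasDerivAt (n := 5) (e' := fun s => deriv a (σ s) / speed a (σ s) - (1 / R * s
      + (-1 / (6 * R ^ 3) - P / (6 * R ^ 2)) * s ^ 3)) ?_ ?_ (by simp [h0, ha0])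
    · filter_upwards [hasDerivAt_comp_arcParam ha h0 hc hσ] with s hs
      refine (hs.fun_sub (((hasDerivAt_pow 2 s).const_mul _).fun_add
        ((hasDerivAt_pow 4 s).const_mul _))).congr_deriv ?_
      simp only [arcDeriv]
      push_cast; ring
    · refine ((hframe.1.mono hr (by norm_num : 5 ≤ 6)).add ((Ord.pow_id 5).const_mul
        (1 / (120 * R ^ 5) + P / (12 * R ^ 4) + P ^ 2 / (20 * R ^ 3) - Q / (120 * R ^ 2)))).of_eq
        fun s => by ring
  · refine (Ord.of_hasDerivAt (n := 6) (e' := fun s => (speed a (σ s))⁻¹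
      - (1 + -1 / (2 * R ^ 2) * s ^ 2 + (1 / (24 * R ^ 4) + P / (6 * R ^ 3)) * s ^ 4)) ?_ hframe.2
      (by simp [h0])).mono hr (by norm_num)
    filter_upwards [hσ] with s hs
    refine (hs.fun_sub (((hasDerivAt_id' s).fun_add ((hasDerivAt_pow 3 s).const_mul _)).fun_add
      ((hasDerivAt_pow 5 s).const_mul _))).congr_deriv ?_
    push_cast; ring

end CurveJets

end Billiard

namespace Billiard

/-! ### Expansion of the generating function -/

section Generating

/-- The derivative `∂/∂s` of `p (s⁴ + t⁴) + q (s³ t + s t³) + m s² t²`. -/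
def cubicPart {𝕜 : Type*} [CommRing 𝕜] (p q m s t : 𝕜) : 𝕜 :=
  4 * p * s ^ 3 + q * (3 * s ^ 2 * t + t ^ 3) + 2 * m * s * t ^ 2

/-- The derivative `∂/∂s` of
`e₀ (s⁶ + t⁶) + e₁ (s⁵ t + s t⁵) + e₂ (s⁴ t² + s² t⁴) + e₃ s³ t³`. -/
def quinticPart {𝕜 : Type*} [CommRing 𝕜] (e₀ e₁ e₂ e₃ s t : 𝕜) : 𝕜 :=
  6 * e₀ * s ^ 5 + e₁ * (5 * s ^ 4 * t + t ^ 5) + e₂ * (4 * s ^ 3 * t ^ 2 + 2 * s * t ^ 4)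
    + 3 * e₃ * s ^ 2 * t ^ 3

/-- Coefficients of the generating function of a billiard map, that is, of the chord length
`H (s, t) = H₀ + α (s² + t²) / 2 + β s t + p (s⁴ + t⁴) + q (s³ t + s t³) + m s² t² + ⋯`
as a function of the arc lengths `s`, `t` of its end points. -/
structure GenCoeffs where
  (α β p q m e₀ e₁ e₂ e₃ : ℝ)

/-- The coefficients of the chord length of the table with parameters `L`, `R`, `P = R''`,
`Q = R⁽⁴⁾`. -/
noncomputable def genCoeffs (L R P Q : ℝ) : GenCoeffs where
  α := 1 / L - 1 / R
  β := 1 / L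
  p := -1 / (8 * L ^ 3) + 1 / (4 * L ^ 2 * R) - 1 / (6 * L * R ^ 2) + 1 / (24 * R ^ 3)
    + P / (24 * R ^ 2)
  q := -1 / (2 * L ^ 3) + 1 / (2 * L ^ 2 * R) - 1 / (6 * L * R ^ 2)
  m := -3 / (4 * L ^ 3) + 1 / (2 * L ^ 2 * R)
  e₀ := 1 / (16 * L ^ 5) - 3 / (16 * L ^ 4 * R) + 5 / (24 * L ^ 3 * R ^ 2)
    - 5 / (48 * L ^ 2 * R ^ 3) - P / (48 * L ^ 2 * R ^ 2) + 1 / (45 * L * R ^ 4)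
    + P / (30 * L * R ^ 3) - 1 / (720 * R ^ 5) - P / (72 * R ^ 4) - P ^ 2 / (120 * R ^ 3)
    + Q / (720 * R ^ 2)
  e₁ := 3 / (8 * L ^ 5) - 3 / (4 * L ^ 4 * R) + 1 / (2 * L ^ 3 * R ^ 2) - 1 / (8 * L ^ 2 * R ^ 3)
    - P / (24 * L ^ 2 * R ^ 2) + 1 / (120 * L * R ^ 4) + P / (30 * L * R ^ 3)
  e₂ := 15 / (16 * L ^ 5) - 21 / (16 * L ^ 4 * R) + 5 / (8 * L ^ 3 * R ^ 2)
    - 5 / (48 * L ^ 2 * R ^ 3) - P / (48 * L ^ 2 * R ^ 2)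
  e₃ := 5 / (4 * L ^ 5) - 3 / (2 * L ^ 4 * R) + 2 / (3 * L ^ 3 * R ^ 2) - 1 / (6 * L ^ 2 * R ^ 3)
    + 1 / (36 * L * R ^ 4)

variable {β : Type*} {l : Filter β} {r : β → ℝ}

/-- Expansion of the momentum of the chord between the points with arc lengths `s` and `t` of the
two curves, from the expansions of the curves. The left curve is run through downwards, whence
the sign of `s`. -/
theorem CurveExpansion.momentum {R P Q L : ℝ} {A σ S C : ℝ → ℝ}
    (h : CurveExpansion R P Q A σ S C) (hL : 0 < L) (hR : 0 < R) (hr : Tendsto r l (𝓝 0))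
    {s t : β → ℝ} (hs0 : Tendsto s l (𝓝 0)) (ht0 : Tendsto t l (𝓝 0)) (hs : Ord l r 1 s)
    (ht : Ord l r 1 t) :
    OddJet l r (fun x => (S (s x) * (L - A (s x) - A (t x)) + C (s x) * (σ (t x) - σ (s x))) /
        Real.sqrt ((L - A (s x) - A (t x)) ^ 2 + (σ (t x) - σ (s x)) ^ 2))
      (fun x => (genCoeffs L R P Q).α * (-s x) + (genCoeffs L R P Q).β * t x)
      (fun x => cubicPart (genCoeffs L R P Q).p (genCoeffs L R P Q).q (genCoeffs L R P Q).m
        (-s x) (t x))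
      (fun x => quinticPart (genCoeffs L R P Q).e₀ (genCoeffs L R P Q).e₁ (genCoeffs L R P Q).e₂
        (genCoeffs L R P Q).e₃ (-s x) (t x)) := by
  have h0 : Ord l r 0 r := by simpa [Ord] using hr.isBigO_one ℝ
  have jet_even {f : ℝ → ℝ} {c₀ c₂ c₄ : ℝ} {u : β → ℝ} (hu0 : Tendsto u l (𝓝 0))
      (hu : Ord l r 1 u) (hf : Ord (𝓝 (0 : ℝ)) (fun s : ℝ => s) 6
        (fun s => f s - (c₀ + c₂ * s ^ 2 + c₄ * s ^ 4))) :
      EvenJet l r (fun x => f (u x)) (fun _ => c₀) (fun x => c₂ * u x ^ 2)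
        (fun x => c₄ * u x ^ 4) :=
    ⟨.const _, (hu.pow 2).const_mul _, (hu.pow 4).const_mul _, (hf.comp hu0).gauge hu⟩
  have jet_odd {f : ℝ → ℝ} {c₁ c₃ c₅ : ℝ} {u : β → ℝ} (hu0 : Tendsto u l (𝓝 0))
      (hu : Ord l r 1 u) (hf : Ord (𝓝 (0 : ℝ)) (fun s : ℝ => s) 6
        (fun s => f s - (c₁ * s + c₃ * s ^ 3 + c₅ * s ^ 5))) :
      OddJet l r (fun x => f (u x)) (fun x => c₁ * u x) (fun x => c₃ * u x ^ 3)
        (fun x => c₅ * u x ^ 5) :=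
    ⟨hu.const_mul _, (hu.pow 3).const_mul _, (hu.pow 5).const_mul _, (hf.comp hu0).gauge hu⟩
  have hA : Ord (𝓝 (0 : ℝ)) (fun s : ℝ => s) 6 (fun s => A s - (0 + 1 / (2 * R) * s ^ 2
    + (-1 / (24 * R ^ 3) - P / (24 * R ^ 2)) * s ^ 4)) := by simpa using h.A_rem
  have hσ : Ord (𝓝 (0 : ℝ)) (fun s : ℝ => s) 6 (fun s => σ s - (1 * s + -1 / (6 * R ^ 2) * s ^ 3
    + (1 / (120 * R ^ 4) + P / (30 * R ^ 3)) * s ^ 5)) := by simpa only [one_mul] using h.σ_rem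
  have jX := ((EvenJet.const (l := l) (r := r) L).sub (jet_even hs0 hs hA)).sub
    (jet_even ht0 ht hA)
  have jY := (jet_odd ht0 ht hσ).add (jet_odd hs0 hs hσ).neg
  have jE := ((jX.mul h0 jX).add (jY.mul h0 jY)).const_mul (L⁻¹ ^ 2)
  have jD := ((jE.cast (g₀ := fun _ => 1) (fun x => by field_simp; ring) (fun _ => rfl)
    (fun _ => rfl)).inv_sqrt hr h0).const_mul L⁻¹
  have jN := (jX.mul_odd h0 (jet_odd hs0 hs h.S_rem)).add
    ((jet_even hs0 hs h.C_rem).mul_odd h0 jY)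
  refine ((jD.mul_odd h0 jN).congr (Eventually.of_forall fun x => ?_)).cast (fun x => ?_)
    (fun x => ?_) (fun x => ?_)
  · have : (L - A (s x) - A (t x)) ^ 2 + (σ (t x) - σ (s x)) ^ 2
        = L ^ 2 * (L⁻¹ ^ 2 * ((L - A (s x) - A (t x)) * (L - A (s x) - A (t x)) +
          (σ (t x) + -σ (s x)) * (σ (t x) + -σ (s x)))) := by
      field_simp; ring
    simp only
    rw [this, Real.sqrt_mul (sq_nonneg L), Real.sqrt_sq hL.le, div_eq_mul_inv, mul_inv]
    ring
  · simp only [genCoeffs]; field_simp; ring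
  · simp only [genCoeffs, cubicPart]; field_simp; ring
  · simp only [genCoeffs, quinticPart]; field_simp; ring

end Generating

end Billiard

namespace Billiard

/-! ### The germ of the billiard map -/

section Germ

/-- The determinant of an endomorphism of the plane, in coordinates. -/
theorem det_prod (A : ℝ × ℝ →L[ℝ] ℝ × ℝ) :
    A.det = (A (1, 0)).1 * (A (0, 1)).2 - (A (0, 1)).1 * (A (1, 0)).2 := by
  rw [ContinuousLinearMap.det, ← LinearMap.det_toMatrix (Module.Basis.finTwoProd ℝ),
    Matrix.det_fin_two]
  simp [LinearMap.toMatrix_apply]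

theorem hasDerivAt_fst {f : ℝ → ℝ × ℝ} {f' : ℝ × ℝ} {x : ℝ} (h : HasDerivAt f f' x) :
    HasDerivAt (fun x => (f x).1) f'.1 x := by
  have h1 : HasFDerivAt (fun p : ℝ × ℝ => p.1) (ContinuousLinearMap.fst ℝ ℝ ℝ) (f x) :=
    hasFDerivAt_fst
  exact h1.comp_hasDerivAt x h

theorem hasDerivAt_snd {f : ℝ → ℝ × ℝ} {f' : ℝ × ℝ} {x : ℝ} (h : HasDerivAt f f' x) :
    HasDerivAt (fun x => (f x).2) f'.2 x := by
  have h1 : HasFDerivAt (fun p : ℝ × ℝ => p.2) (ContinuousLinearMap.snd ℝ ℝ ℝ) (f x) :=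
    hasFDerivAt_snd
  exact h1.comp_hasDerivAt x h

namespace SymmetricTable

variable (Q : SymmetricTable)

/-- The length of the chord from `γ₀ t` to `γ₁ t₁`. -/
noncomputable def chord (t t₁ : ℝ) : ℝ :=
  Real.sqrt ((Q.L - Q.a t - Q.a t₁) ^ 2 + (t₁ - t) ^ 2)

/-- The momentum `u = -cos θ` of the ray from `γ₀ t` to `γ₁ t₁`. By symmetry `momentum t₁ t` is
the momentum of the reflected ray. -/
noncomputable def momentum (t t₁ : ℝ) : ℝ :=
  (deriv Q.a t * (Q.L - Q.a t - Q.a t₁) + (t₁ - t)) / (speed Q.a t * Q.chord t t₁)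

/-- The coordinates `(s, u)` of the ray from `γ₀ t` to `γ₁ t₁`. -/
noncomputable def chart (p : ℝ × ℝ) : ℝ × ℝ := (-arcLength Q.a p.1, Q.momentum p.1 p.2)

/-- The coordinates of the ray reflected at `γ₁ t₁`, when it comes from `γ₀ t`. -/
noncomputable def image (p : ℝ × ℝ) : ℝ × ℝ := (arcLength Q.a p.2, Q.momentum p.2 p.1)

theorem chord_comm (t t₁ : ℝ) : Q.chord t t₁ = Q.chord t₁ t := by
  simp only [chord]; congr 1; ring

theorem hasParity : HasParity 1 Q.a := by
  filter_upwards [Q.even] with t ht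
  rw [ht, one_mul]

theorem deriv_a_zero : deriv Q.a 0 = 0 := by simpa using Q.hasParity.deriv.apply_zero

theorem speed_zero : speed Q.a 0 = 1 := by simp [speed, Q.deriv_a_zero]

theorem chord_zero : Q.chord 0 0 = Q.L := by simp [chord, Q.zero, Real.sqrt_sq Q.L_pos.le]

@[simp]
theorem momentum_zero : Q.momentum 0 0 = 0 := by simp [momentum, Q.deriv_a_zero]

/-- A billiard step, given the parameters `t`, `t₁` of its end points, is the chord between them;
the reflection law turns its momentum into `momentum t₁ t`. -/
theorem billiardStep_iff {t t₁ : ℝ} (h : 0 < Q.chord t t₁) (v v₁ p q : ℝ × ℝ) :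
    (BilliardStep Q t v t₁ v₁ ∧ p = (-arcLength Q.a t, -dot (Q.T₀ t) v) ∧
      q = (arcLength Q.a t₁, -dot (Q.T₁ t₁) v₁)) ↔
    (v = ((Q.chord t t₁)⁻¹ * (Q.L - Q.a t - Q.a t₁), (Q.chord t t₁)⁻¹ * (t₁ - t)) ∧
      v₁ = (2 * dot v (Q.T₁ t₁)) • Q.T₁ t₁ - v ∧
      p = Q.chart (t, t₁) ∧ q = Q.image (t, t₁)) := by
  have hs := speed_pos Q.a t
  have hs₁ := speed_pos Q.a t₁
  have hs₁' := speed_sq Q.a t₁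
  have hsq : Q.chord t t₁ ^ 2 = (Q.L - Q.a t - Q.a t₁) ^ 2 + (t₁ - t) ^ 2 :=
    Real.sq_sqrt (by positivity)
  have key : BilliardStep Q t v t₁ v₁ ↔
      (v = ((Q.chord t t₁)⁻¹ * (Q.L - Q.a t - Q.a t₁), (Q.chord t t₁)⁻¹ * (t₁ - t)) ∧
      v₁ = (2 * dot v (Q.T₁ t₁)) • Q.T₁ t₁ - v) := by
    constructor
    · rintro ⟨h1, ⟨d, hd, hdv⟩, h3⟩
      refine ⟨?_, h3⟩
      have e1 : d * v.1 = Q.L - Q.a t - Q.a t₁ := by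
        have := congrArg Prod.fst hdv
        simp only [γ₀, γ₁, Prod.fst_add, Prod.smul_fst, smul_eq_mul] at this
        linarith
      have e2 : d * v.2 = t₁ - t := by
        have := congrArg Prod.snd hdv
        simp only [γ₀, γ₁, Prod.snd_add, Prod.smul_snd, smul_eq_mul] at this
        linarith
      have hdc : Q.chord t t₁ = d := by
        simp only [dot] at h1
        rw [chord, ← e1, ← e2, show (d * v.1) ^ 2 + (d * v.2) ^ 2 = d ^ 2 by
          linear_combination d ^ 2 * h1, Real.sqrt_sq hd.le]
      rw [hdc, ← e1, ← e2]
      ext <;> field_simp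
    · rintro ⟨rfl, h3⟩
      refine ⟨?_, ⟨Q.chord t t₁, h, ?_⟩, h3⟩
      · simp only [dot]; field_simp; linarith
      · ext
        · simp only [γ₀, γ₁, Prod.fst_add, Prod.smul_fst, smul_eq_mul]
          field_simp; ring
        · simp only [γ₀, γ₁, Prod.snd_add, Prod.smul_snd, smul_eq_mul]
          field_simp; ring
  rw [key, and_assoc]
  refine and_congr_right fun hv => and_congr_right fun hv₁ => ?_
  have m0 : -dot (Q.T₀ t) v = Q.momentum t t₁ := by
    rw [hv]; simp only [dot, T₀, momentum]; field_simp; ring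
  have m1 : -dot (Q.T₁ t₁) v₁ = Q.momentum t₁ t := by
    rw [hv₁, hv]
    simp only [dot, T₁, momentum, Prod.fst_sub, Prod.snd_sub, Prod.smul_fst, Prod.smul_snd,
      smul_eq_mul, Q.chord_comm t₁ t]
    field_simp
    rw [hs₁']
    ring
  rw [m0, m1]
  rfl

theorem contDiffAt_chord : ContDiffAt ℝ ∞ (fun p : ℝ × ℝ => Q.chord p.1 p.2) 0 := by
  have ha : ContDiffAt ℝ ∞ Q.a 0 := Q.analytic.contDiffAt
  have h1 : ContDiffAt ℝ ∞ (fun p : ℝ × ℝ => Q.a p.1) 0 := ha.comp (0 : ℝ × ℝ) contDiffAt_fst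
  have h2 : ContDiffAt ℝ ∞ (fun p : ℝ × ℝ => Q.a p.2) 0 := ha.comp (0 : ℝ × ℝ) contDiffAt_snd
  refine ContDiffAt.sqrt ((((contDiffAt_const.sub h1).sub h2).pow 2).add
    ((contDiffAt_snd.sub contDiffAt_fst).pow 2)) ?_
  simp [Q.zero, Q.L_pos.ne']

theorem contDiffAt_momentum : ContDiffAt ℝ ∞ (fun p : ℝ × ℝ => Q.momentum p.1 p.2) 0 := by
  have ha : ContDiffAt ℝ ∞ Q.a 0 := Q.analytic.contDiffAt
  have hd : ContDiffAt ℝ ∞ (deriv Q.a) 0 := Q.analytic.deriv.contDiffAt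
  have hs : ContDiffAt ℝ ∞ (speed Q.a) 0 := (analyticAt_speed Q.analytic).contDiffAt
  have h1 : ContDiffAt ℝ ∞ (fun p : ℝ × ℝ => Q.a p.1) 0 := ha.comp (0 : ℝ × ℝ) contDiffAt_fst
  have h2 : ContDiffAt ℝ ∞ (fun p : ℝ × ℝ => Q.a p.2) 0 := ha.comp (0 : ℝ × ℝ) contDiffAt_snd
  have h3 : ContDiffAt ℝ ∞ (fun p : ℝ × ℝ => deriv Q.a p.1) 0 :=
    hd.comp (0 : ℝ × ℝ) contDiffAt_fst
  have h4 : ContDiffAt ℝ ∞ (fun p : ℝ × ℝ => speed Q.a p.1) 0 :=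
    ContDiffAt.comp (g := speed Q.a) (0 : ℝ × ℝ) hs contDiffAt_fst
  refine ContDiffAt.div ((h3.mul ((contDiffAt_const.sub h1).sub h2)).add
    (contDiffAt_snd.sub contDiffAt_fst)) (h4.mul Q.contDiffAt_chord) ?_
  simp [Q.chord_zero, Q.speed_zero, Q.L_pos.ne']

theorem contDiffAt_chart : ContDiffAt ℝ ∞ Q.chart 0 :=
  ((contDiffAt_arcLength Q.analytic).comp (0 : ℝ × ℝ) contDiffAt_fst).neg.prodMk
    Q.contDiffAt_momentum

theorem contDiffAt_image : ContDiffAt ℝ ∞ Q.image 0 := by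
  have h := Q.contDiffAt_momentum
  have hswap : ContDiffAt ℝ ∞ (fun p : ℝ × ℝ => (p.2, p.1)) 0 :=
    contDiffAt_snd.prodMk contDiffAt_fst
  exact ((contDiffAt_arcLength Q.analytic).comp (0 : ℝ × ℝ) contDiffAt_snd).prodMk
    (ContDiffAt.comp (0 : ℝ × ℝ) (g := fun p : ℝ × ℝ => Q.momentum p.1 p.2) h hswap)

@[simp]
theorem chart_zero : Q.chart 0 = 0 := by simp [chart]

@[simp]
theorem image_zero : Q.image 0 = 0 := by simp [image]

/-- The coordinates of a ray depend on its end points by a local diffeomorphism (twist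
condition). -/
theorem det_chart : (fderiv ℝ Q.chart 0).det ≠ 0 := by
  have hA := (Q.contDiffAt_chart.differentiableAt (by simp)).hasFDerivAt
  set A := fderiv ℝ Q.chart 0
  have hline (v : ℝ × ℝ) : HasDerivAt (fun τ : ℝ => Q.chart (τ • v)) (A v) 0 := by
    have h1 : HasDerivAt (fun τ : ℝ => τ • v) v 0 := by
      simpa using (hasDerivAt_id (0 : ℝ)).smul_const v
    have hA' : HasFDerivAt Q.chart A ((fun τ : ℝ => τ • v) 0) := by simpa using hA
    exact hA'.comp_hasDerivAt 0 h1
  -- the derivative is `!![-1, 0; *, 1 / L]`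
  have e1 : (A (1, 0)).1 = -1 := by
    have h := hasDerivAt_fst (hline (1, 0))
    have h2 := (hasDerivAt_arcLength Q.analytic).self_of_nhds.neg
    rw [Q.speed_zero] at h2
    exact h.unique (by simpa [chart] using! h2)
  have e2 : (A (0, 1)).1 = 0 := by
    have h := hasDerivAt_fst (hline (0, 1))
    exact h.unique (by simpa [chart] using! hasDerivAt_const (0 : ℝ) (0 : ℝ))
  have e3 : (A (0, 1)).2 = 1 / Q.L := by
    have h := hasDerivAt_snd (hline (0, 1))
    have hc : ContinuousAt (fun τ : ℝ => Q.chord 0 τ) 0 := by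
      have := Q.contDiffAt_chord.continuousAt
      exact ContinuousAt.comp (f := fun τ : ℝ => ((0 : ℝ), τ)) (x := 0) this (by fun_prop)
    have h2 : HasDerivAt (fun τ : ℝ => τ / Q.chord 0 τ) (1 / Q.L) 0 := by
      rw [hasDerivAt_iff_tendsto_slope]
      have h3 : Tendsto (fun τ => 1 / Q.chord 0 τ) (𝓝[≠] 0) (𝓝 (1 / Q.L)) := by
        have := (tendsto_const_nhds (x := (1 : ℝ))).div hc.tendsto
          (by rw [Q.chord_zero]; exact Q.L_pos.ne')
        rw [Q.chord_zero] at this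
        exact this.mono_left nhdsWithin_le_nhds
      refine h3.congr' ?_
      filter_upwards [self_mem_nhdsWithin] with τ hτ
      have : τ ≠ 0 := hτ
      simp only [slope, vsub_eq_sub, sub_zero, zero_div, smul_eq_mul]
      field_simp
    exact h.unique (by simpa [chart, momentum, Q.deriv_a_zero, Q.speed_zero] using! h2)
  rw [det_prod, e1, e2, e3]
  have := Q.L_pos
  simp [this.ne']

/-- The billiard map exists, its germ at the fixed point is unique, and it is smooth. -/
theorem exists_billiardGerm :
    ∃ F : ℝ × ℝ → ℝ × ℝ, ContDiffAt ℝ ∞ F 0 ∧ IsBilliardMap Q F ∧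
      (∀ F', IsBilliardMap Q F' → F' =ᶠ[𝓝 0] F) ∧ ∀ᶠ p in 𝓝 0, F (Q.chart p) = Q.image p := by
  obtain ⟨g, hg, hg0, hr, hl⟩ := exists_smooth_inverse Q.contDiffAt_chart Q.chart_zero Q.det_chart
  have hpos : ∀ᶠ p : ℝ × ℝ in 𝓝 0, 0 < Q.chord p.1 p.2 := by
    have := Q.contDiffAt_chord.continuousAt.tendsto
    simp only [Prod.fst_zero, Prod.snd_zero, Q.chord_zero] at this
    exact this.eventually_const_lt Q.L_pos
  have hgt : Tendsto g (𝓝 0) (𝓝 0) := by simpa [hg0] using hg.continuousAt.tendsto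
  refine ⟨fun p => Q.image (g p), ?_, ?_, ?_, ?_⟩
  · have := Q.contDiffAt_image
    rw [← hg0] at this
    exact this.comp 0 hg
  · intro ε hε
    have hball : ∀ᶠ p : ℝ × ℝ in 𝓝 0, |p.1| < ε ∧ |p.2| < ε := by
      filter_upwards [Metric.ball_mem_nhds (0 : ℝ × ℝ) hε] with p hp
      rw [mem_ball_zero_iff, Prod.norm_def, max_lt_iff] at hp
      exact hp
    filter_upwards [hgt.eventually hball, hgt.eventually hpos, hr] with p h1 h2 h3
    refine ⟨(g p).1, (g p).2, _, _, h1.1, h1.2,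
      (Q.billiardStep_iff h2 _ _ p (Q.image (g p))).2 ⟨rfl, rfl, h3.symm, rfl⟩⟩
  · intro F' hF'
    obtain ⟨ε, hε, hball⟩ := Metric.eventually_nhds_iff_ball.1 (hl.and hpos)
    filter_upwards [hF' ε hε] with p ⟨t, t₁, v, v₁, h1, h2, h3⟩
    have hmem : (t, t₁) ∈ Metric.ball (0 : ℝ × ℝ) ε := by
      rw [mem_ball_zero_iff, Prod.norm_def, max_lt_iff]
      exact ⟨h1, h2⟩
    obtain ⟨-, -, h4, h5⟩ := (Q.billiardStep_iff (hball _ hmem).2 v v₁ p (F' p)).1 h3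
    rw [h5, h4, (hball _ hmem).1]
  · filter_upwards [hl] with p hp
    rw [hp]

/-- Expansion of the billiard map along a family of orbit segments `s ↦ t`. -/
theorem exists_momentum_expansion (hR : 0 < Q.Rad 0) {F : ℝ × ℝ → ℝ × ℝ}
    (hF : ∀ᶠ p in 𝓝 0, F (Q.chart p) = Q.image p) {β : Type*} {l : Filter β} {r : β → ℝ}
    (hr : Tendsto r l (𝓝 0)) {s t : β → ℝ} (hs : Ord l r 1 s) (ht : Ord l r 1 t)
    {G : GenCoeffs} (hG : G = genCoeffs Q.L (Q.Rad 0) (Q.Rad 2) (Q.Rad 4)) :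
    ∃ u v : β → ℝ, (∀ᶠ x in l, F (s x, u x) = (t x, v x)) ∧
      OddJet l r u (fun x => G.α * s x + G.β * t x)
        (fun x => cubicPart G.p G.q G.m (s x) (t x))
        (fun x => quinticPart G.e₀ G.e₁ G.e₂ G.e₃ (s x) (t x)) ∧
      OddJet l r v (fun x => -(G.α * t x + G.β * s x))
        (fun x => -cubicPart G.p G.q G.m (t x) (s x))
        (fun x => -quinticPart G.e₀ G.e₁ G.e₂ G.e₃ (t x) (s x)) := by
  obtain ⟨σ, h0, hc, hinv, hcurve⟩ := exists_curveExpansion Q.analytic Q.hasParity Q.zero hR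
  have hσt : Tendsto σ (𝓝 0) (𝓝 0) := by simpa [h0] using hc.tendsto
  have lim {u : β → ℝ} (hu : Ord l r 1 u) : Tendsto u l (𝓝 0) :=
    IsBigO.trans_tendsto hu (by simpa using hr)
  have hs0 := lim hs
  have ht0 := lim ht
  have hs0' : Tendsto (fun x => -s x) l (𝓝 0) := by simpa using hs0.neg
  have e1 := hcurve.momentum Q.L_pos hR hr hs0' ht0 hs.neg ht
  have e2 := hcurve.momentum Q.L_pos hR hr ht0 hs0' ht hs.neg
  have hmom (t t₁ : ℝ) : Q.momentum t t₁ = (deriv Q.a t / speed Q.a t * (Q.L - Q.a t - Q.a t₁)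
      + (speed Q.a t)⁻¹ * (t₁ - t)) / Real.sqrt ((Q.L - Q.a t - Q.a t₁) ^ 2 + (t₁ - t) ^ 2) := by
    have := speed_pos Q.a t
    rw [momentum, chord, ← div_div]
    congr 1
    field_simp
  simp only [← hmom] at e1 e2
  subst hG
  refine ⟨_, _, ?_, e1.cast (fun x => ?_) (fun x => ?_) (fun x => ?_),
    e2.cast (fun x => ?_) (fun x => ?_) (fun x => ?_)⟩
  · have hp : Tendsto (fun x => (σ (-s x), σ (t x))) l (𝓝 (0 : ℝ × ℝ)) :=
      (hσt.comp hs0').prodMk_nhds (hσt.comp ht0)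
    filter_upwards [hp.eventually hF, hs0'.eventually hinv, ht0.eventually hinv] with x h1 h2 h3
    simpa [chart, image, h2, h3] using h1
  · simp only [neg_neg]; rfl
  · simp only [neg_neg]; rfl
  · simp only [neg_neg]; rfl
  · simp only [Rad, Function.iterate_zero, id]; ring
  · simp only [cubicPart, Rad, Function.iterate_zero, id]; ring
  · simp only [quinticPart, Rad, Function.iterate_zero, id]; ring

end SymmetricTable

end Germ

end Billiard

namespace Billiard

/-! ### Taylor expansion of functions on the plane -/

section Taylor

/-- The linear form on the plane with the coefficients `a` and `b`. -/
noncomputable def grad (a b : ℝ) : ℝ × ℝ →L[ℝ] ℝ :=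
  a • ContinuousLinearMap.fst ℝ ℝ ℝ + b • ContinuousLinearMap.snd ℝ ℝ ℝ

@[simp]
theorem grad_apply (a b : ℝ) (v : ℝ × ℝ) : grad a b v = a * v.1 + b * v.2 := by simp [grad]

theorem eq_grad (A : ℝ × ℝ →L[ℝ] ℝ) : A = grad (A (1, 0)) (A (0, 1)) := by
  ext <;> simp

theorem norm_grad_le (a b : ℝ) : ‖grad a b‖ ≤ |a| + |b| := by
  refine ContinuousLinearMap.opNorm_le_bound _ (by positivity) fun v => ?_
  rw [grad_apply, add_mul]
  refine (norm_add_le _ _).trans (add_le_add ?_ ?_) <;> rw [norm_mul, Real.norm_eq_abs]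
  · exact mul_le_mul_of_nonneg_left (norm_fst_le v) (abs_nonneg a)
  · exact mul_le_mul_of_nonneg_left (norm_snd_le v) (abs_nonneg b)

/-- The partial derivative with respect to the first variable. -/
noncomputable def partial₁ (g : ℝ × ℝ → ℝ) (p : ℝ × ℝ) : ℝ := fderiv ℝ g p (1, 0)

/-- The partial derivative with respect to the second variable. -/
noncomputable def partial₂ (g : ℝ × ℝ → ℝ) (p : ℝ × ℝ) : ℝ := fderiv ℝ g p (0, 1)

variable {g : ℝ × ℝ → ℝ}

theorem fderiv_eq_grad (g : ℝ × ℝ → ℝ) (p : ℝ × ℝ) :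
    fderiv ℝ g p = grad (partial₁ g p) (partial₂ g p) := eq_grad _

theorem contDiffAt_partial₁ (hg : ContDiffAt ℝ ∞ g 0) : ContDiffAt ℝ ∞ (partial₁ g) 0 :=
  (hg.fderiv_right (by simp)).clm_apply contDiffAt_const

theorem contDiffAt_partial₂ (hg : ContDiffAt ℝ ∞ g 0) : ContDiffAt ℝ ∞ (partial₂ g) 0 :=
  (hg.fderiv_right (by simp)).clm_apply contDiffAt_const

theorem contDiffAt_iterate_partial₂ (hg : ContDiffAt ℝ ∞ g 0) (k : ℕ) :
    ContDiffAt ℝ ∞ (partial₂^[k] g) 0 := by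
  induction k with
  | zero => exact hg
  | succ k ih => rw [Function.iterate_succ_apply']; exact contDiffAt_partial₂ ih

theorem eventually_differentiableAt {E F : Type*} [NormedAddCommGroup E] [NormedSpace ℝ E]
    [NormedAddCommGroup F] [NormedSpace ℝ F] {g : E → F} {x : E} (hg : ContDiffAt ℝ ∞ g x) :
    ∀ᶠ p in 𝓝 x, DifferentiableAt ℝ g p :=
  ((hg.of_le (m := 1) (by simp)).eventually (by simp)).mono fun p hp =>
    hp.differentiableAt (by simp)

theorem partial₂_congr {f g : ℝ × ℝ → ℝ} (h : f =ᶠ[𝓝 0] g) :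
    partial₂ f =ᶠ[𝓝 0] partial₂ g := by
  filter_upwards [h.fderiv (𝕜 := ℝ)] with p hp
  simp only [Billiard.partial₂, hp]

theorem partial_comm (hg : ContDiffAt ℝ ∞ g 0) :
    partial₁ (partial₂ g) =ᶠ[𝓝 0] partial₂ (partial₁ g) := by
  have h2 : ∀ᶠ p in 𝓝 (0 : ℝ × ℝ), ContDiffAt ℝ 2 g p :=
    (contDiffAt_infty.1 hg 2).eventually (by simp)
  filter_upwards [h2] with p hp
  have hd : DifferentiableAt ℝ (fderiv ℝ g) p :=
    (hp.fderiv_right (m := 1) (by norm_num)).differentiableAt (by simp)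
  have hsymm := hp.isSymmSndFDerivAt (by simp)
  have e (v w : ℝ × ℝ) : fderiv ℝ (fun q => fderiv ℝ g q v) p w = fderiv ℝ (fderiv ℝ g) p w v := by
    rw [fderiv_clm_apply hd (differentiableAt_const v)]
    simp
  change fderiv ℝ (fun q => fderiv ℝ g q (0, 1)) p (1, 0)
    = fderiv ℝ (fun q => fderiv ℝ g q (1, 0)) p (0, 1)
  rw [e, e]
  exact hsymm _ _

theorem partial_iterate_comm (hg : ContDiffAt ℝ ∞ g 0) (k : ℕ) :
    partial₁ (partial₂^[k] g) =ᶠ[𝓝 0] partial₂^[k] (partial₁ g) := by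
  induction k with
  | zero => rfl
  | succ k ih =>
    simp only [Function.iterate_succ_apply']
    exact (partial_comm (contDiffAt_iterate_partial₂ hg k)).trans
      (partial₂_congr ih)

theorem deriv_snd {p : ℝ × ℝ} (hg : DifferentiableAt ℝ g p) :
    deriv (fun u => g (p.1, u)) p.2 = partial₂ g p := by
  have h1 : HasDerivAt (fun u : ℝ => (p.1, u)) ((0 : ℝ), (1 : ℝ)) p.2 :=
    (hasDerivAt_const _ _).prodMk (hasDerivAt_id _)
  exact (HasFDerivAt.comp_hasDerivAt (l := g) (f := fun u : ℝ => (p.1, u)) p.2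
    hg.hasFDerivAt h1).deriv

theorem deriv_fst {p : ℝ × ℝ} (hg : DifferentiableAt ℝ g p) :
    deriv (fun s => g (s, p.2)) p.1 = partial₁ g p := by
  have h1 : HasDerivAt (fun s : ℝ => (s, p.2)) ((1 : ℝ), (0 : ℝ)) p.1 :=
    (hasDerivAt_id _).prodMk (hasDerivAt_const _ _)
  exact (HasFDerivAt.comp_hasDerivAt (l := g) (f := fun s : ℝ => (s, p.2)) p.1
    hg.hasFDerivAt h1).deriv

theorem iteratedDeriv_snd (hg : ContDiffAt ℝ ∞ g 0) (k : ℕ) :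
    ∀ᶠ p in 𝓝 (0 : ℝ × ℝ), iteratedDeriv k (fun u => g (p.1, u)) p.2 = (partial₂^[k] g) p := by
  induction k with
  | zero => simp
  | succ k ih =>
    filter_upwards [ih.eventually_nhds,
      eventually_differentiableAt (contDiffAt_iterate_partial₂ hg k)] with p h1 h2
    rw [iteratedDeriv_succ, Function.iterate_succ_apply', ← deriv_snd h2]
    refine Filter.EventuallyEq.deriv_eq ?_
    have hc : ContinuousAt (fun u : ℝ => (p.1, u)) p.2 := by fun_prop
    exact hc.eventually h1

theorem taylorCoeff_zero (g : ℝ × ℝ → ℝ) : taylorCoeff g 0 0 = g 0 := by simp [taylorCoeff]; rfl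

theorem taylorCoeff_partial₂ (hg : ContDiffAt ℝ ∞ g 0) (j k : ℕ) :
    taylorCoeff (partial₂ g) j k = (k + 1) * taylorCoeff g j (k + 1) := by
  have hs : Tendsto (fun s : ℝ => (s, (0 : ℝ))) (𝓝 0) (𝓝 (0 : ℝ × ℝ)) :=
    (by fun_prop : Continuous fun s : ℝ => (s, (0 : ℝ))).tendsto' _ _ rfl
  have h : (fun s => iteratedDeriv k (fun u => partial₂ g (s, u)) 0) =ᶠ[𝓝 0]
      fun s => iteratedDeriv (k + 1) (fun u => g (s, u)) 0 := by
    filter_upwards [hs.eventually (iteratedDeriv_snd hg (k + 1)),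
      hs.eventually (iteratedDeriv_snd (contDiffAt_partial₂ hg) k)] with s h1 h2
    exact h2.trans h1.symm
  rw [taylorCoeff, taylorCoeff, h.iteratedDeriv_eq, Nat.factorial_succ]
  have := Nat.factorial_ne_zero j
  have := Nat.factorial_ne_zero k
  push_cast
  field_simp

theorem taylorCoeff_partial₁ (hg : ContDiffAt ℝ ∞ g 0) (j k : ℕ) :
    taylorCoeff (partial₁ g) j k = (j + 1) * taylorCoeff g (j + 1) k := by
  have hs : Tendsto (fun s : ℝ => (s, (0 : ℝ))) (𝓝 0) (𝓝 (0 : ℝ × ℝ)) :=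
    (by fun_prop : Continuous fun s : ℝ => (s, (0 : ℝ))).tendsto' _ _ rfl
  have h : (fun s => iteratedDeriv k (fun u => partial₁ g (s, u)) 0) =ᶠ[𝓝 0]
      deriv fun s => iteratedDeriv k (fun u => g (s, u)) 0 := by
    filter_upwards [(hs.eventually (iteratedDeriv_snd hg k)).eventually_nhds,
      hs.eventually (iteratedDeriv_snd (contDiffAt_partial₁ hg) k),
      hs.eventually (partial_iterate_comm hg k),
      hs.eventually (eventually_differentiableAt (contDiffAt_iterate_partial₂ hg k))]
      with s h1 h2 h3 h4
    rw [Filter.EventuallyEq.deriv_eq (f := fun s => (partial₂^[k] g) (s, 0)) h1]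
    exact h2.trans (h3.symm.trans (deriv_fst h4).symm)
  rw [taylorCoeff, taylorCoeff, h.iteratedDeriv_eq, ← iteratedDeriv_succ', Nat.factorial_succ]
  have := Nat.factorial_ne_zero j
  have := Nat.factorial_ne_zero k
  push_cast
  field_simp

/-- The polynomial in two variables of degree less than `n` with coefficients `c i j`. -/
def planePoly (c : ℕ → ℕ → ℝ) (n : ℕ) (p : ℝ × ℝ) : ℝ :=
  ∑ m ∈ Finset.range n, ∑ ij ∈ Finset.HasAntidiagonal.antidiagonal m, c ij.1 ij.2 * (p.1 ^ ij.1 * p.2 ^ ij.2)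

theorem planePoly_zero (c : ℕ → ℕ → ℝ) (n : ℕ) : planePoly c (n + 1) 0 = c 0 0 := by
  have h : ∑ m ∈ Finset.range n, ∑ ij ∈ Finset.HasAntidiagonal.antidiagonal (m + 1),
      c ij.1 ij.2 * ((0 : ℝ × ℝ).1 ^ ij.1 * (0 : ℝ × ℝ).2 ^ ij.2) = 0 := by
    refine Finset.sum_eq_zero fun m _ => Finset.sum_eq_zero fun ij hij => ?_
    have : ij.1 ≠ 0 ∨ ij.2 ≠ 0 := by
      by_contra! h
      rw [Finset.HasAntidiagonal.mem_antidiagonal, h.1, h.2] at hij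
      omega
    rcases this with h | h <;> simp [h]
  rw [planePoly, Finset.sum_range_succ', h]
  simp

theorem hasFDerivAt_planePoly (c : ℕ → ℕ → ℝ) (n : ℕ) (p : ℝ × ℝ) :
    HasFDerivAt (planePoly c (n + 1)) (grad (planePoly (fun i j => (i + 1) * c (i + 1) j) n p)
      (planePoly (fun i j => (j + 1) * c i (j + 1)) n p)) p := by
  have mono (i j : ℕ) (c : ℝ) : HasFDerivAt (fun p : ℝ × ℝ => c * (p.1 ^ i * p.2 ^ j))
      (grad (c * (i * p.1 ^ (i - 1) * p.2 ^ j)) (c * (p.1 ^ i * (j * p.2 ^ (j - 1))))) p := by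
    have h1 : HasFDerivAt (fun p : ℝ × ℝ => p.1) (ContinuousLinearMap.fst ℝ ℝ ℝ) p := hasFDerivAt_fst
    have h2 : HasFDerivAt (fun p : ℝ × ℝ => p.2) (ContinuousLinearMap.snd ℝ ℝ ℝ) p := hasFDerivAt_snd
    have := ((h1.pow i).mul (h2.pow j)).const_mul c
    refine this.congr_fderiv ?_
    ext <;> simp only [ContinuousLinearMap.coe_comp, Function.comp_apply,
      ContinuousLinearMap.inl_apply, ContinuousLinearMap.inr_apply, grad_apply,
      _root_.smul_apply, _root_.add_apply, ContinuousLinearMap.coe_fst',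
      ContinuousLinearMap.coe_snd', smul_eq_mul, nsmul_eq_mul] <;> ring
  have := HasFDerivAt.fun_sum (u := Finset.range (n + 1)) fun m _ =>
    HasFDerivAt.fun_sum (u := Finset.HasAntidiagonal.antidiagonal m) fun ij _ => mono ij.1 ij.2 (c ij.1 ij.2)
  refine HasFDerivAt.congr_fderiv (f := planePoly c (n + 1)) this ?_
  ext
  · simp only [planePoly, ContinuousLinearMap.coe_comp, Function.comp_apply,
      ContinuousLinearMap.inl_apply, _root_.sum_apply, grad_apply]
    rw [Finset.sum_range_succ']
    simp only [Finset.Nat.sum_antidiagonal_succ]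
    simp
    refine Finset.sum_congr rfl fun m _ => Finset.sum_congr rfl fun ij _ => ?_
    ring
  · simp only [planePoly, ContinuousLinearMap.coe_comp, Function.comp_apply,
      ContinuousLinearMap.inr_apply, _root_.sum_apply, grad_apply]
    rw [Finset.sum_range_succ']
    simp only [Finset.Nat.sum_antidiagonal_succ']
    simp
    refine Finset.sum_congr rfl fun m _ => Finset.sum_congr rfl fun ij _ => ?_
    ring

/-- Taylor's theorem in the plane. -/
theorem taylor_plane (n : ℕ) : ∀ {g : ℝ × ℝ → ℝ}, ContDiffAt ℝ ∞ g 0 →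
    Ord (𝓝 (0 : ℝ × ℝ)) (fun p => ‖p‖) n (fun p => g p - planePoly (taylorCoeff g) n p) := by
  induction n with
  | zero =>
    intro g hg
    simpa [Ord, planePoly] using hg.continuousAt.tendsto.isBigO_one ℝ
  | succ n ih =>
    intro g hg
    have hd := eventually_differentiableAt hg
    have hf : ∀ᶠ p in 𝓝 (0 : ℝ × ℝ),
        HasFDerivAt (fun p => g p - planePoly (taylorCoeff g) (n + 1) p)
        (grad (partial₁ g p - planePoly (taylorCoeff (partial₁ g)) n p)
          (partial₂ g p - planePoly (taylorCoeff (partial₂ g)) n p)) p := by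
      filter_upwards [hd] with p hp
      have h1 := hp.hasFDerivAt
      rw [fderiv_eq_grad] at h1
      refine (h1.fun_sub (hasFDerivAt_planePoly (taylorCoeff g) n p)).congr_fderiv ?_
      rw [← funext₂ (taylorCoeff_partial₁ hg), ← funext₂ (taylorCoeff_partial₂ hg)]
      ext <;> simp
    refine Ord.of_fderiv (hf.mono fun p hp => hp.differentiableAt) ?_ ?_
    · have e1 := (ih (contDiffAt_partial₁ hg)).norm_left.add
        (ih (contDiffAt_partial₂ hg)).norm_left
      refine IsBigO.trans (IsBigO.of_bound 1 ?_) e1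
      filter_upwards [hf] with p hp
      rw [hp.fderiv, one_mul]
      exact (norm_grad_le _ _).trans (le_abs_self _)
    · simp [planePoly_zero, taylorCoeff_zero]

end Taylor

end Billiard

namespace Billiard

section Taylor

/-- A homogeneous function of degree `n` that is `O(‖p‖ ^ (n + 1))` vanishes. -/
theorem eq_zero_of_homogeneous {E : Type*} [NormedAddCommGroup E] [NormedSpace ℝ E] {f : E → ℂ}
    {n : ℕ} (hf : ∀ (τ : ℝ) (v : E), f (τ • v) = (τ : ℂ) ^ n * f v)
    (ho : Ord (𝓝 (0 : E)) (fun p => ‖p‖) (n + 1) f) (v : E) : f v = 0 := by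
  have ht : Tendsto (fun τ : ℝ => τ • v) (𝓝[≠] 0) (𝓝 0) := by
    have : Continuous fun τ : ℝ => τ • v := by fun_prop
    exact (this.tendsto' 0 0 (by simp)).mono_left nhdsWithin_le_nhds
  have h1 := IsBigO.comp_tendsto ho ht
  have h2 : (fun _ : ℝ => f v) =O[𝓝[≠] 0] fun τ : ℝ => τ := by
    have h3 : (fun τ : ℝ => (τ : ℂ) ^ n * f v) =O[𝓝[≠] 0] fun τ : ℝ => τ ^ n * τ := by
      refine IsBigO.trans (h1.congr_left fun τ => hf τ v) (IsBigO.of_bound (‖v‖ ^ (n + 1)) ?_)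
      refine Eventually.of_forall fun τ => le_of_eq ?_
      simp only [Function.comp_apply, norm_smul, norm_mul, norm_pow, norm_norm]
      ring
    obtain ⟨C, hC⟩ := h3.bound
    refine IsBigO.of_bound C ?_
    filter_upwards [hC, self_mem_nhdsWithin] with τ h4 h5
    have h6 : 0 < ‖τ‖ ^ n := by
      have : τ ≠ 0 := h5
      positivity
    rw [norm_mul, norm_mul, norm_pow, norm_pow, Complex.norm_real] at h4
    exact le_of_mul_le_mul_left (h4.trans_eq (by ring)) h6
  have h3 : Tendsto (fun _ : ℝ => f v) (𝓝[≠] 0) (𝓝 0) :=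
    h2.trans_tendsto (tendsto_id.mono_left nhdsWithin_le_nhds)
  exact tendsto_nhds_unique tendsto_const_nhds h3

/-- The homogeneous part of degree `m` of `planePoly c`. -/
def homPart (c : ℕ → ℕ → ℝ) (m : ℕ) (p : ℝ × ℝ) : ℝ :=
  ∑ ij ∈ Finset.HasAntidiagonal.antidiagonal m, c ij.1 ij.2 * (p.1 ^ ij.1 * p.2 ^ ij.2)

theorem homPart_smul (c : ℕ → ℕ → ℝ) (m : ℕ) (τ : ℝ) (p : ℝ × ℝ) :
    homPart c m (τ • p) = τ ^ m * homPart c m p := by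
  rw [homPart, homPart, Finset.mul_sum]
  refine Finset.sum_congr rfl fun ij hij => ?_
  rw [← Finset.HasAntidiagonal.mem_antidiagonal.1 hij, pow_add]
  simp only [Prod.smul_fst, Prod.smul_snd, smul_eq_mul]
  ring

theorem ord_norm_zero {E : Type*} [SeminormedAddCommGroup E] :
    Ord (𝓝 (0 : E)) (fun p => ‖p‖) 0 (fun p => ‖p‖) := by
  simpa [Ord] using (continuous_norm.tendsto (0 : E)).isBigO_one ℝ

theorem Ord.ofReal {α : Type*} {l : Filter α} {r : α → ℝ} {n : ℕ} {f : α → ℝ} (h : Ord l r n f) :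
    Ord l r n (fun x => (f x : ℂ)) :=
  IsBigO.trans (IsBigO.of_bound 1 (by simp)) h

theorem ord_fst : Ord (𝓝 (0 : ℝ × ℝ)) (fun p => ‖p‖) 1 (fun p => p.1) :=
  IsBigO.of_bound 1 (Eventually.of_forall fun p => by simpa using norm_fst_le p)

theorem ord_snd : Ord (𝓝 (0 : ℝ × ℝ)) (fun p => ‖p‖) 1 (fun p => p.2) :=
  IsBigO.of_bound 1 (Eventually.of_forall fun p => by simpa using norm_snd_le p)

theorem ord_sum {α ι 𝕜 : Type*} [NormedField 𝕜] {l : Filter α} {r : α → ℝ} {n : ℕ}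
    {s : Finset ι} {f : ι → α → 𝕜} (h : ∀ i ∈ s, Ord l r n (f i)) :
    Ord l r n (fun x => ∑ i ∈ s, f i x) := IsBigO.fun_sum h

theorem ord_homPart (c : ℕ → ℕ → ℝ) (m : ℕ) :
    Ord (𝓝 (0 : ℝ × ℝ)) (fun p => ‖p‖) m (homPart c m) := by
  refine ord_sum fun ij hij => Ord.const_mul _ ?_
  have h := (ord_fst.pow ij.1).mul (ord_snd.pow ij.2)
  rwa [one_mul, one_mul, Finset.HasAntidiagonal.mem_antidiagonal.1 hij] at h

theorem planePoly_eq (c : ℕ → ℕ → ℝ) (n : ℕ) (p : ℝ × ℝ) :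
    planePoly c n p = ∑ m ∈ Finset.range n, homPart c m p := rfl

theorem homPart_eq_zero {c : ℕ → ℕ → ℝ} {n : ℕ}
    (h : Ord (𝓝 (0 : ℝ × ℝ)) (fun p => ‖p‖) n (planePoly c n)) :
    ∀ m < n, ∀ p, homPart c m p = 0 := by
  intro m
  induction m using Nat.strong_induction_on with
  | _ m ih =>
    intro hm
    have h1 : Ord (𝓝 (0 : ℝ × ℝ)) (fun p => ‖p‖) (m + 1)
        (fun p => ∑ k ∈ Finset.Ico (m + 1) n, homPart c k p) :=
      ord_sum fun k hk => (ord_homPart c k).mono ord_norm_zero (Finset.mem_Ico.1 hk).1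
    have h2 : Ord (𝓝 (0 : ℝ × ℝ)) (fun p => ‖p‖) (m + 1) (homPart c m) := by
      refine ((h.mono ord_norm_zero hm).sub h1).of_eq fun p => ?_
      rw [planePoly_eq, ← Finset.sum_range_add_sum_Ico _ (Nat.succ_le_of_lt hm),
        Finset.sum_range_succ, Finset.sum_eq_zero fun k hk =>
          ih k (Finset.mem_range.1 hk) ((Finset.mem_range.1 hk).trans hm) p]
      ring
    intro p
    have := eq_zero_of_homogeneous (f := fun p => (homPart c m p : ℂ)) (n := m)
      (fun τ v => by rw [homPart_smul]; push_cast; rfl) h2.ofReal p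
    exact_mod_cast this

theorem coeff_eq_zero_of_homPart {c : ℕ → ℕ → ℝ} {m : ℕ} (h : ∀ p, homPart c m p = 0)
    {i j : ℕ} (hij : i + j = m) : c i j = 0 := by
  have h1 : ∑ ij ∈ Finset.HasAntidiagonal.antidiagonal m,
      Polynomial.C (c ij.1 ij.2) * Polynomial.X ^ ij.2 = 0 := by
    refine Polynomial.funext fun y => ?_
    have := h (1, y)
    simpa [homPart, Polynomial.eval_finsetSum] using this
  have h2 := congrArg (fun q => Polynomial.coeff q j) h1
  simp only [Polynomial.finsetSum_coeff, Polynomial.coeff_C_mul_X_pow,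
    Polynomial.coeff_zero] at h2
  rw [Finset.sum_eq_single (i, j)] at h2
  · simpa using h2
  · intro b hb hne
    rw [if_neg]
    rintro rfl
    exact hne (Prod.ext (by
      have := Finset.HasAntidiagonal.mem_antidiagonal.1 hb
      simp only; omega) rfl)
  · intro hb
    exact absurd (Finset.HasAntidiagonal.mem_antidiagonal.2 hij) hb

/-- Uniqueness of the Taylor expansion. -/
theorem taylorCoeff_eq_of_ord {g : ℝ × ℝ → ℝ} (hg : ContDiffAt ℝ ∞ g 0) {c : ℕ → ℕ → ℝ} {n : ℕ}
    (h : Ord (𝓝 (0 : ℝ × ℝ)) (fun p => ‖p‖) n (fun p => g p - planePoly c n p)) {i j : ℕ}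
    (hij : i + j < n) : taylorCoeff g i j = c i j := by
  have h1 : Ord (𝓝 (0 : ℝ × ℝ)) (fun p => ‖p‖) n
      (planePoly (fun i j => taylorCoeff g i j - c i j) n) := by
    refine (h.sub (taylor_plane n hg)).of_eq fun p => ?_
    simp only [planePoly, sub_mul, Finset.sum_sub_distrib]
    ring
  exact sub_eq_zero.1 (coeff_eq_zero_of_homPart (homPart_eq_zero h1 _ hij) rfl)

end Taylor

end Billiard

namespace Billiard

/-! ### Complex coordinates -/

section ComplexCoord

open Complex (I)

/-- The complex coordinate `z = x + i y` of a point of the plane. -/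
noncomputable def zc (p : ℝ × ℝ) : ℂ := p.1 + p.2 * I

/-- The conjugate coordinate `w = x - i y`. -/
noncomputable def wc (p : ℝ × ℝ) : ℂ := p.1 - p.2 * I

theorem conj_zc (p : ℝ × ℝ) : conj (zc p) = wc p := by simp [zc, wc, sub_eq_add_neg]

theorem conj_wc (p : ℝ × ℝ) : conj (wc p) = zc p := by simp [zc, wc]

theorem zc_mul_wc (p : ℝ × ℝ) : zc p * wc p = ((p.1 ^ 2 + p.2 ^ 2 : ℝ) : ℂ) := by
  simp only [zc, wc]; push_cast; linear_combination -(p.2 : ℂ) ^ 2 * Complex.I_sq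

theorem zc_smul (τ : ℝ) (p : ℝ × ℝ) : zc (τ • p) = τ * zc p := by simp [zc]; ring

theorem wc_smul (τ : ℝ) (p : ℝ × ℝ) : wc (τ • p) = τ * wc p := by simp [wc]; ring

theorem zc_sub (p q : ℝ × ℝ) : zc (p - q) = zc p - zc q := by simp [zc]; ring

theorem norm_le_norm_zc (p : ℝ × ℝ) : ‖p‖ ≤ ‖zc p‖ := by
  have h1 : |(zc p).re| ≤ ‖zc p‖ := Complex.abs_re_le_norm _
  have h2 : |(zc p).im| ≤ ‖zc p‖ := Complex.abs_im_le_norm _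
  rw [Prod.norm_def]
  exact max_le (by simpa [zc] using h1) (by simpa [zc] using h2)

theorem norm_zc_le (p : ℝ × ℝ) : ‖zc p‖ ≤ 2 * ‖p‖ := by
  refine (norm_add_le _ _).trans ?_
  have h1 := norm_fst_le p
  have h2 := norm_snd_le p
  simp only [norm_mul, Complex.norm_real, Complex.norm_I, mul_one]
  linarith

theorem Ord.conj {α : Type*} {l : Filter α} {r : α → ℝ} {n : ℕ} {f : α → ℂ} (h : Ord l r n f) :
    Ord l r n (fun x => conj (f x)) := IsBigO.trans (IsBigO.of_bound 1 (by simp)) h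

variable {α : Type*} {l : Filter α} {r : α → ℝ} {n : ℕ}

theorem Ord.zc_comp {k : α → ℝ × ℝ} (h : k =O[l] fun x => r x ^ n) :
    Ord l r n (fun x => zc (k x)) :=
  IsBigO.trans (IsBigO.of_bound 2 (Eventually.of_forall fun _ => norm_zc_le _)) h

theorem ord_zc : Ord (𝓝 (0 : ℝ × ℝ)) (fun p => ‖p‖) 1 zc :=
  Ord.zc_comp (k := id) (IsBigO.of_bound 1 (by simp))

theorem ord_wc : Ord (𝓝 (0 : ℝ × ℝ)) (fun p => ‖p‖) 1 wc :=
  ord_zc.conj.of_eq conj_zc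

/-- Taylor expansion of the exponential of a small function. -/
theorem ord_exp {f : α → ℂ} {m : ℕ} (k : ℕ) (hk : 0 < k) (hf : Ord l r m f)
    (h0 : Tendsto f l (𝓝 0)) :
    Ord l r (m * k) (fun x => Complex.exp (f x) - ∑ i ∈ Finset.range k, f x ^ i / i.factorial) := by
  refine IsBigO.trans (IsBigO.of_bound ((k.succ : ℝ) * ((k.factorial : ℝ) * k)⁻¹) ?_) (hf.pow k)
  have : ∀ᶠ x in l, ‖f x‖ ≤ 1 := by
    have := h0.norm
    rw [norm_zero] at this
    exact (this.eventually_lt_const one_pos).mono fun x hx => hx.le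
  filter_upwards [this] with x hx
  rw [norm_pow, mul_comm]
  exact Complex.exp_bound hx hk

theorem Ord.apply_zero {E : Type*} [NormedAddCommGroup E] {f : E → ℂ}
    (h : Ord (𝓝 (0 : E)) (fun p => ‖p‖) (n + 1) f) : f 0 = 0 := by
  obtain ⟨C, hC⟩ := IsBigO.bound h
  simpa using hC.self_of_nhds

theorem zc_twistMap (θ τ₁ τ₂ : ℝ) (p : ℝ × ℝ) :
    zc (twistMap θ τ₁ τ₂ p) = zc p * (Complex.exp (θ * I) *
      Complex.exp ((τ₁ * (zc p * wc p) + τ₂ * (zc p * wc p) ^ 2) * I)) := by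
  rw [← Complex.exp_add, zc_mul_wc]
  simp only [twistMap, zc]
  have : (θ : ℂ) * I + (τ₁ * ((p.1 ^ 2 + p.2 ^ 2 : ℝ) : ℂ) + τ₂ * ((p.1 ^ 2 + p.2 ^ 2 : ℝ) : ℂ) ^ 2)
      * I = ((θ + τ₁ * (p.1 ^ 2 + p.2 ^ 2) + τ₂ * (p.1 ^ 2 + p.2 ^ 2) ^ 2 : ℝ) : ℂ) * I := by
    push_cast; ring
  rw [this, Complex.exp_mul_I, ← Complex.ofReal_cos, ← Complex.ofReal_sin]
  push_cast
  linear_combination -(p.2 * Complex.sin _) * Complex.I_sq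

theorem norm_exp_mul_I (x : ℂ) (hx : conj x = x) : ‖Complex.exp (x * I)‖ = 1 := by
  obtain ⟨r, rfl⟩ := Complex.conj_eq_iff_real.1 hx
  exact Complex.norm_exp_ofReal_mul_I r

theorem linear_coeff_zero {a b : ℂ} (h : ∀ p, a * zc p + b * wc p = 0) : a = 0 ∧ b = 0 := by
  have h1 := h (1, 0)
  have h2 := h (0, 1)
  simp only [zc, wc, Complex.ofReal_one, Complex.ofReal_zero, zero_mul, add_zero, sub_zero,
    mul_one, one_mul, zero_add, zero_sub] at h1 h2
  constructor
  · linear_combination h1 / 2 - I / 2 * h2 + (a - b) / 2 * Complex.I_sq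
  · linear_combination h1 / 2 + I / 2 * h2 - (a - b) / 2 * Complex.I_sq

theorem quadratic_coeff_zero {a b c : ℂ}
    (h : ∀ p, a * zc p ^ 2 + b * (zc p * wc p) + c * wc p ^ 2 = 0) : a = 0 ∧ b = 0 ∧ c = 0 := by
  have h1 := h (1, 0)
  have h2 := h (0, 1)
  have h3 := h (1, 1)
  simp only [zc, wc, Complex.ofReal_one, Complex.ofReal_zero, zero_mul, add_zero, sub_zero,
    mul_one, one_mul, zero_add, zero_sub] at h1 h2 h3
  have e2 : -a + b - c = 0 := by linear_combination h2 - (a - b + c) * Complex.I_sq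
  have e3 : 2 * I * a + 2 * b - 2 * I * c = 0 := by
    linear_combination h3 - (a - b + c) * Complex.I_sq
  have hb : b = 0 := by linear_combination (h1 + e2) / 2
  have hac : a + c = 0 := by linear_combination (h1 - e2) / 2
  have ha : a = 0 := by
    linear_combination -I / 4 * e3 + I / 2 * hb + hac / 2 + (a - c) / 2 * Complex.I_sq
  exact ⟨ha, hb, by linear_combination hac - ha⟩

theorem cubic_coeff_zero {a b c d : ℂ}
    (h : ∀ p, a * zc p ^ 3 + b * (zc p ^ 2 * wc p) + c * (zc p * wc p ^ 2) + d * wc p ^ 3 = 0) :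
    a = 0 ∧ b = 0 ∧ c = 0 ∧ d = 0 := by
  have h1 := h (1, 0)
  have h2 := h (0, 1)
  have h3 := h (1, 1)
  have h4 := h (1, -1)
  simp only [zc, wc, Complex.ofReal_one, Complex.ofReal_zero, zero_mul, add_zero, sub_zero,
    mul_one, one_mul, zero_add, zero_sub, Complex.ofReal_neg, neg_mul, sub_neg_eq_add, one_pow]
    at h1 h2 h3 h4
  have hI := Complex.I_sq
  have e2 : -a + b - c + d = 0 := by
    linear_combination -I * h2 + (a - b + c - d) * (I ^ 2 - 1) * hI
  have hbd : b + d = 0 := by linear_combination (h1 + e2) / 2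
  have hac : a + c = 0 := by linear_combination (h1 - e2) / 2
  have hc : c = -a := by linear_combination hac
  have hd : d = -b := by linear_combination hbd
  subst hc hd
  have e3 : a * (I - 1) + b * (1 + I) = 0 := by
    linear_combination h3 / 4 + (b - a) * hI
  have e4 : -a * (1 + I) + b * (1 - I) = 0 := by
    linear_combination h4 / 4 + (b - a) * hI
  have ha : a = 0 := by
    linear_combination (-1 - I) / 4 * (e3 - I * e4) + (3 * a + a * I + b + b * I) / 4 * hI
  have hb : b = 0 := by
    linear_combination (1 + I) / 2 * e4 + (1 + I) ^ 2 / 2 * ha + b / 2 * hI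
  exact ⟨ha, hb, by rw [ha, neg_zero], by rw [hb, neg_zero]⟩

end ComplexCoord

end Billiard

namespace Billiard

section ComplexCoord

open Complex (I)

/-- The complex coordinate of a map of the plane. -/
noncomputable def zmap (k : ℝ × ℝ → ℝ × ℝ) (p : ℝ × ℝ) : ℂ := zc (k p)

/-- The partial derivative of `zmap k` with respect to `x`. -/
noncomputable def zmap₁ (k : ℝ × ℝ → ℝ × ℝ) (p : ℝ × ℝ) : ℂ :=
  partial₁ (fun p => (k p).1) p + partial₁ (fun p => (k p).2) p * I

/-- The partial derivative of `zmap k` with respect to `y`. -/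
noncomputable def zmap₂ (k : ℝ × ℝ → ℝ × ℝ) (p : ℝ × ℝ) : ℂ :=
  partial₂ (fun p => (k p).1) p + partial₂ (fun p => (k p).2) p * I

theorem det_eq_conj {k : ℝ × ℝ → ℝ × ℝ} {p : ℝ × ℝ} (hk : DifferentiableAt ℝ k p) :
    2 * I * ((fderiv ℝ k p).det : ℂ) =
      conj (zmap₁ k p) * zmap₂ k p - zmap₁ k p * conj (zmap₂ k p) := by
  have h1 (v : ℝ × ℝ) : fderiv ℝ (fun p => (k p).1) p v = (fderiv ℝ k p v).1 := by
    rw [fderiv.fst hk]; rfl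
  have h2 (v : ℝ × ℝ) : fderiv ℝ (fun p => (k p).2) p v = (fderiv ℝ k p v).2 := by
    rw [fderiv.snd hk]; rfl
  rw [det_prod]
  simp only [zmap₁, zmap₂, partial₁, partial₂, h1, h2, map_add, map_mul, Complex.conj_ofReal,
    Complex.conj_I]
  push_cast
  ring

theorem planePoly_three (c : ℕ → ℕ → ℝ) (p : ℝ × ℝ) : planePoly c 3 p = c 0 0
    + (c 1 0 * p.1 + c 0 1 * p.2)
    + (c 2 0 * p.1 ^ 2 + c 1 1 * (p.1 * p.2) + c 0 2 * p.2 ^ 2) := by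
  simp [planePoly, Finset.sum_range_succ, Finset.Nat.sum_antidiagonal_succ]
  ring

theorem planePoly_four (c : ℕ → ℕ → ℝ) (p : ℝ × ℝ) : planePoly c 4 p = c 0 0
    + (c 1 0 * p.1 + c 0 1 * p.2)
    + (c 2 0 * p.1 ^ 2 + c 1 1 * (p.1 * p.2) + c 0 2 * p.2 ^ 2)
    + (c 3 0 * p.1 ^ 3 + c 2 1 * (p.1 ^ 2 * p.2) + c 1 2 * (p.1 * p.2 ^ 2) + c 0 3 * p.2 ^ 3) := by
  simp [planePoly, Finset.sum_range_succ, Finset.Nat.sum_antidiagonal_succ]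
  ring

/-- The expansion to order three of a smooth map and of its partial derivatives, in complex
coordinates. -/
theorem zmap_expansion {k : ℝ × ℝ → ℝ × ℝ} (hk : ContDiffAt ℝ ∞ k 0) (hk0 : k 0 = 0) :
    ∃ u v A B D a b c d : ℂ,
      Ord (𝓝 (0 : ℝ × ℝ)) (fun p => ‖p‖) 4 (fun p => zmap k p - (u * zc p + v * wc p
        + (A * zc p ^ 2 + B * (zc p * wc p) + D * wc p ^ 2)
        + (a * zc p ^ 3 + b * (zc p ^ 2 * wc p) + c * (zc p * wc p ^ 2) + d * wc p ^ 3))) ∧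
      Ord (𝓝 (0 : ℝ × ℝ)) (fun p => ‖p‖) 3 (fun p => zmap₁ k p - (u + v
        + (2 * A * zc p + B * (zc p + wc p) + 2 * D * wc p)
        + (3 * a * zc p ^ 2 + b * (2 * (zc p * wc p) + zc p ^ 2)
          + c * (wc p ^ 2 + 2 * (zc p * wc p)) + 3 * d * wc p ^ 2))) ∧
      Ord (𝓝 (0 : ℝ × ℝ)) (fun p => ‖p‖) 3 (fun p => zmap₂ k p - I * (u - v
        + (2 * A * zc p + B * (wc p - zc p) - 2 * D * wc p)
        + (3 * a * zc p ^ 2 + b * (2 * (zc p * wc p) - zc p ^ 2)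
          + c * (wc p ^ 2 - 2 * (zc p * wc p)) - 3 * d * wc p ^ 2))) := by
  have hk1 : ContDiffAt ℝ ∞ (fun p => (k p).1) 0 := contDiffAt_fst.comp 0 hk
  have hk2 : ContDiffAt ℝ ∞ (fun p => (k p).2) 0 := contDiffAt_snd.comp 0 hk
  have combine {n : ℕ} {f g f' g' : ℝ × ℝ → ℝ}
      (hf : Ord (𝓝 (0 : ℝ × ℝ)) (fun p => ‖p‖) n (fun p => f p - f' p))
      (hg : Ord (𝓝 (0 : ℝ × ℝ)) (fun p => ‖p‖) n (fun p => g p - g' p)) :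
      Ord (𝓝 (0 : ℝ × ℝ)) (fun p => ‖p‖) n (fun p => (f p + g p * I : ℂ) - (f' p + g' p * I)) :=
    (hf.ofReal.add (hg.ofReal.const_mul I)).of_eq fun p => by push_cast; ring
  have e0 := combine (taylor_plane 4 hk1) (taylor_plane 4 hk2)
  have e1 := combine (taylor_plane 3 (contDiffAt_partial₁ hk1))
    (taylor_plane 3 (contDiffAt_partial₁ hk2))
  have e2 := combine (taylor_plane 3 (contDiffAt_partial₂ hk1))
    (taylor_plane 3 (contDiffAt_partial₂ hk2))
  have z1 : taylorCoeff (fun p => (k p).1) 0 0 = 0 := by rw [taylorCoeff_zero, hk0]; rfl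
  have z2 : taylorCoeff (fun p => (k p).2) 0 0 = 0 := by rw [taylorCoeff_zero, hk0]; rfl
  rw [← funext₂ fun i j => (taylorCoeff_partial₁ hk1 i j).symm,
    ← funext₂ fun i j => (taylorCoeff_partial₁ hk2 i j).symm] at e1
  rw [← funext₂ fun i j => (taylorCoeff_partial₂ hk1 i j).symm,
    ← funext₂ fun i j => (taylorCoeff_partial₂ hk2 i j).symm] at e2
  set f := taylorCoeff (fun p => (k p).1)
  set g := taylorCoeff (fun p => (k p).2)
  let C : ℕ → ℕ → ℂ := fun i j => f i j + g i j * I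
  refine ⟨(C 1 0 - I * C 0 1) / 2, (C 1 0 + I * C 0 1) / 2,
    (C 2 0 - I * C 1 1 - C 0 2) / 4, (C 2 0 + C 0 2) / 2, (C 2 0 + I * C 1 1 - C 0 2) / 4,
    (C 3 0 - I * C 2 1 - C 1 2 + I * C 0 3) / 8, (3 * C 3 0 - I * C 2 1 + C 1 2 - 3 * I * C 0 3) / 8,
    (3 * C 3 0 + I * C 2 1 + C 1 2 + 3 * I * C 0 3) / 8,
    (C 3 0 + I * C 2 1 - C 1 2 - I * C 0 3) / 8, e0.of_eq fun p => ?_, e1.of_eq fun p => ?_,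
    e2.of_eq fun p => ?_⟩
  · rw [zmap, zc]
    congr 1
    simp only [planePoly_four, z1, z2, C, zc, wc]
    apply Complex.ext <;> simp [pow_succ] <;> ring
  · rw [zmap₁]
    congr 1
    simp only [planePoly_three, C, zc, wc]
    apply Complex.ext <;> simp [pow_succ] <;> ring
  · rw [zmap₂]
    congr 1
    simp only [planePoly_three, C, zc, wc]
    apply Complex.ext <;> simp [pow_succ] <;> ring

end ComplexCoord

end Billiard

namespace Billiard

section ComplexCoord

open Complex (I)


theorem linear_zero_of_ord {a b : ℂ}
    (h : Ord (𝓝 (0 : ℝ × ℝ)) (fun p => ‖p‖) 2 (fun p => a * zc p + b * wc p)) :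
    a = 0 ∧ b = 0 :=
  linear_coeff_zero <| eq_zero_of_homogeneous (n := 1)
    (fun τ v => by simp only [zc_smul, wc_smul]; ring) h

theorem quadratic_zero_of_ord {a b c : ℂ}
    (h : Ord (𝓝 (0 : ℝ × ℝ)) (fun p => ‖p‖) 3
      (fun p => a * zc p ^ 2 + b * (zc p * wc p) + c * wc p ^ 2)) : a = 0 ∧ b = 0 ∧ c = 0 :=
  quadratic_coeff_zero <| eq_zero_of_homogeneous (n := 2)
    (fun τ v => by simp only [zc_smul, wc_smul]; ring) h

theorem cubic_zero_of_ord {a b c d : ℂ}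
    (h : Ord (𝓝 (0 : ℝ × ℝ)) (fun p => ‖p‖) 4 (fun p => a * zc p ^ 3 + b * (zc p ^ 2 * wc p)
      + c * (zc p * wc p ^ 2) + d * wc p ^ 3)) : a = 0 ∧ b = 0 ∧ c = 0 ∧ d = 0 :=
  cubic_coeff_zero <| eq_zero_of_homogeneous (n := 3)
    (fun τ v => by simp only [zc_smul, wc_smul]; ring) h

theorem ord_zw : Ord (𝓝 (0 : ℝ × ℝ)) (fun p => ‖p‖) 2 (fun p => zc p * wc p) := ord_zc.mul ord_wc

theorem tendsto_of_ord {α : Type*} {l : Filter α} {r : α → ℝ} {n : ℕ} {f : α → ℂ}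
    (hr : Tendsto r l (𝓝 0)) (hf : Ord l r (n + 1) f) : Tendsto f l (𝓝 0) :=
  IsBigO.trans_tendsto hf (by simpa using hr.pow (n + 1))

theorem ord_phase {α : Type*} {l : Filter α} {r : α → ℝ} {n : ℕ} {q : α → ℂ} (τ₁ τ₂ : ℝ)
    (hr : Ord l r 0 r) (hq : Ord l r n q) :
    Ord l r n (fun x => (τ₁ * q x + τ₂ * q x ^ 2) * I) := by
  have h2 : Ord l r n (fun x => (τ₂ : ℂ) * q x ^ 2) :=
    ((hq.pow 2).const_mul _).mono hr (by omega)
  exact (((hq.const_mul (τ₁ : ℂ)).add h2).const_mul I).of_eq fun x => by ring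

/-! ### Orbits of twist maps -/

section Rigidity

variable (θ τ₁ τ₂ : ℝ)

theorem norm_zc_twistMap (p : ℝ × ℝ) : ‖zc (twistMap θ τ₁ τ₂ p)‖ = ‖zc p‖ := by
  rw [zc_twistMap, norm_mul, norm_mul, norm_exp_mul_I _ (by simp), norm_exp_mul_I, one_mul, mul_one]
  simp [conj_zc, conj_wc, mul_comm]

theorem zc_mul_conj (p : ℝ × ℝ) : zc p * wc p = (‖zc p‖ : ℂ) ^ 2 := by
  rw [← conj_zc, Complex.mul_conj']

theorem zc_mul_wc_twistMap (p : ℝ × ℝ) :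
    zc (twistMap θ τ₁ τ₂ p) * wc (twistMap θ τ₁ τ₂ p) = zc p * wc p := by
  rw [zc_mul_conj, zc_mul_conj, norm_zc_twistMap]

theorem ord_twistMap : Ord (𝓝 (0 : ℝ × ℝ)) (fun p => ‖p‖) 1
    (fun p => ‖twistMap θ τ₁ τ₂ p‖) := by
  refine IsBigO.of_bound 2 (Eventually.of_forall fun p => ?_)
  rw [norm_norm, pow_one, norm_norm]
  exact (norm_le_norm_zc _).trans ((norm_zc_twistMap θ τ₁ τ₂ p).le.trans (norm_zc_le p))

theorem tendsto_twistMap : Tendsto (twistMap θ τ₁ τ₂) (𝓝 0) (𝓝 0) := by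
  rw [tendsto_zero_iff_norm_tendsto_zero]
  exact IsBigO.trans_tendsto (ord_twistMap θ τ₁ τ₂) (by simpa using tendsto_norm_zero)

theorem Ord.comp_twistMap {n : ℕ} {f : ℝ × ℝ → ℂ}
    (h : Ord (𝓝 (0 : ℝ × ℝ)) (fun p => ‖p‖) n f) :
    Ord (𝓝 (0 : ℝ × ℝ)) (fun p => ‖p‖) n (fun p => f (twistMap θ τ₁ τ₂ p)) :=
  (h.comp (tendsto_twistMap θ τ₁ τ₂)).gauge (ord_twistMap θ τ₁ τ₂)

/-- Expansion of a twist map along a curve of points. -/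
theorem zc_twistMap_expansion {k : ℝ × ℝ → ℝ × ℝ}
    (hk : Ord (𝓝 (0 : ℝ × ℝ)) (fun p => ‖p‖) 1 (fun p => zc (k p))) :
    Ord (𝓝 (0 : ℝ × ℝ)) (fun p => ‖p‖) 3
      (fun p => zc (twistMap θ τ₁ τ₂ (k p)) - Complex.exp (θ * I) * zc (k p)) ∧
    Ord (𝓝 (0 : ℝ × ℝ)) (fun p => ‖p‖) 5
      (fun p => zc (twistMap θ τ₁ τ₂ (k p)) - Complex.exp (θ * I) *
        (zc (k p) + I * τ₁ * (zc (k p) * (zc (k p) * wc (k p))))) := by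
  have hw : Ord (𝓝 (0 : ℝ × ℝ)) (fun p => ‖p‖) 1 (fun p => wc (k p)) := hk.conj.of_eq fun p => conj_zc _
  have hq := hk.mul hw
  have hph := ord_phase τ₁ τ₂ ord_norm_zero hq
  have h0 := tendsto_of_ord (n := 1) tendsto_norm_zero hph
  have e1 := (hk.mul (ord_exp 1 one_pos hph h0)).const_mul (Complex.exp (θ * I))
  have e2 := (hk.mul (ord_exp 2 two_pos hph h0)).const_mul (Complex.exp (θ * I))
  have e3 := ((hk.mul (hq.pow 2)).const_mul (Complex.exp (θ * I) * τ₂ * I))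
  constructor
  · refine e1.of_eq fun p => ?_
    rw [zc_twistMap]
    simp
    ring
  · refine (e2.add e3).of_eq fun p => ?_
    rw [zc_twistMap]
    simp [Finset.sum_range_succ]
    ring

/-- If `G` is bounded near the origin and changes under a twist map by `c q³ + O(r⁷)`, where
`q = r²` is invariant, then `c = 0`: along an orbit the changes add up. -/
theorem drift_eq_zero {G : ℝ × ℝ → ℂ} {c : ℂ}
    (hG : Ord (𝓝 (0 : ℝ × ℝ)) (fun p => ‖p‖) 0 G)
    (hd : Ord (𝓝 (0 : ℝ × ℝ)) (fun p => ‖p‖) 7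
      (fun p => G (twistMap θ τ₁ τ₂ p) - G p - c * (zc p * wc p) ^ 3)) : c = 0 := by
  obtain ⟨C₁, h1⟩ := IsBigO.bound hG
  obtain ⟨C₂, h2⟩ := IsBigO.bound hd
  obtain ⟨ε, hε, hball⟩ := Metric.eventually_nhds_iff.1 (h1.and h2)
  by_contra hc
  -- a point on the axis at a small distance `ρ`
  obtain ⟨ρ, hρ0, hρε, hρc⟩ : ∃ ρ : ℝ, 0 < ρ ∧ ρ < ε ∧ |C₂| * ρ < ‖c‖ := by
    refine ⟨min (ε / 2) (‖c‖ / (2 * (|C₂| + 1))), by positivity, ?_, ?_⟩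
    · exact (min_le_left _ _).trans_lt (by linarith)
    · have hc' : 0 < ‖c‖ := norm_pos_iff.2 hc
      calc |C₂| * min (ε / 2) (‖c‖ / (2 * (|C₂| + 1))) ≤ |C₂| * (‖c‖ / (2 * (|C₂| + 1))) := by
            gcongr; exact min_le_right _ _
        _ = (|C₂| / (|C₂| + 1)) * (‖c‖ / 2) := by field_simp
        _ ≤ 1 * (‖c‖ / 2) := by
            gcongr
            rw [div_le_one (by positivity)]; linarith
        _ < ‖c‖ := by linarith
  set T := twistMap θ τ₁ τ₂
  let x : ℕ → ℝ × ℝ := fun n => T^[n] (ρ, 0)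
  have hx (n : ℕ) : ‖zc (x n)‖ = ρ := by
    induction n with
    | zero => simp [x, zc, abs_of_pos hρ0]
    | succ n ih =>
      rw [← ih]
      simp only [x, Function.iterate_succ_apply']
      exact norm_zc_twistMap ..
  have hn (n : ℕ) : ‖x n‖ ≤ ρ := (norm_le_norm_zc _).trans (hx n).le
  have hb (n : ℕ) := hball (y := x n) (by rw [dist_zero_right]; exact (hn n).trans_lt hρε)
  -- the changes of `G` along the orbit add up to a multiple of `n`, while `G` stays bounded
  have hsum (n : ℕ) : ‖G (x n) - G (x 0) - n * (c * (ρ : ℂ) ^ 6)‖ ≤ n * (|C₂| * ρ ^ 7) := by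
    induction n with
    | zero => simp
    | succ n ih =>
      have h := (hb n).2
      rw [zc_mul_conj, hx n, norm_pow, norm_norm] at h
      have h' : ‖G (T (x n)) - G (x n) - c * ((ρ : ℂ) ^ 2) ^ 3‖ ≤ |C₂| * ρ ^ 7 :=
        h.trans (mul_le_mul (le_abs_self _) (pow_le_pow_left₀ (norm_nonneg _) (hn n) 7)
          (by positivity) (abs_nonneg _))
      have hxs : x (n + 1) = T (x n) := Function.iterate_succ_apply' ..
      rw [hxs]
      refine le_trans (le_of_eq_of_le ?_ (norm_add_le (G (x n) - G (x 0) - n * (c * (ρ : ℂ) ^ 6))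
        (G (T (x n)) - G (x n) - c * ((ρ : ℂ) ^ 2) ^ 3))) ((add_le_add ih h').trans_eq ?_)
      · congr 1; push_cast; ring
      · push_cast; ring
  have hbd (n : ℕ) : n * ((‖c‖ - |C₂| * ρ) * ρ ^ 6) ≤ 2 * |C₁| := by
    have hg (m : ℕ) : ‖G (x m)‖ ≤ |C₁| := by
      have := (hb m).1
      simp only [pow_zero, norm_one, mul_one] at this
      exact this.trans (le_abs_self _)
    have h3 : ‖(n : ℂ) * (c * (ρ : ℂ) ^ 6)‖ = n * (‖c‖ * ρ ^ 6) := by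
      simp [abs_of_pos hρ0]
    have h4 : ‖(n : ℂ) * (c * (ρ : ℂ) ^ 6)‖ ≤ ‖G (x n) - G (x 0) - n * (c * (ρ : ℂ) ^ 6)‖
        + (‖G (x n)‖ + ‖G (x 0)‖) := by
      rw [← norm_neg]
      refine le_trans (le_of_eq_of_le ?_ (norm_add_le
        (G (x n) - G (x 0) - n * (c * (ρ : ℂ) ^ 6)) (-(G (x n) - G (x 0))))) ?_
      · congr 1; ring
      · rw [norm_neg]; gcongr; exact norm_sub_le _ _
    have := hsum n
    have := hg n
    have := hg 0
    nlinarith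
  obtain ⟨n, hn'⟩ := exists_nat_gt (2 * |C₁| / ((‖c‖ - |C₂| * ρ) * ρ ^ 6))
  have hpos : 0 < (‖c‖ - |C₂| * ρ) * ρ ^ 6 := mul_pos (by linarith) (by positivity)
  rw [div_lt_iff₀ hpos] at hn'
  linarith [hbd n]

end Rigidity

end ComplexCoord

end Billiard

namespace Billiard

/-! ### Rigidity of twist maps -/

section ComplexCoord

open Complex (I)

/-- A smooth symplectic germ that conjugates two twist maps up to terms of order six preserves
the second twist coefficient, in the absence of resonances of order four and six. -/
theorem twist_rigidity {k : ℝ × ℝ → ℝ × ℝ} (hk : IsSymplecticGerm k) {θ τ₁ τ₂ θ' τ₁' τ₂' : ℝ}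
    (h4 : Complex.exp (θ * I) ^ 4 ≠ 1) (h6 : Complex.exp (θ * I) ^ 6 ≠ 1)
    (hconj : (fun p => k (twistMap θ' τ₁' τ₂' p) - twistMap θ τ₁ τ₂ (k p))
      =O[𝓝 (0 : ℝ × ℝ)] fun p => ‖p‖ ^ 6) : τ₂' = τ₂ := by
  obtain ⟨hk0, hks, hdet⟩ := hk
  obtain ⟨u, v, A, B, D, a, b, c, d, e0, e1, e2⟩ := zmap_expansion hks hk0
  have hr := ord_norm_zero (E := ℝ × ℝ)
  set T' := twistMap θ' τ₁' τ₂' with hT'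
  set T := twistMap θ τ₁ τ₂ with hT
  set ζ := Complex.exp (θ * I) with hζ
  set ζ' := Complex.exp (θ' * I) with hζ'
  have hζζ : ζ * conj ζ = 1 := by
    rw [Complex.mul_conj', hζ, norm_exp_mul_I _ (by simp)]; simp
  have hζζ' : ζ' * conj ζ' = 1 := by
    rw [Complex.mul_conj', hζ', norm_exp_mul_I _ (by simp)]; simp
  have hζ0 : ζ ≠ 0 := Complex.exp_ne_zero _
  have hconj' : Ord (𝓝 (0 : ℝ × ℝ)) (fun p => ‖p‖) 6 (fun p => zc (k (T' p)) - zc (T (k p))) :=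
    (Ord.zc_comp hconj).of_eq fun p => zc_sub _ _
  -- the determinant at the origin
  have hdet0 : u * conj u - v * conj v = 1 := by
    have h := det_eq_conj (hks.differentiableAt (by simp) : DifferentiableAt ℝ k 0)
    rw [hdet.self_of_nhds] at h
    have h1 := e1.apply_zero
    have h2 := e2.apply_zero
    simp only [zc, wc, Prod.fst_zero, Prod.snd_zero, Complex.ofReal_zero, zero_mul, add_zero,
      sub_zero, mul_zero, ne_eq, OfNat.ofNat_ne_zero, not_false_eq_true, zero_pow] at h1 h2
    rw [sub_eq_zero.1 h1, sub_eq_zero.1 h2] at h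
    simp only [map_add, map_sub, map_mul, Complex.conj_I, Complex.ofReal_one] at h
    linear_combination I / 2 * h + (u * conj u - v * conj v - 1) * Complex.I_sq
  -- the linear part
  have hz := ord_zc
  have hw := ord_wc
  have hκ : Ord (𝓝 (0 : ℝ × ℝ)) (fun p => ‖p‖) 2 (fun p => zc (k p) - (u * zc p + v * wc p)) := by
    have h1 := e0.mono hr (by norm_num : 2 ≤ 4)
    have h2 := (hz.pow 2).const_mul A
    have h3 := (hz.mul hw).const_mul B
    have h4 := (hw.pow 2).const_mul D
    have h5 := ((hz.pow 3).const_mul a).mono hr (by norm_num : 2 ≤ 1 * 3)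
    have h6 := (((hz.pow 2).mul hw).const_mul b).mono hr (by norm_num : 2 ≤ 1 * 2 + 1)
    have h7 := ((hz.mul (hw.pow 2)).const_mul c).mono hr (by norm_num : 2 ≤ 1 + 1 * 2)
    have h8 := ((hw.pow 3).const_mul d).mono hr (by norm_num : 2 ≤ 1 * 3)
    refine ((((h1.add h2).add h3).add h4).add (((h5.add h6).add h7).add h8)).of_eq fun p => ?_
    rw [zmap]; ring
  have hκ1 : Ord (𝓝 (0 : ℝ × ℝ)) (fun p => ‖p‖) 1 (fun p => zc (k p)) :=
    ((hκ.mono hr one_le_two).add ((hz.const_mul u).add (hw.const_mul v))).of_eq fun p => by ring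
  obtain ⟨t3, t5⟩ := zc_twistMap_expansion θ' τ₁' τ₂' (k := id) hz
  obtain ⟨s3, s5⟩ := zc_twistMap_expansion θ τ₁ τ₂ hκ1
  have t3c := t3.conj
  simp only [id, map_sub, map_mul, conj_zc] at t3 t5 t3c
  rw [← hT', ← hζ'] at t3 t5 t3c
  rw [← hT, ← hζ] at s3 s5
  -- the terms of degree one in the conjugacy: the multipliers agree, and `k` is `ℂ`-linear at `0`
  have hlin : u * ζ' - u * ζ = 0 ∧ v * conj ζ' - v * ζ = 0 := by
    refine linear_zero_of_ord ?_
    have h1 := hκ.comp_twistMap θ' τ₁' τ₂'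
    have h2 := (t3.mono hr (by norm_num : 2 ≤ 3)).const_mul u
    have h3 := (t3c.mono hr (by norm_num : 2 ≤ 3)).const_mul v
    refine ((((hconj'.mono hr (by norm_num : 2 ≤ 6)).sub h1).sub (h2.add h3)).add
      ((s3.mono hr (by norm_num : 2 ≤ 3)).add (hκ.const_mul ζ))).of_eq fun p => ?_
    ring
  have hu0 : u ≠ 0 := by
    rintro rfl
    have h : (‖v‖ : ℂ) ^ 2 = -1 := by rw [← Complex.mul_conj']; linear_combination -hdet0
    have h' : ‖v‖ ^ 2 = -1 := by exact_mod_cast h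
    nlinarith [sq_nonneg ‖v‖]
  have hζeq : ζ' = ζ := by
    have : u * (ζ' - ζ) = 0 := by linear_combination hlin.1
    exact sub_eq_zero.1 ((mul_eq_zero.1 this).resolve_left hu0)
  rw [hζeq] at t3 t5 t3c
  have hv : v = 0 := by
    have h : v * (1 - ζ ^ 2) = 0 := by
      linear_combination ζ * hlin.2 + v * ζ * congrArg conj hζeq.symm - v * hζζ
    refine (mul_eq_zero.1 h).resolve_right fun h' => h4 ?_
    linear_combination -(ζ ^ 2 + 1) * h'
  subst hv
  have hu1 : u * conj u = 1 := by linear_combination hdet0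
  have hq := ord_zw
  have t1 := Ord.comp_twistMap θ' τ₁' τ₂' hz
  have t1c := Ord.comp_twistMap θ' τ₁' τ₂' hw
  rw [← hT'] at t1 t1c
  have hinv (p : ℝ × ℝ) : zc (T' p) * wc (T' p) = zc p * wc p := zc_mul_wc_twistMap ..
  -- the quadratic part
  have hκ2 : Ord (𝓝 (0 : ℝ × ℝ)) (fun p => ‖p‖) 3 (fun p => zc (k p) - (u * zc p
      + (A * zc p ^ 2 + B * (zc p * wc p) + D * wc p ^ 2))) := by
    have h1 := e0.mono hr (by norm_num : 3 ≤ 4)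
    have h5 := (hz.pow 3).const_mul a
    have h6 := ((hz.pow 2).mul hw).const_mul b
    have h7 := (hz.mul (hw.pow 2)).const_mul c
    have h8 := (hw.pow 3).const_mul d
    refine (h1.add (((h5.add h6).add h7).add h8)).of_eq fun p => ?_
    rw [zmap]; ring
  have hquad : A * ζ ^ 2 - ζ * A = 0 ∧ B - ζ * B = 0 ∧ D * conj ζ ^ 2 - ζ * D = 0 := by
    refine quadratic_zero_of_ord ?_
    have h1 := hκ2.comp_twistMap θ' τ₁' τ₂'
    have h2 := t3.const_mul u
    have h3 := (t3.mul_le hr (t1.add (hz.const_mul ζ)) (k := 3) (by norm_num)).const_mul A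
    have h4 := (t3c.mul_le hr (t1c.add (hw.const_mul (conj ζ))) (k := 3) (by norm_num)).const_mul D
    refine ((((hconj'.mono hr (by norm_num : 3 ≤ 6)).sub h1).sub ((h2.add h3).add h4)).add
      (s3.add (hκ2.const_mul ζ))).of_eq fun p => ?_
    rw [← hT', hinv]
    ring
  have hζ1 : ζ - 1 ≠ 0 := fun h => h4 (by linear_combination (ζ ^ 3 + ζ ^ 2 + ζ + 1) * h)
  have hζ2 : ζ ^ 2 - 1 ≠ 0 := fun h => h4 (by linear_combination (ζ ^ 2 + 1) * h)
  have hζ3 : ζ ^ 3 - 1 ≠ 0 := fun h => h6 (by linear_combination (ζ ^ 3 + 1) * h)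
  have hζ4 : ζ ^ 4 - 1 ≠ 0 := fun h => h4 (by linear_combination h)
  have hA : A = 0 := by
    have : A * (ζ * (ζ - 1)) = 0 := by linear_combination hquad.1
    exact (mul_eq_zero.1 this).resolve_right (mul_ne_zero hζ0 hζ1)
  have hB : B = 0 := by
    have : B * (ζ - 1) = 0 := by linear_combination -hquad.2.1
    exact (mul_eq_zero.1 this).resolve_right hζ1
  have hD : D = 0 := by
    have : D * (ζ ^ 3 - 1) = 0 := by
      linear_combination -ζ ^ 2 * hquad.2.2 + D * (ζ * conj ζ + 1) * hζζ
    exact (mul_eq_zero.1 this).resolve_right hζ3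
  subst hA hB hD
  have hκ3 : Ord (𝓝 (0 : ℝ × ℝ)) (fun p => ‖p‖) 3 (fun p => zc (k p) - u * zc p) :=
    hκ2.of_eq fun p => by ring
  -- the cubic part
  have hcub : a * ζ ^ 3 - ζ * a = 0 ∧ u * ζ * I * (τ₁' - τ₁) = 0 ∧ c * conj ζ - ζ * c = 0
      ∧ d * conj ζ ^ 3 - ζ * d = 0 := by
    refine cubic_zero_of_ord ?_
    have h1 := e0.comp_twistMap θ' τ₁' τ₂'
    have h2 := (t5.mono hr (by norm_num : 4 ≤ 5)).const_mul u
    have h3 := (t3.mul_le hr (((t1.pow 2).add ((t1.mul hz).const_mul ζ)).add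
      ((hz.pow 2).const_mul (ζ ^ 2))) (k := 4) (by norm_num)).const_mul a
    have h4 := (t3c.mul_le hr (((t1c.pow 2).add ((t1c.mul hw).const_mul (conj ζ))).add
      ((hw.pow 2).const_mul (conj ζ ^ 2))) (k := 4) (by norm_num)).const_mul d
    have h5 := (t3.mul_le hr hq (k := 4) (by norm_num)).const_mul b
    have h6 := (t3c.mul_le hr hq (k := 4) (by norm_num)).const_mul c
    have hc := hκ1.conj
    have hcc := hκ3.conj
    have h7 := (((hκ3.mul_le hr (hκ1.mul hc) (k := 4) (by norm_num)).add
      (((hz.const_mul u).mul hκ3).mul_le hr hc (k := 4) (by norm_num))).add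
      (((hz.const_mul u).mul (hz.const_mul u)).mul_le hr hcc (k := 4)
        (by norm_num))).const_mul (ζ * I * τ₁)
    refine (((((hconj'.mono hr (by norm_num : 4 ≤ 6)).sub h1).sub
      ((((h2.add h3).add h4).add h5).add h6)).add
      ((s5.mono hr (by norm_num : 4 ≤ 5)).add (e0.const_mul ζ))).add h7).of_eq fun p => ?_
    rw [← hT', zmap, zmap]
    simp only [map_sub, map_mul, conj_zc]
    have hi := hinv p
    linear_combination (b * zc (T' p) + c * wc (T' p)) * hi -
      ζ * I * τ₁ * u * zc p ^ 2 * wc p * hu1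
  have hτ : (τ₁' : ℂ) - τ₁ = 0 :=
    (mul_eq_zero.1 hcub.2.1).resolve_left (mul_ne_zero (mul_ne_zero hu0 hζ0) Complex.I_ne_zero)
  have hτ1 : τ₁' = τ₁ := by exact_mod_cast sub_eq_zero.1 hτ
  have ha : a = 0 := by
    have : a * (ζ * (ζ ^ 2 - 1)) = 0 := by linear_combination hcub.1
    exact (mul_eq_zero.1 this).resolve_right (mul_ne_zero hζ0 hζ2)
  have hc : c = 0 := by
    have : c * (ζ ^ 2 - 1) = 0 := by linear_combination -ζ * hcub.2.2.1 + c * hζζ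
    exact (mul_eq_zero.1 this).resolve_right hζ2
  have hd : d = 0 := by
    have : d * (ζ ^ 4 - 1) = 0 := by
      linear_combination -ζ ^ 3 * hcub.2.2.2 + d * (ζ ^ 2 * conj ζ ^ 2 + ζ * conj ζ + 1) * hζζ
    exact (mul_eq_zero.1 this).resolve_right hζ4
  subst ha hc hd
  have hκ4 : Ord (𝓝 (0 : ℝ × ℝ)) (fun p => ‖p‖) 4
      (fun p => zc (k p) - (u * zc p + b * (zc p * (zc p * wc p)))) :=
    e0.of_eq fun p => by rw [zmap]; ring
  -- the symplectic condition in degree two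
  have hub : conj u * b + u * conj b = 0 := by
    have f1 : Ord (𝓝 (0 : ℝ × ℝ)) (fun p => ‖p‖) 3 (fun p => zmap₁ k p - (u
        + b * (2 * (zc p * wc p) + zc p ^ 2))) := e1.of_eq fun p => by ring
    have f2 : Ord (𝓝 (0 : ℝ × ℝ)) (fun p => ‖p‖) 3 (fun p => zmap₂ k p - I * (u
        + b * (2 * (zc p * wc p) - zc p ^ 2))) := e2.of_eq fun p => by ring
    have z2 := hz.pow 2
    have w2 := hw.pow 2
    have g1 : Ord (𝓝 (0 : ℝ × ℝ)) (fun p => ‖p‖) 0 (zmap₁ k) :=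
      ((f1.mono hr (by norm_num : 0 ≤ 3)).add ((Ord.const u).add
        ((((hq.const_mul 2).add z2).const_mul b).mono hr (Nat.zero_le _)))).of_eq fun p => by ring
    have g2 : Ord (𝓝 (0 : ℝ × ℝ)) (fun p => ‖p‖) 0 (zmap₂ k) :=
      ((f2.mono hr (by norm_num : 0 ≤ 3)).add (((Ord.const u).add
        ((((hq.const_mul 2).sub z2).const_mul b).mono hr (Nat.zero_le _))).const_mul I)).of_eq
        fun p => by ring
    have f1c := f1.conj
    have f2c := f2.conj
    -- the approximations of the derivatives are bounded as well
    have a1 := (g1.sub (f1.mono hr (Nat.zero_le _)))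
    have a1c := a1.conj
    have m1 := f1c.mul_le hr g2 (k := 3) (by norm_num)
    have m2 := a1c.mul_le hr f2 (k := 3) (by norm_num)
    have m3 := f1.mul_le hr g2.conj (k := 3) (by norm_num)
    have m4 := a1.mul_le hr f2c (k := 3) (by norm_num)
    have hq2 := (((hq.pow 2).mono hr (by norm_num : 3 ≤ 2 * 2)).const_mul (6 * b * conj b * I))
    have hd := hdet.and (((hks.of_le (m := 1) (by simp)).eventually (by simp)).mono fun p hp =>
      hp.differentiableAt (by simp))
    have key : Ord (𝓝 (0 : ℝ × ℝ)) (fun p => ‖p‖) 3 (fun p => (0 : ℂ) * zc p ^ 2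
        + (4 * I * (conj u * b + u * conj b)) * (zc p * wc p) + 0 * wc p ^ 2) := by
      refine (((m1.add m2).sub (m3.add m4)).add hq2).neg.congr' ?_
      filter_upwards [hd] with p hp
      have h := det_eq_conj hp.2
      rw [hp.1] at h
      simp only [map_add, map_sub, map_mul, map_pow, map_ofNat, conj_zc, conj_wc, Complex.conj_I,
        Complex.ofReal_one] at h ⊢
      linear_combination h + 2 * I * hu1
    have := (quadratic_zero_of_ord key).2.1
    have h4I : (4 * I : ℂ) ≠ 0 := by simp
    exact (mul_eq_zero.1 this).resolve_left h4I
  -- the squared radius is invariant up to order five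
  have hrad : Ord (𝓝 (0 : ℝ × ℝ)) (fun p => ‖p‖) 5
      (fun p => zc (k p) * wc (k p) - zc p * wc p) := by
    have h1 := hκ4.mul_le hr hκ1.conj (k := 5) (by norm_num)
    have h2 := hκ4.conj
    have h3 := ((hz.const_mul u).add
      (((hz.mul hq).const_mul b).mono hr (by norm_num : 1 ≤ 1 + 2))).mul_le hr h2 (k := 5)
      (by norm_num)
    have h4 := ((hq.pow 3).mono hr (by norm_num : 5 ≤ 2 * 3)).const_mul (b * conj b)
    refine ((h1.add h3).add h4).of_eq fun p => ?_
    simp only [map_add, map_sub, map_mul, conj_zc, conj_wc]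
    linear_combination (-(zc p * wc p)) * hu1 - (zc p * wc p) ^ 2 * hub
  have hdiff : Ord (𝓝 (0 : ℝ × ℝ)) (fun p => ‖p‖) 5 (fun p =>
      (τ₁ * (zc (k p) * wc (k p)) + τ₂ * (zc (k p) * wc (k p)) ^ 2) * I
        - (τ₁ * (zc p * wc p) + τ₂ * (zc p * wc p) ^ 2) * I) := by
    have hqk := (hκ1.mul hκ1.conj).of_eq fun p => by rw [conj_zc]
    have h2 := hrad.mul_le hr ((hqk.add hq).const_mul (τ₂ : ℂ)) (k := 5) (by norm_num)
    refine (((hrad.const_mul (τ₁ : ℂ)).add h2).const_mul I).of_eq fun p => by ring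
  have hunit (c : ℂ) (hc : conj c = c) (p : ℝ × ℝ) :
      ‖Complex.exp ((τ₁ * (zc p * wc p) + c * (zc p * wc p) ^ 2) * I)‖ = 1 :=
    norm_exp_mul_I _ (by simp [conj_zc, conj_wc, mul_comm, hc])
  have hTk : Ord (𝓝 (0 : ℝ × ℝ)) (fun p => ‖p‖) 6 (fun p => zc (T (k p)) - zc (k p) * (ζ *
      Complex.exp ((τ₁ * (zc p * wc p) + τ₂ * (zc p * wc p) ^ 2) * I))) := by
    have h1 := ord_exp 1 one_pos hdiff (tendsto_of_ord tendsto_norm_zero hdiff)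
    have h2 : Ord (𝓝 (0 : ℝ × ℝ)) (fun p => ‖p‖) 0 (fun p =>
        Complex.exp ((τ₁ * (zc p * wc p) + τ₂ * (zc p * wc p) ^ 2) * I)) :=
      IsBigO.of_bound 1 (Eventually.of_forall fun p => by simp [hunit τ₂ (by simp) p])
    refine (((hκ1.const_mul ζ).mul h2).mul_le hr h1 (k := 6) (by norm_num)).of_eq fun p => ?_
    rw [hT, zc_twistMap]
    simp only [Finset.range_one, Finset.sum_singleton, pow_zero, Nat.factorial_zero, Nat.cast_one,
      div_one, mul_sub, mul_one]
    rw [mul_assoc (ζ * _), ← Complex.exp_add, add_sub_cancel]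
    ring
  -- `κ w` changes by a multiple of `q³` under the twist map
  have hδ := drift_eq_zero θ' τ₁' τ₂' (G := fun p => zc (k p) * wc p) (c := -(I * (τ₂' - τ₂) * u))
    ((hκ1.mul hw).mono hr (by norm_num)) ?_
  · have : ((τ₂' : ℂ) - τ₂) = 0 := by
      have h := neg_eq_zero.1 hδ
      exact (mul_eq_zero.1 ((mul_eq_zero.1 h).resolve_right hu0)).resolve_left Complex.I_ne_zero
    exact_mod_cast sub_eq_zero.1 this
  · have h1 := (hconj'.add hTk).mul_le hr t1c (k := 7) (by norm_num)
    have hs : Ord (𝓝 (0 : ℝ × ℝ)) (fun p => ‖p‖) 4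
        (fun p => ((τ₂ : ℂ) - τ₂') * (zc p * wc p) ^ 2 * I) :=
      (((hq.pow 2).const_mul ((τ₂ : ℂ) - τ₂')).const_mul I).of_eq fun p => by ring
    have h2 := (hκ1.mul hw).mul_le hr
      (ord_exp 2 two_pos hs (tendsto_of_ord tendsto_norm_zero hs)) (k := 7) (by norm_num)
    have h3 := (hκ3.mul_le hr (hw.mul hs) (k := 7) (by norm_num))
    refine ((h1.add h2).add h3).of_eq fun p => ?_
    have hwT : wc (T' p) = wc p * (conj ζ *
        Complex.exp (-((τ₁ * (zc p * wc p) + τ₂' * (zc p * wc p) ^ 2) * I))) := by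
      rw [← conj_zc, hT', zc_twistMap, ← hζ', hζeq, hτ1, map_mul, map_mul, conj_zc]
      congr 2
      rw [← Complex.exp_conj]
      congr 1
      simp only [map_mul, map_add, map_pow, conj_zc, conj_wc, Complex.conj_I, Complex.conj_ofReal]
      ring
    have hE : Complex.exp ((τ₁ * (zc p * wc p) + τ₂ * (zc p * wc p) ^ 2) * I)
        * Complex.exp (-((τ₁ * (zc p * wc p) + τ₂' * (zc p * wc p) ^ 2) * I))
        = Complex.exp (((τ₂ : ℂ) - τ₂') * (zc p * wc p) ^ 2 * I) := by
      rw [← Complex.exp_add]; congr 1; ring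
    rw [hwT]
    simp only [Finset.sum_range_succ, Finset.range_zero, Finset.sum_empty, pow_zero, pow_one,
      Nat.factorial_zero, Nat.factorial_one, Nat.cast_one, div_one]
    rw [← hE]
    generalize Complex.exp ((τ₁ * (zc p * wc p) + τ₂ * (zc p * wc p) ^ 2) * I) = E₁
    generalize Complex.exp (-((τ₁ * (zc p * wc p) + τ₂' * (zc p * wc p) ^ 2) * I)) = E₂
    linear_combination (-(zc (k p) * wc p * E₁ * E₂)) * hζζ

end ComplexCoord

end Billiard

namespace Billiard

/-! ### Uniqueness of the second twist coefficient -/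

section Uniqueness

open Complex (I)

/-- A smooth map is Lipschitz near a point, in the language of asymptotics. -/
theorem isBigO_sub_of_contDiffAt {E F α : Type*} [NormedAddCommGroup E] [NormedSpace ℝ E]
    [NormedAddCommGroup F] [NormedSpace ℝ F] {g : E → F} {x : E} (hg : ContDiffAt ℝ ∞ g x)
    {l : Filter α} {a b : α → E} (ha : Tendsto a l (𝓝 x)) (hb : Tendsto b l (𝓝 x)) :
    (fun y => g (a y) - g (b y)) =O[l] fun y => a y - b y := by
  obtain ⟨K, s, hs, hK⟩ := (hg.of_le (m := 1) (by simp)).exists_lipschitzOnWith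
  refine IsBigO.of_bound K ?_
  filter_upwards [ha hs, hb hs] with y h1 h2
  exact hK.norm_sub_le h1 h2

theorem det_comp (A B : ℝ × ℝ →L[ℝ] ℝ × ℝ) : (A.comp B).det = A.det * B.det :=
  LinearMap.det_comp _ _

theorem IsSymplecticGerm.exists_inverse {h : ℝ × ℝ → ℝ × ℝ} (hh : IsSymplecticGerm h) :
    ∃ g, IsSymplecticGerm g ∧ (∀ᶠ p in 𝓝 0, h (g p) = p) ∧ ∀ᶠ p in 𝓝 0, g (h p) = p := by
  obtain ⟨h0, hs, hdet⟩ := hh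
  obtain ⟨g, hg, g0, hhg, hgh⟩ := exists_smooth_inverse hs h0 (by
    rw [hdet.self_of_nhds]; exact one_ne_zero)
  refine ⟨g, ⟨g0, hg, ?_⟩, hhg, hgh⟩
  have hgt : Tendsto g (𝓝 0) (𝓝 0) := by simpa [g0] using hg.continuousAt.tendsto
  filter_upwards [hgt.eventually hdet, hhg.eventually_nhds,
    (hg.of_le (m := 1) (by simp)).eventually (by simp),
    hgt.eventually ((hs.of_le (m := 1) (by simp)).eventually (by simp))] with p h1 h2 h3 h4
  have hid : fderiv ℝ (fun p => h (g p)) p = ContinuousLinearMap.id ℝ _ := by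
    rw [EventuallyEq.fderiv_eq (f := fun p => p) h2, fderiv_fun_id]
  have hc : fderiv ℝ (fun p => h (g p)) p = (fderiv ℝ h (g p)).comp (fderiv ℝ g p) :=
    fderiv_comp p (h4.differentiableAt (by simp)) (h3.differentiableAt (by simp))
  have hd := congrArg ContinuousLinearMap.det (hc.symm.trans hid)
  rw [det_comp, h1, one_mul] at hd
  rw [hd]
  simp [ContinuousLinearMap.det]

theorem IsSymplecticGerm.comp {h g : ℝ × ℝ → ℝ × ℝ} (hh : IsSymplecticGerm h)
    (hg : IsSymplecticGerm g) : IsSymplecticGerm (fun p => h (g p)) := by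
  obtain ⟨h0, hs, hdet⟩ := hh
  obtain ⟨g0, gs, gdet⟩ := hg
  have hgt : Tendsto g (𝓝 0) (𝓝 0) := by simpa [g0] using gs.continuousAt.tendsto
  refine ⟨by simp only [g0, h0], ContDiffAt.comp 0 (by rwa [g0]) gs, ?_⟩
  filter_upwards [hgt.eventually hdet, gdet,
    (gs.of_le (m := 1) (by simp)).eventually (by simp),
    hgt.eventually ((hs.of_le (m := 1) (by simp)).eventually (by simp))] with p h1 h2 h3 h4
  have hc : fderiv ℝ (fun p => h (g p)) p = (fderiv ℝ h (g p)).comp (fderiv ℝ g p) :=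
    fderiv_comp p (h4.differentiableAt (by simp)) (h3.differentiableAt (by simp))
  rw [hc, det_comp, h1, h2, one_mul]

theorem IsSymplecticGerm.tendsto {h : ℝ × ℝ → ℝ × ℝ} (hh : IsSymplecticGerm h) :
    Tendsto h (𝓝 0) (𝓝 0) := by simpa [hh.1] using hh.2.1.continuousAt.tendsto

theorem IsSymplecticGerm.isBigO {h : ℝ × ℝ → ℝ × ℝ} (hh : IsSymplecticGerm h) :
    h =O[𝓝 0] fun p => p := by
  simpa [hh.1] using isBigO_sub_of_contDiffAt hh.2.1 tendsto_id (tendsto_const_nhds (x := 0))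

/-- Uniqueness of the second twist coefficient, in the absence of resonances of order four and
six. -/
theorem second_twist_unique {F : ℝ × ℝ → ℝ × ℝ} (hF : ContDiffAt ℝ ∞ F 0) (hF0 : F 0 = 0)
    {θ τ₁ τ₂ τ : ℝ} {h : ℝ × ℝ → ℝ × ℝ} (hh : IsSymplecticGerm h)
    (h4 : Complex.exp (θ * I) ^ 4 ≠ 1) (h6 : Complex.exp (θ * I) ^ 6 ≠ 1)
    (hN : (fun p => F (h p) - h (twistMap θ τ₁ τ₂ p)) =O[𝓝 (0 : ℝ × ℝ)] fun p => ‖p‖ ^ 6)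
    (hτ : IsSecondTwistCoefficient F τ) : τ = τ₂ := by
  obtain ⟨τ₁', θ', h', hh', hN'⟩ := hτ
  obtain ⟨g, hg, hhg, hgh⟩ := hh.exists_inverse
  have hk := hg.comp hh'
  have hFt : Tendsto F (𝓝 0) (𝓝 0) := by simpa [hF0] using hF.continuousAt.tendsto
  have hT' := tendsto_twistMap θ' τ₁' τ
  have hT := tendsto_twistMap θ τ₁ τ₂
  refine twist_rigidity hk (τ₁' := τ₁') (θ' := θ') (τ₁ := τ₁) h4 h6 ?_
  have e1 : (fun p => g (h' (twistMap θ' τ₁' τ p)) - g (F (h' p)))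
      =O[𝓝 (0 : ℝ × ℝ)] fun p => ‖p‖ ^ 6 := by
    refine (isBigO_sub_of_contDiffAt hg.2.1 (hh'.tendsto.comp hT')
      (hFt.comp hh'.tendsto)).trans ?_
    exact hN'.neg_left.congr_left fun p => by simp
  have e2 : (fun q => g (F (h q)) - g (h (twistMap θ τ₁ τ₂ q)))
      =O[𝓝 (0 : ℝ × ℝ)] fun p => ‖p‖ ^ 6 :=
    (isBigO_sub_of_contDiffAt hg.2.1 (hFt.comp hh.tendsto) (hh.tendsto.comp hT)).trans hN
  have e3 := (e2.comp_tendsto hk.tendsto).trans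
    ((hk.isBigO.norm_norm.pow 6).congr (fun _ => rfl) fun _ => rfl)
  refine (e1.add e3).congr' ?_ .rfl
  filter_upwards [hh'.tendsto.eventually hhg, (hT.comp hk.tendsto).eventually hgh] with p h1 h2
  simp only [Function.comp_apply] at h2 ⊢
  rw [h1, h2]
  abel

end Uniqueness

end Billiard

namespace Billiard

/-! ### Odd jets in the complex coordinates -/

section Jets

variable {α 𝕜 : Type*} [NormedField 𝕜] {l : Filter α} {r : α → ℝ} {s s₁ s₃ s₅ t t₁ t₃ t₅ : α → 𝕜}

/-- The derivative of the cubic part of the generating function at `(s, t)` in the direction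
`(ds, dt)`. -/
def cubicPartDeriv {𝕜 : Type*} [CommRing 𝕜] (p q m s t ds dt : 𝕜) : 𝕜 :=
  (12 * p * s ^ 2 + 6 * q * (s * t) + 2 * m * t ^ 2) * ds
    + (3 * q * (s ^ 2 + t ^ 2) + 4 * m * (s * t)) * dt

theorem OddJet.cubicPart (hr : Ord l r 0 r) (hs : OddJet l r s s₁ s₃ s₅)
    (ht : OddJet l r t t₁ t₃ t₅) (p q m : 𝕜) :
    OddJet l r (fun x => Billiard.cubicPart p q m (s x) (t x)) (fun _ => 0)
      (fun x => Billiard.cubicPart p q m (s₁ x) (t₁ x))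
      (fun x => cubicPartDeriv p q m (s₁ x) (t₁ x) (s₃ x) (t₃ x)) := by
  have hss := hs.mul hr hs
  have htt := ht.mul hr ht
  have h := ((((hss.mul_odd hr hs).const_mul (4 * p)).add
    (((hss.mul_odd hr ht).const_mul (3 * q)).add ((htt.mul_odd hr ht).const_mul q))).add
    ((htt.mul_odd hr hs).const_mul (2 * m)))
  refine (h.congr (.of_forall fun x => ?_)).cast (fun x => ?_) (fun x => ?_) fun x => ?_ <;>
  try simp only [Billiard.cubicPart, cubicPartDeriv]
  all_goals ring

theorem OddJet.quinticPart (hr : Ord l r 0 r) (hs : OddJet l r s s₁ s₃ s₅)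
    (ht : OddJet l r t t₁ t₃ t₅) (e₀ e₁ e₂ e₃ : 𝕜) :
    OddJet l r (fun x => Billiard.quinticPart e₀ e₁ e₂ e₃ (s x) (t x)) (fun _ => 0) (fun _ => 0)
      (fun x => Billiard.quinticPart e₀ e₁ e₂ e₃ (s₁ x) (t₁ x)) := by
  have hss := hs.mul hr hs
  have htt := ht.mul hr ht
  have hs4 := hss.mul hr hss
  have ht4 := htt.mul hr htt
  have hst := hss.mul hr htt
  have h := (((((hs4.mul_odd hr hs).const_mul (6 * e₀)).add
    ((((hs4.mul_odd hr ht).const_mul (5 * e₁))).add ((ht4.mul_odd hr ht).const_mul e₁))).add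
    (((hst.mul_odd hr hs).const_mul (4 * e₂)).add ((ht4.mul_odd hr hs).const_mul (2 * e₂)))).add
    ((hst.mul_odd hr ht).const_mul (3 * e₃)))
  refine (h.congr (.of_forall fun x => ?_)).cast (fun x => ?_) (fun x => ?_) fun x => ?_ <;>
  try simp only [Billiard.quinticPart]
  all_goals ring

end Jets

section ComplexCoord

open Complex (I)

@[fun_prop]
theorem continuous_zc : Continuous zc := by unfold zc; fun_prop

@[fun_prop]
theorem continuous_wc : Continuous wc := by unfold wc; fun_prop

/-- A continuous homogeneous function of degree `n` is `O(‖p‖ ^ n)`. -/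
theorem Ord.of_homogeneous {f : ℝ × ℝ → ℂ} {n : ℕ} (hc : Continuous f)
    (hf : ∀ (τ : ℝ) (v : ℝ × ℝ), f (τ • v) = (τ : ℂ) ^ n * f v) :
    Ord (𝓝 (0 : ℝ × ℝ)) (fun p => ‖p‖) n f := by
  obtain ⟨M, hM⟩ := (isCompact_closedBall (0 : ℝ × ℝ) 1).exists_bound_of_continuousOn
    hc.continuousOn
  refine IsBigO.of_bound M (Eventually.of_forall fun p => ?_)
  have h1 : f p = (‖p‖ : ℂ) ^ n * f (‖p‖⁻¹ • p) := by
    rcases eq_or_ne p 0 with rfl | hp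
    · have := hf 0 0
      simpa using this
    · rw [← hf, smul_smul, mul_inv_cancel₀ (norm_ne_zero_iff.2 hp), one_smul]
  have h2 := hM (‖p‖⁻¹ • p) (by
    rw [mem_closedBall_zero_iff, norm_smul, norm_inv, norm_norm]
    exact inv_mul_le_one)
  rw [h1, norm_mul, norm_pow, norm_pow, Complex.norm_real, norm_norm, mul_comm]
  gcongr

theorem OddJet.conj {α : Type*} {l : Filter α} {r : α → ℝ} {f f₁ f₃ f₅ : α → ℂ}
    (hf : OddJet l r f f₁ f₃ f₅) : OddJet l r (fun x => conj (f x)) (fun x => conj (f₁ x))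
      (fun x => conj (f₃ x)) (fun x => conj (f₅ x)) :=
  ⟨hf.o1.conj, hf.o3.conj, hf.o5.conj, hf.rem.conj.of_eq fun x => by simp⟩

theorem oddJet_twistMap (θ τ₁ τ₂ : ℝ) :
    OddJet (𝓝 (0 : ℝ × ℝ)) (fun p => ‖p‖) (fun p => zc (twistMap θ τ₁ τ₂ p))
      (fun p => Complex.exp (θ * I) * zc p)
      (fun p => Complex.exp (θ * I) * (I * τ₁) * (zc p ^ 2 * wc p))
      (fun p => Complex.exp (θ * I) * (I * τ₂ - τ₁ ^ 2 / 2) * (zc p ^ 3 * wc p ^ 2)) := by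
  have hr := ord_norm_zero (E := ℝ × ℝ)
  refine ⟨Ord.of_homogeneous (by fun_prop) fun τ v => ?_,
    Ord.of_homogeneous (by fun_prop) fun τ v => ?_,
    Ord.of_homogeneous (by fun_prop) fun τ v => ?_, ?_⟩
  iterate 3 simp only [zc_smul, wc_smul]; ring
  have hph := ord_phase τ₁ τ₂ hr ord_zw
  have h1 := (ord_zc.const_mul (Complex.exp (θ * I))).mul_le hr
    (ord_exp 3 three_pos hph (tendsto_of_ord tendsto_norm_zero hph)) (k := 6) (by norm_num)
  have h2 := ((ord_zc.mul (ord_zw.pow 3)).const_mul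
    (-(Complex.exp (θ * I) * (τ₁ * τ₂)))).mono hr (by norm_num : 6 ≤ 1 + 2 * 3)
  have h3 := ((ord_zc.mul (ord_zw.pow 4)).const_mul
    (-(Complex.exp (θ * I) * (τ₂ ^ 2 / 2)))).mono hr (by norm_num : 6 ≤ 1 + 2 * 4)
  refine ((h1.add h2).add h3).of_eq fun p => ?_
  rw [zc_twistMap]
  simp only [Finset.sum_range_succ, Finset.range_zero, Finset.sum_empty, pow_zero, pow_one,
      Nat.factorial, Nat.cast_one, div_one]
  push_cast
  linear_combination Complex.exp (θ * I) * zc p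
    * -((τ₁ * (zc p * wc p) + τ₂ * (zc p * wc p) ^ 2) ^ 2 / 2) * Complex.I_sq

/-- The odd polynomial of degree five in `z`, `w` with real coefficients that is used for the
coordinates of the normal form. -/
noncomputable def oddPoly (a b c d e f : ℝ) (p : ℝ × ℝ) : ℂ :=
  a * zc p + b * zc p ^ 3 + c * (zc p ^ 2 * wc p) + d * zc p ^ 5 + e * (zc p ^ 4 * wc p)
    + f * (zc p ^ 3 * wc p ^ 2)

theorem oddJet_oddPoly (a b c d e f : ℝ) :
    OddJet (𝓝 (0 : ℝ × ℝ)) (fun p => ‖p‖) (oddPoly a b c d e f) (fun p => a * zc p)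
      (fun p => b * zc p ^ 3 + c * (zc p ^ 2 * wc p))
      (fun p => d * zc p ^ 5 + e * (zc p ^ 4 * wc p) + f * (zc p ^ 3 * wc p ^ 2)) := by
  refine ⟨Ord.of_homogeneous (by fun_prop) fun τ v => ?_,
    Ord.of_homogeneous (by fun_prop) fun τ v => ?_,
    Ord.of_homogeneous (by fun_prop) fun τ v => ?_, Ord.zero.of_eq fun p => ?_⟩
  iterate 3 simp only [zc_smul, wc_smul]; ring
  simp only [oddPoly]; ring

theorem oddJet_oddPoly_twistMap (a b c d e f : ℝ) {θ τ₁ τ₂ : ℝ} {ζ : ℂ}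
    (hζ : ζ = Complex.exp (θ * I)) :
    OddJet (𝓝 (0 : ℝ × ℝ)) (fun p => ‖p‖) (fun p => oddPoly a b c d e f (twistMap θ τ₁ τ₂ p))
      (fun p => a * ζ * zc p)
      (fun p => b * ζ ^ 3 * zc p ^ 3 + (c * ζ + a * ζ * (I * τ₁)) * (zc p ^ 2 * wc p))
      (fun p => d * ζ ^ 5 * zc p ^ 5 + (e * ζ ^ 3 + 3 * b * ζ ^ 3 * (I * τ₁)) * (zc p ^ 4 * wc p)
        + (f * ζ + c * ζ * (I * τ₁) + a * ζ * (I * τ₂ - τ₁ ^ 2 / 2))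
          * (zc p ^ 3 * wc p ^ 2)) := by
  have hr := ord_norm_zero (E := ℝ × ℝ)
  have hT := oddJet_twistMap θ τ₁ τ₂
  rw [← hζ] at hT
  have hq : EvenJet (𝓝 (0 : ℝ × ℝ)) (fun p => ‖p‖) (fun p => zc p * wc p) (fun _ => 0)
      (fun p => zc p * wc p) (fun _ => 0) :=
    ⟨.zero, ord_zw, .zero, Ord.zero.of_eq fun p => by ring⟩
  have hTT := hT.mul hr hT
  have h := (((((hT.const_mul (a : ℂ)).add ((hTT.mul_odd hr hT).const_mul (b : ℂ))).add
    ((hq.mul_odd hr hT).const_mul (c : ℂ))).add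
    (((hTT.mul hr hTT).mul_odd hr hT).const_mul (d : ℂ))).add
    (((hq.mul hr hTT).mul_odd hr hT).const_mul (e : ℂ))).add
    (((hq.mul hr hq).mul_odd hr hT).const_mul (f : ℂ))
  refine (h.congr (.of_forall fun p => ?_)).cast (fun p => ?_) (fun p => ?_) fun p => ?_
  · have hi := zc_mul_wc_twistMap θ τ₁ τ₂ p
    simp only [oddPoly]
    rw [← hi]
    ring
  all_goals ring

end ComplexCoord

end Billiard

namespace Billiard

/-! ### The coefficients of the normal form -/

section Coefficients

open Complex (I)

variable {p q m e₀ e₁ e₂ e₃ C S : ℝ} {x y : ℂ}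

/-- The coefficient of `z³` in `cubicPart p q m (z + w) (x z + y w)`. -/
def cubic₃₀ (p q m x : ℂ) : ℂ := 4 * p + q * (3 * x + x ^ 3) + 2 * m * x ^ 2

/-- The coefficient of `z² w` in `cubicPart p q m (z + w) (x z + y w)`. -/
def cubic₂₁ (p q m x y : ℂ) : ℂ :=
  12 * p + q * (3 * (y + 2 * x) + 3 * x ^ 2 * y) + 2 * m * (x ^ 2 + 2 * x * y)

/-- The coefficient of `z⁵` in `quinticPart e₀ e₁ e₂ e₃ (z + w) (x z + y w)`. -/
def quintic₅₀ (e₀ e₁ e₂ e₃ x : ℂ) : ℂ :=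
  6 * e₀ + e₁ * (5 * x + x ^ 5) + e₂ * (4 * x ^ 2 + 2 * x ^ 4) + 3 * e₃ * x ^ 3

/-- The coefficient of `z⁴ w` in `quinticPart e₀ e₁ e₂ e₃ (z + w) (x z + y w)`. -/
def quintic₄₁ (e₀ e₁ e₂ e₃ x y : ℂ) : ℂ :=
  30 * e₀ + e₁ * (5 * (4 * x + y) + 5 * x ^ 4 * y)
    + e₂ * (4 * (2 * x * y + 3 * x ^ 2) + 2 * (4 * x ^ 3 * y + x ^ 4))
    + 3 * e₃ * (3 * x ^ 2 * y + 2 * x ^ 3)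

/-- The coefficient of `z³ w²` in `quinticPart e₀ e₁ e₂ e₃ (z + w) (x z + y w)`. -/
def quintic₃₂ (e₀ e₁ e₂ e₃ x y : ℂ) : ℂ :=
  60 * e₀ + e₁ * (5 * (6 * x + 4 * y) + 10 * x ^ 3 * y ^ 2)
    + e₂ * (4 * (y ^ 2 + 6 * x * y + 3 * x ^ 2) + 2 * (6 * x ^ 2 * y ^ 2 + 4 * x ^ 3 * y))
    + 3 * e₃ * (3 * x * y ^ 2 + 6 * x ^ 2 * y + x ^ 3)

/-- The coefficient of `z²` in the `s`-derivative of `cubicPart p q m s t` at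
`(z + w, x z + y w)`. -/
def hess₂₀ (p q m x : ℂ) : ℂ := 12 * p + 6 * q * x + 2 * m * x ^ 2

/-- The coefficient of `z w` in the `s`-derivative of `cubicPart p q m s t` at
`(z + w, x z + y w)`. -/
def hess₁₁ (p q m x y : ℂ) : ℂ := 24 * p + 6 * q * (x + y) + 4 * m * (x * y)

/-- The coefficient of `z²` in the `t`-derivative of `cubicPart p q m s t` at
`(z + w, x z + y w)`. -/
def mixed₂₀ (q m x : ℂ) : ℂ := 3 * q + 3 * q * x ^ 2 + 4 * m * x

/-- The coefficient of `z w` in the `t`-derivative of `cubicPart p q m s t` at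
`(z + w, x z + y w)`. -/
def mixed₁₁ (q m x y : ℂ) : ℂ := 6 * q + 6 * q * (x * y) + 4 * m * (x + y)

/-- The coefficients of the coordinates `X = 2 Re (ξ z + b z³ + c z² w + d z⁵ + e z⁴ w + f z³ w²)`
and `Y = 2 Im (ξ' z + b' z³ + c' z² w + d' z⁵ + e' z⁴ w + f' z³ w²)` of a normal form with twist
coefficients `τ₁`, `τ₂` and multiplier `x`, where `y` is the conjugate of `x`. The conditions are
the identities between the coefficients in the equation `u = h (X, X ∘ T)` for the momentum `u = Y`,
and the vanishing of the coefficients of `z w` and of `z² w²` in the Jacobian determinant. -/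
structure NormalForm (G : GenCoeffs) (x y : ℂ) (τ₁ τ₂ : ℝ) where
  (ξ b c d e f ξ' b' c' d' e' f' : ℝ)
  eq₁₀ : (G.α + G.β * x) * ξ = -(I * ξ')
  eq₃₀ : (G.α + G.β * x ^ 3) * b + ξ ^ 3 * cubic₃₀ G.p G.q G.m x = -(I * b')
  eq₂₁ : (G.α + G.β * x) * c + G.β * (ξ * x * (I * τ₁)) + ξ ^ 3 * cubic₂₁ G.p G.q G.m x y
    = -(I * c')
  eq₅₀ : (G.α + G.β * x ^ 5) * d + (ξ ^ 2 * (hess₂₀ G.p G.q G.m x * b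
    + mixed₂₀ G.q G.m x * (b * x ^ 3)) + ξ ^ 5 * quintic₅₀ G.e₀ G.e₁ G.e₂ G.e₃ x) = -(I * d')
  eq₄₁ : (G.α + G.β * x ^ 3) * e + (G.β * (3 * b * x ^ 3 * (I * τ₁))
    + ξ ^ 2 * (hess₂₀ G.p G.q G.m x * c + hess₁₁ G.p G.q G.m x y * b
      + mixed₂₀ G.q G.m x * (c * x + ξ * x * (I * τ₁)) + mixed₁₁ G.q G.m x y * (b * x ^ 3))
    + ξ ^ 5 * quintic₄₁ G.e₀ G.e₁ G.e₂ G.e₃ x y) = -(I * e')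
  eq₃₂ : (G.α + G.β * x) * f + (G.β * (c * x * (I * τ₁) + ξ * x * (I * τ₂ - τ₁ ^ 2 / 2))
    + ξ ^ 2 * ((hess₂₀ G.p G.q G.m x + hess₁₁ G.p G.q G.m x y) * c + hess₂₀ G.p G.q G.m y * b
      + mixed₂₀ G.q G.m x * (c * y - ξ * y * (I * τ₁))
      + mixed₁₁ G.q G.m x y * (c * x + ξ * x * (I * τ₁)) + mixed₂₀ G.q G.m y * (b * x ^ 3))
    + ξ ^ 5 * quintic₃₂ G.e₀ G.e₁ G.e₂ G.e₃ x y) = -(I * f')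
  det₀₀ : 4 * (ξ * ξ') = 1
  det₁₁ : ξ * c' + c * ξ' = 0
  det₂₂ : ξ * f' + f * ξ' + 3 * (b * b') + c * c' = 0

theorem exists_eq_neg_I_mul {k : ℂ} (h : k.re = 0) : ∃ v : ℝ, k = -(I * v) ∧ v = -k.im :=
  ⟨-k.im, by apply Complex.ext <;> simp [h], rfl⟩

/-- Solves a resonance-free homological equation in degree `n`. -/
theorem exists_homological {C S β : ℝ} (hCS : C ^ 2 + S ^ 2 = 1) (hβ : β ≠ 0) {x : ℂ}
    (hx : x = C + S * I) (n : ℕ) (h1 : x ^ n ≠ 1) (h2 : x ^ (n + 2) ≠ 1) (k : ℂ) :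
    ∃ d d' : ℝ, ((-(β * C) : ℝ) + β * x ^ (n + 1)) * d + k = -(I * d') := by
  have hxx : x * conj x = 1 := by
    rw [hx]
    simp only [map_add, map_mul, Complex.conj_ofReal, Complex.conj_I]
    have : ((C : ℂ) ^ 2 + S ^ 2) = 1 := by exact_mod_cast hCS
    linear_combination this - S ^ 2 * Complex.I_sq
  have hre : (x ^ (n + 1)).re ≠ C := by
    intro h
    have h3 : x ^ (n + 1) + conj (x ^ (n + 1)) = x + conj x := by
      rw [Complex.add_conj, Complex.add_conj, h, hx]
      simp
    have h4 : (x ^ n - 1) * (x ^ (n + 2) - 1) = 0 := by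
      rw [map_pow] at h3
      have h5 : x ^ (n + 1) * conj x ^ (n + 1) = 1 := by rw [← mul_pow, hxx, one_pow]
      linear_combination x ^ (n + 1) * h3 - h5 + x ^ n * hxx
    rcases mul_eq_zero.1 h4 with h | h
    exacts [h1 (sub_eq_zero.1 h), h2 (sub_eq_zero.1 h)]
  have hne : β * ((x ^ (n + 1)).re - C) ≠ 0 := mul_ne_zero hβ (sub_ne_zero.2 hre)
  obtain ⟨d', hd, -⟩ := exists_eq_neg_I_mul (k := ((-(β * C) : ℝ) + β * x ^ (n + 1))
    * (-k.re / (β * ((x ^ (n + 1)).re - C)) : ℝ) + k) (by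
      rw [Complex.add_re, Complex.re_mul_ofReal, Complex.add_re, Complex.re_ofReal_mul,
        Complex.ofReal_re]
      have : -(β * C) + β * (x ^ (n + 1)).re = β * ((x ^ (n + 1)).re - C) := by ring
      rw [this, mul_div_cancel₀ _ hne]
      ring)
  exact ⟨_, d', hd⟩

end Coefficients

end Billiard

namespace Billiard

section Coefficients

open Complex (I)

variable {p q m e₀ e₁ e₂ e₃ C S : ℝ} {x y : ℂ}

theorem cubic₃₀_re (hCS : C ^ 2 + S ^ 2 = 1) :
    (cubic₃₀ p q m (C + S * I)).re = 4 * p + 4 * q * C ^ 3 + 2 * m * (2 * C ^ 2 - 1) := by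
  simp [cubic₃₀, pow_succ]
  grind

theorem cubic₂₁_re (hCS : C ^ 2 + S ^ 2 = 1) : (cubic₂₁ p q m (C + S * I) (C - S * I)).re =
    12 * p + 12 * q * C + 2 * m * (2 * C ^ 2 + 1) := by
  simp [cubic₂₁, pow_succ]
  grind

theorem cubic₂₁_im (hCS : C ^ 2 + S ^ 2 = 1) : (cubic₂₁ p q m (C + S * I) (C - S * I)).im =
    S * (6 * q + 4 * m * C) := by
  simp [cubic₂₁, pow_succ]
  grind

theorem quintic₃₂_re (hCS : C ^ 2 + S ^ 2 = 1) :
    (quintic₃₂ e₀ e₁ e₂ e₃ (C + S * I) (C - S * I)).re = 60 * e₀ + 60 * e₁ * C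
      + 12 * e₂ * (4 * C ^ 2 + 1) + 6 * e₃ * (2 * C ^ 3 + 3 * C) := by
  simp [quintic₃₂, pow_succ]
  grind

/-- The real part of the factor of the coefficient `c` in the equation for `z³ w²`. -/
theorem second_order_re_c (hCS : C ^ 2 + S ^ 2 = 1) (hx : x = C + S * I) (hy : y = C - S * I) :
    (hess₂₀ p q m x + hess₁₁ p q m x y + mixed₂₀ q m x * y + mixed₁₁ q m x y * x).re =
      3 * (12 * p + 12 * q * C + 2 * m * (2 * C ^ 2 + 1)) := by
  subst hx hy
  simp [hess₂₀, hess₁₁, mixed₂₀, mixed₁₁, pow_succ]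
  grind

/-- The real part of the factor of the coefficient `b` in the equation for `z³ w²`. -/
theorem second_order_re_b (hCS : C ^ 2 + S ^ 2 = 1) (hx : x = C + S * I) (hy : y = C - S * I) :
    (hess₂₀ p q m y + mixed₂₀ q m y * x ^ 3).re =
      3 * (4 * p + 4 * q * C ^ 3 + 2 * m * (2 * C ^ 2 - 1)) := by
  subst hx hy
  simp [hess₂₀, mixed₂₀, pow_succ]
  grind

/-- The real part of the factor of `ξ³ τ₁` in the equation for `z³ w²`. -/
theorem second_order_re_τ (hCS : C ^ 2 + S ^ 2 = 1) (hx : x = C + S * I) (hy : y = C - S * I) :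
    (I * (mixed₁₁ q m x y * x - mixed₂₀ q m x * y)).re = -(2 * S * (6 * q + 4 * m * C)) := by
  subst hx hy
  simp [mixed₂₀, mixed₁₁, pow_succ]
  grind

/-- The number `g` of the formula `τ₁ = -g / (4 β² S²)` for the first twist coefficient. -/
def GenCoeffs.g (G : GenCoeffs) (C : ℝ) : ℝ :=
  12 * G.p + 12 * G.q * C + 2 * G.m * (2 * C ^ 2 + 1)

/-- The combination of the quartic coefficients of the generating function that is responsible for
the resonant term of order four. -/
def GenCoeffs.N (G : GenCoeffs) (C : ℝ) : ℝ :=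
  4 * G.p + 4 * G.q * C ^ 3 + 2 * G.m * (2 * C ^ 2 - 1)

/-- The combination of the coefficients of order six that enters the second twist coefficient. -/
def GenCoeffs.sextic (G : GenCoeffs) (C : ℝ) : ℝ :=
  60 * G.e₀ + 60 * G.e₁ * C + 12 * G.e₂ * (4 * C ^ 2 + 1) + 6 * G.e₃ * (2 * C ^ 3 + 3 * C)

/-- The first twist coefficient of the map generated by `G`, with multiplier `C + i S`. -/
noncomputable def GenCoeffs.twist₁ (G : GenCoeffs) (C S : ℝ) : ℝ :=
  -G.g C / (4 * G.β ^ 2 * S ^ 2)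

/-- The second twist coefficient of the map generated by `G`, with multiplier `C + i S`. -/
noncomputable def GenCoeffs.twist₂ (G : GenCoeffs) (C S : ℝ) : ℝ :=
  3 * G.N C ^ 2 / (64 * G.β ^ 4 * C * S ^ 5) + G.sextic C / (16 * G.β ^ 3 * S ^ 3)
    + 3 * (6 * G.q + 4 * G.m * C) * G.twist₁ C S / (4 * G.β ^ 2 * S)
    - 3 * C * G.twist₁ C S ^ 2 / (2 * S)

/-- Solution of the equations of a normal form. In the non-resonant terms the first coefficient is
chosen to make an equation solvable for the second one. In the terms `z`, `z² w` and `z³ w²` both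
sides are determined, by the equations and the conditions on the determinant, and solvability forces
the values of `τ₁` and `τ₂`. -/
theorem exists_normalForm (G : GenCoeffs) (hCS : C ^ 2 + S ^ 2 = 1) (hα : G.α = -(G.β * C))
    (hβ : G.β ≠ 0) (hS : G.β * S < 0) (hC : C ≠ 0) (hx : x = C + S * I) (hy : y = C - S * I)
    (h4 : x ^ 4 ≠ 1) (h6 : x ^ 6 ≠ 1) :
    Nonempty (NormalForm G x y (G.twist₁ C S) (G.twist₂ C S)) := by
  obtain ⟨α, β, p, q, m, e₀, e₁, e₂, e₃⟩ := G
  simp only at hα hβ hS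
  set τ₁ := GenCoeffs.twist₁ ⟨α, β, p, q, m, e₀, e₁, e₂, e₃⟩ C S with hτ₁
  set τ₂ := GenCoeffs.twist₂ ⟨α, β, p, q, m, e₀, e₁, e₂, e₃⟩ C S with hτ₂
  have hS0 : S ≠ 0 := by rintro rfl; simp at hS
  have h2 : x ^ 2 ≠ 1 := fun h => h4 (by linear_combination (x ^ 2 + 1) * h)
  set X := -1 / (4 * β * S) with hX
  have hX0 : 0 < X := by
    rw [hX, neg_div, ← div_neg]
    exact div_pos one_pos (by linarith)
  set ξ := √X with hξ
  have hξ2 : ξ ^ 2 = X := Real.sq_sqrt hX0.le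
  have hξ0 : ξ ≠ 0 := (Real.sqrt_pos.2 hX0).ne'
  have hαx : (α : ℂ) + β * x = β * S * I := by rw [hα, hx]; push_cast; ring
  set N := 4 * p + 4 * q * C ^ 3 + 2 * m * (2 * C ^ 2 - 1) with hN
  set g := 12 * p + 12 * q * C + 2 * m * (2 * C ^ 2 + 1) with hg
  set w := 6 * q + 4 * m * C with hw
  have hτg : τ₁ = -g / (4 * β ^ 2 * S ^ 2) := rfl
  have hα' : (α : ℂ) = (-(β * C) : ℝ) := by rw [hα]
  -- order one
  have det₀₀ : 4 * (ξ * -(β * ξ * S)) = 1 := by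
    have : 4 * (ξ * -(β * ξ * S)) = -(4 * β * S) * ξ ^ 2 := by ring
    rw [this, hξ2, hX]
    field_simp
  -- order three
  set b := ξ ^ 3 * N / (4 * β * C * S ^ 2) with hb
  obtain ⟨b', eq₃₀, -⟩ := exists_eq_neg_I_mul
    (k := ((α : ℂ) + β * x ^ 3) * b + ξ ^ 3 * cubic₃₀ p q m x) (by
      have h3 : (x ^ 3).re = 4 * C ^ 3 - 3 * C := by
        rw [hx]; simp [pow_succ]; grind
      rw [Complex.add_re, Complex.re_mul_ofReal, Complex.add_re, Complex.re_ofReal_mul, h3,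
        Complex.ofReal_re, ← Complex.ofReal_pow, Complex.re_ofReal_mul, hx, cubic₃₀_re hCS, hα, hb]
      have : -(β * C) + β * (4 * C ^ 3 - 3 * C) = -(4 * β * C * S ^ 2) := by
        linear_combination 4 * β * C * hCS
      rw [this]
      field_simp
      ring)
  set c := -(ξ * β * C * τ₁ + ξ ^ 3 * S * w) / (2 * β * S) with hc
  obtain ⟨c', eq₂₁, hc'⟩ := exists_eq_neg_I_mul
    (k := ((α : ℂ) + β * x) * c + β * (ξ * x * (I * τ₁)) + ξ ^ 3 * cubic₂₁ p q m x y) (by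
      have h1 : (((α : ℂ) + β * x) * c).re = 0 := by rw [hαx]; simp
      have h3 : ((β : ℂ) * (ξ * x * (I * τ₁))).re = -(β * ξ * S * τ₁) := by rw [hx]; simp; ring
      rw [Complex.add_re, Complex.add_re, h1, h3, ← Complex.ofReal_pow, Complex.re_ofReal_mul, hx,
        hy, cubic₂₁_re hCS, ← hg, hτg]
      have : ξ ^ 3 = ξ * X := by rw [← hξ2]; ring
      rw [this, hX]
      field_simp
      ring)
  have hc'' : c' = -(β * S * c + β * ξ * τ₁ * C + ξ ^ 3 * (S * w)) := by
    have h1 : (((α : ℂ) + β * x) * c).im = β * S * c := by rw [hαx]; simp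
    have h3 : ((β : ℂ) * (ξ * x * (I * τ₁))).im = β * ξ * τ₁ * C := by rw [hx]; simp; ring
    rw [hc', Complex.add_im, Complex.add_im, h1, h3, ← Complex.ofReal_pow, Complex.im_ofReal_mul,
      hx, hy, cubic₂₁_im hCS]
  have det₁₁ : ξ * c' + c * -(β * ξ * S) = 0 := by
    rw [hc'', hc]
    field_simp
    ring
  -- order five
  obtain ⟨d, d', eq₅₀⟩ := exists_homological hCS hβ hx 4 h4 h6
    (ξ ^ 2 * (hess₂₀ p q m x * b + mixed₂₀ q m x * (b * x ^ 3))
      + ξ ^ 5 * quintic₅₀ e₀ e₁ e₂ e₃ x)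
  obtain ⟨e, e', eq₄₁⟩ := exists_homological hCS hβ hx 2 h2 h4
    (β * (3 * b * x ^ 3 * (I * τ₁)) + ξ ^ 2 * (hess₂₀ p q m x * c + hess₁₁ p q m x y * b
      + mixed₂₀ q m x * (c * x + ξ * x * (I * τ₁)) + mixed₁₁ q m x y * (b * x ^ 3))
      + ξ ^ 5 * quintic₄₁ e₀ e₁ e₂ e₃ x y)
  obtain ⟨k, hk⟩ : ∃ k : ℂ, k = β * (c * x * (I * τ₁) + ξ * x * (I * τ₂ - τ₁ ^ 2 / 2))
    + ξ ^ 2 * ((hess₂₀ p q m x + hess₁₁ p q m x y) * c + hess₂₀ p q m y * b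
      + mixed₂₀ q m x * (c * y - ξ * y * (I * τ₁))
      + mixed₁₁ q m x y * (c * x + ξ * x * (I * τ₁)) + mixed₂₀ q m y * (b * x ^ 3))
    + ξ ^ 5 * quintic₃₂ e₀ e₁ e₂ e₃ x y := ⟨_, rfl⟩
  have hkre : k.re = 0 := by
    have h1 : k = ((c * β * τ₁ : ℝ) * (x * I) + (β * ξ * τ₂ : ℝ) * (x * I)
        - (β * ξ * τ₁ ^ 2 / 2 : ℝ) * x)
        + ((ξ ^ 2 * c : ℝ) * (hess₂₀ p q m x + hess₁₁ p q m x y + mixed₂₀ q m x * y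
          + mixed₁₁ q m x y * x)
        + (ξ ^ 2 * b : ℝ) * (hess₂₀ p q m y + mixed₂₀ q m y * x ^ 3)
        + (ξ ^ 3 * τ₁ : ℝ) * (I * (mixed₁₁ q m x y * x - mixed₂₀ q m x * y)))
        + (ξ ^ 5 : ℝ) * quintic₃₂ e₀ e₁ e₂ e₃ x y := by
      rw [hk]; push_cast; ring
    have hxI : (x * I).re = -S := by rw [hx]; simp
    have hxr : x.re = C := by rw [hx]; simp
    rw [h1]
    simp only [Complex.add_re, Complex.sub_re, Complex.re_ofReal_mul, hxI, hxr,
      second_order_re_c hCS hx hy, second_order_re_b hCS hx hy, second_order_re_τ hCS hx hy]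
    rw [hx, hy, quintic₃₂_re hCS, ← hg, ← hN, ← hw]
    have hτ₂' : τ₂ = 3 * N ^ 2 / (64 * β ^ 4 * C * S ^ 5)
      + (60 * e₀ + 60 * e₁ * C + 12 * e₂ * (4 * C ^ 2 + 1) + 6 * e₃ * (2 * C ^ 3 + 3 * C))
        / (16 * β ^ 3 * S ^ 3) + 3 * w * τ₁ / (4 * β ^ 2 * S) - 3 * C * τ₁ ^ 2 / (2 * S) := rfl
    have hgτ : g = -(4 * β ^ 2 * S ^ 2 * τ₁) := by rw [hτg]; field_simp
    have h3 : ξ ^ 3 = ξ * X := by rw [← hξ2]; ring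
    have h5 : ξ ^ 5 = ξ * X ^ 2 := by rw [← hξ2]; ring
    rw [hτ₂', hgτ, hb, hc, hξ2, h3, h5, hX]
    clear_value N w τ₁ ξ
    field_simp
    ring
  set f := (ξ * (k.im) - 3 * b * b' - c * c') / (2 * -(β * ξ * S)) with hf
  obtain ⟨f', eq₃₂, hf'⟩ := exists_eq_neg_I_mul (k := ((α : ℂ) + β * x) * f + k) (by
    rw [hαx, Complex.add_re, hkre]; simp)
  have hf'' : f' = -(β * S * f + k.im) := by
    rw [hf', hαx]; simp
  refine ⟨⟨ξ, b, c, d, e, f, -(β * ξ * S), b', c', d', e', f', ?_, eq₃₀, eq₂₁, ?_, ?_, ?_, det₀₀,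
    det₁₁, ?_⟩⟩
  · simp only [hαx]; push_cast; ring
  · simpa only [hα'] using eq₅₀
  · simpa only [hα'] using eq₄₁
  · rw [← eq₃₂, hk]
  · rw [hf'', hf]
    field_simp
    ring

end Coefficients

end Billiard

namespace Billiard

/-! ### The normal form as a pair of functions -/

section NormalForm

open Complex (I)

theorem Ord.of_ofReal {α : Type*} {l : Filter α} {r : α → ℝ} {n : ℕ} {f : α → ℝ}
    (h : Ord l r n (fun x => (f x : ℂ))) : Ord l r n f :=
  IsBigO.trans (IsBigO.of_bound 1 (by simp)) h

namespace NormalForm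

variable {G : GenCoeffs} {x y : ℂ} {τ₁ τ₂ : ℝ} (nf : NormalForm G x y τ₁ τ₂)

/-- The first coordinate of a normal form. -/
noncomputable def X (p : ℝ × ℝ) : ℝ := 2 * (oddPoly nf.ξ nf.b nf.c nf.d nf.e nf.f p).re

/-- The second coordinate of a normal form. -/
noncomputable def Y (p : ℝ × ℝ) : ℝ := 2 * (oddPoly nf.ξ' nf.b' nf.c' nf.d' nf.e' nf.f' p).im

theorem ofReal_X (p : ℝ × ℝ) : (nf.X p : ℂ) = oddPoly nf.ξ nf.b nf.c nf.d nf.e nf.f p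
    + conj (oddPoly nf.ξ nf.b nf.c nf.d nf.e nf.f p) := by
  rw [Complex.add_conj, X]

theorem ofReal_Y (p : ℝ × ℝ) : (nf.Y p : ℂ) = -(I * (oddPoly nf.ξ' nf.b' nf.c' nf.d' nf.e' nf.f' p
    - conj (oddPoly nf.ξ' nf.b' nf.c' nf.d' nf.e' nf.f' p))) := by
  rw [Complex.sub_conj, Y]
  push_cast
  linear_combination (2 * (oddPoly nf.ξ' nf.b' nf.c' nf.d' nf.e' nf.f' p).im : ℂ) * Complex.I_sq

end NormalForm

/-- The derivative `∂/∂s` of the generating function `G`. -/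
def GenCoeffs.momentum (G : GenCoeffs) (s t : ℝ) : ℝ :=
  G.α * s + G.β * t + cubicPart G.p G.q G.m s t + quinticPart G.e₀ G.e₁ G.e₂ G.e₃ s t

/-- The coordinates of a normal form satisfy the equation `u = h (X, X ∘ T)`. -/
theorem NormalForm.momentum_eq {G : GenCoeffs} {x y : ℂ} {θ τ₁ τ₂ : ℝ}
    (nf : NormalForm G x y τ₁ τ₂) (hx : x = Complex.exp (θ * I)) (hy : conj x = y) :
    Ord (𝓝 (0 : ℝ × ℝ)) (fun p => ‖p‖) 6
      (fun p => G.momentum (nf.X p) (nf.X (twistMap θ τ₁ τ₂ p)) - nf.Y p) := by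
  have hr := ord_norm_zero (E := ℝ × ℝ)
  have h0 := oddJet_oddPoly nf.ξ nf.b nf.c nf.d nf.e nf.f
  have h1 := oddJet_oddPoly_twistMap nf.ξ nf.b nf.c nf.d nf.e nf.f (θ := θ) (τ₁ := τ₁) (τ₂ := τ₂) hx
  have h2 := oddJet_oddPoly nf.ξ' nf.b' nf.c' nf.d' nf.e' nf.f'
  have hX := h0.add h0.conj
  have hX₁ := h1.add h1.conj
  have hY := (h2.add h2.conj.neg).const_mul I
  have hall := ((((hX.const_mul (G.α : ℂ)).add (hX₁.const_mul (G.β : ℂ))).add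
    (hX.cubicPart hr hX₁ (G.p : ℂ) G.q G.m)).add
    (hX.quinticPart hr hX₁ (G.e₀ : ℂ) G.e₁ G.e₂ G.e₃)).add hY
  have hyx : conj y = x := by rw [← hy, Complex.conj_conj]
  have cq₁₀ := congrArg conj nf.eq₁₀
  have cq₃₀ := congrArg conj nf.eq₃₀
  have cq₂₁ := congrArg conj nf.eq₂₁
  have cq₅₀ := congrArg conj nf.eq₅₀
  have cq₄₁ := congrArg conj nf.eq₄₁
  have cq₃₂ := congrArg conj nf.eq₃₂
  simp only [cubic₃₀, cubic₂₁, quintic₅₀, quintic₄₁, quintic₃₂, hess₂₀, hess₁₁, mixed₂₀, mixed₁₁,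
    map_add, map_sub, map_mul, map_pow, map_neg, map_div₀, map_ofNat, Complex.conj_ofReal,
    Complex.conj_I, hy, hyx] at cq₁₀ cq₃₀ cq₂₁ cq₅₀ cq₄₁ cq₃₂
  have key := hall.cast (g₁ := fun _ => 0) (g₃ := fun _ => 0) (g₅ := fun _ => 0)
    (fun p => by
      simp only [map_mul, Complex.conj_ofReal, hy, conj_zc]
      linear_combination nf.eq₁₀ * zc p + cq₁₀ * wc p)
    (fun p => by
      simp only [cubicPart, map_add, map_mul, map_pow, Complex.conj_ofReal, Complex.conj_I, hy,
        conj_zc, conj_wc]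
      have h3 := nf.eq₃₀
      have h4 := nf.eq₂₁
      simp only [cubic₃₀, cubic₂₁] at h3 h4
      linear_combination h3 * zc p ^ 3 + h4 * (zc p ^ 2 * wc p) + cq₃₀ * wc p ^ 3
        + cq₂₁ * (wc p ^ 2 * zc p))
    (fun p => by
      have h3 := nf.eq₅₀
      have h4 := nf.eq₄₁
      have h5 := nf.eq₃₂
      simp only [quintic₅₀, quintic₄₁, quintic₃₂, hess₂₀, hess₁₁, mixed₂₀, mixed₁₁] at h3 h4 h5
      simp only [cubicPartDeriv, quinticPart, map_add, map_sub, map_mul, map_pow, map_div₀,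
        map_ofNat, Complex.conj_ofReal, Complex.conj_I, hy, conj_zc, conj_wc]
      linear_combination h3 * zc p ^ 5 + h4 * (zc p ^ 4 * wc p) + h5 * (zc p ^ 3 * wc p ^ 2)
        + cq₅₀ * wc p ^ 5 + cq₄₁ * (wc p ^ 4 * zc p) + cq₃₂ * (wc p ^ 3 * zc p ^ 2))
  have h3 : Ord (𝓝 (0 : ℝ × ℝ)) (fun p => ‖p‖) 6 (fun p =>
      ((G.momentum (nf.X p) (nf.X (twistMap θ τ₁ τ₂ p)) - nf.Y p : ℝ) : ℂ)) := by
    refine key.rem.of_eq fun p => ?_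
    push_cast [GenCoeffs.momentum, ofReal_X, ofReal_Y, cubicPart, quinticPart]
    ring
  exact h3.of_ofReal

end NormalForm

end Billiard

namespace Billiard

/-! ### Reversibility -/

section Reflection

open Complex (I)

theorem zc_injective : Function.Injective zc := fun p q h => by
  have h1 := congrArg Complex.re h
  have h2 := congrArg Complex.im h
  simp only [zc, Complex.add_re, Complex.ofReal_re, Complex.mul_re, Complex.I_re, mul_zero,
    Complex.ofReal_im, Complex.I_im, mul_one, add_zero, Complex.add_im, Complex.mul_im,
    zero_add, sub_self] at h1 h2
  exact Prod.ext h1 h2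

theorem zc_reflect (p : ℝ × ℝ) : zc (p.1, -p.2) = wc p := by simp [zc, wc, sub_eq_add_neg]

theorem wc_reflect (p : ℝ × ℝ) : wc (p.1, -p.2) = zc p := by simp [zc, wc]

theorem oddPoly_reflect (a b c d e f : ℝ) (p : ℝ × ℝ) :
    oddPoly a b c d e f (p.1, -p.2) = conj (oddPoly a b c d e f p) := by
  simp [oddPoly, zc_reflect, wc_reflect, conj_zc, conj_wc]

/-- A twist map is conjugate to its inverse by a reflection. -/
theorem twistMap_reflect (θ τ₁ τ₂ : ℝ) (p : ℝ × ℝ) :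
    twistMap θ τ₁ τ₂ ((twistMap θ τ₁ τ₂ p).1, -(twistMap θ τ₁ τ₂ p).2) = (p.1, -p.2) := by
  refine zc_injective ?_
  have hi := (mul_comm _ _).trans (zc_mul_wc_twistMap θ τ₁ τ₂ p)
  have hn : ‖Complex.exp (θ * I) *
      Complex.exp ((τ₁ * (zc p * wc p) + τ₂ * (zc p * wc p) ^ 2) * I)‖ = 1 := by
    rw [norm_mul, norm_exp_mul_I _ (by simp), norm_exp_mul_I, one_mul]
    simp [conj_zc, conj_wc, mul_comm]
  rw [zc_twistMap, zc_reflect, wc_reflect, hi, zc_reflect, ← conj_zc, zc_twistMap, map_mul,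
    mul_assoc, Complex.conj_mul', hn, conj_zc]
  simp

variable {G : GenCoeffs} {x y : ℂ} {θ τ₁ τ₂ : ℝ} (nf : NormalForm G x y τ₁ τ₂)

theorem NormalForm.X_reflect (p : ℝ × ℝ) : nf.X (p.1, -p.2) = nf.X p := by
  simp [X, oddPoly_reflect]

theorem NormalForm.Y_reflect (p : ℝ × ℝ) : nf.Y (p.1, -p.2) = -nf.Y p := by
  simp [Y, oddPoly_reflect]

theorem Ord.reflect {n : ℕ} {f : ℝ × ℝ → ℝ} (h : Ord (𝓝 (0 : ℝ × ℝ)) (fun p => ‖p‖) n f) :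
    Ord (𝓝 (0 : ℝ × ℝ)) (fun p => ‖p‖) n (fun p => f (p.1, -p.2)) := by
  have ht : Tendsto (fun p : ℝ × ℝ => (p.1, -p.2)) (𝓝 0) (𝓝 0) := by
    have : Continuous fun p : ℝ × ℝ => (p.1, -p.2) := by fun_prop
    exact this.tendsto' 0 0 (by simp)
  exact (h.comp ht).of_eq (fun _ => rfl) |>.gauge (r' := fun p : ℝ × ℝ => ‖p‖)
    (IsBigO.of_bound 1 (.of_forall fun p => by simp [Prod.norm_def]))

/-- The second equation of the normal form. It follows from the first one, since the map that is
generated by `G` is reversible. -/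
theorem NormalForm.momentum_eq' (hx : x = Complex.exp (θ * I)) (hy : conj x = y) :
    Ord (𝓝 (0 : ℝ × ℝ)) (fun p => ‖p‖) 6
      (fun p => G.momentum (nf.X (twistMap θ τ₁ τ₂ p)) (nf.X p) + nf.Y (twistMap θ τ₁ τ₂ p)) := by
  have h := (nf.momentum_eq hx hy).reflect
  have h2 := (h.comp (tendsto_twistMap θ τ₁ τ₂)).gauge (ord_twistMap θ τ₁ τ₂)
  refine h2.of_eq fun p => ?_
  rw [twistMap_reflect, nf.X_reflect, nf.X_reflect, nf.Y_reflect]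
  ring

end Reflection

/-! ### Poisson brackets -/

section Poisson

/-- A partial derivative of a smooth function of order `n + 1` is of order `n`. -/
theorem Ord.partials {f : ℝ × ℝ → ℝ} {n : ℕ} (hf : ContDiffAt ℝ ∞ f 0)
    (h : Ord (𝓝 (0 : ℝ × ℝ)) (fun p => ‖p‖) (n + 1) f) :
    Ord (𝓝 (0 : ℝ × ℝ)) (fun p => ‖p‖) n (partial₁ f) ∧
      Ord (𝓝 (0 : ℝ × ℝ)) (fun p => ‖p‖) n (partial₂ f) := by
  have h0 (i j : ℕ) (hij : i + j < n + 1) : taylorCoeff f i j = 0 :=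
    taylorCoeff_eq_of_ord hf (c := fun _ _ => 0) (h.of_eq fun p => by simp [planePoly]) hij
  constructor
  · refine (taylor_plane n (contDiffAt_partial₁ hf)).of_eq fun p => ?_
    rw [planePoly, Finset.sum_eq_zero, sub_zero]
    refine fun k hk => Finset.sum_eq_zero fun ij hij => ?_
    rw [taylorCoeff_partial₁ hf, h0, mul_zero, zero_mul]
    have := Finset.HasAntidiagonal.mem_antidiagonal.1 hij
    have := Finset.mem_range.1 hk
    omega
  · refine (taylor_plane n (contDiffAt_partial₂ hf)).of_eq fun p => ?_
    rw [planePoly, Finset.sum_eq_zero, sub_zero]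
    refine fun k hk => Finset.sum_eq_zero fun ij hij => ?_
    rw [taylorCoeff_partial₂ hf, h0, mul_zero, zero_mul]
    have := Finset.HasAntidiagonal.mem_antidiagonal.1 hij
    have := Finset.mem_range.1 hk
    omega

/-- The Poisson bracket of two functions on the plane, which is the Jacobian determinant of the map
that has them as its components. -/
noncomputable def bracket (f g : ℝ × ℝ → ℝ) (p : ℝ × ℝ) : ℝ :=
  partial₁ f p * partial₂ g p - partial₂ f p * partial₁ g p

variable {f g : ℝ × ℝ → ℝ} {p : ℝ × ℝ}

theorem bracket_eq_det (hf : DifferentiableAt ℝ f p) (hg : DifferentiableAt ℝ g p) :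
    bracket f g p = (fderiv ℝ (fun q => (f q, g q)) p).det := by
  rw [det_prod, hf.fderiv_prodMk hg]
  simp only [bracket, partial₁, partial₂, ContinuousLinearMap.prod_apply]

theorem bracket_add {g' : ℝ × ℝ → ℝ} (h : DifferentiableAt ℝ g p)
    (h' : DifferentiableAt ℝ g' p) :
    bracket f (fun q => g q + g' q) p = bracket f g p + bracket f g' p := by
  simp only [bracket, partial₁, partial₂, fderiv_fun_add h h', add_apply]
  ring

theorem ord_zero_of_contDiffAt {f : ℝ × ℝ → ℝ} (hf : ContDiffAt ℝ ∞ f 0) :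
    Ord (𝓝 (0 : ℝ × ℝ)) (fun p => ‖p‖) 0 f := by
  simpa [Ord] using hf.continuousAt.isBigO_one ℝ

theorem Ord.bracket {n : ℕ} (hf : ContDiffAt ℝ ∞ f 0) (hg : ContDiffAt ℝ ∞ g 0)
    (h : Ord (𝓝 (0 : ℝ × ℝ)) (fun p => ‖p‖) (n + 1) g) :
    Ord (𝓝 (0 : ℝ × ℝ)) (fun p => ‖p‖) n (bracket f g) := by
  obtain ⟨h1, h2⟩ := h.partials hg
  exact ((ord_zero_of_contDiffAt (contDiffAt_partial₁ hf)).mul_le ord_norm_zero h2 (by simp)).sub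
    ((ord_zero_of_contDiffAt (contDiffAt_partial₂ hf)).mul_le ord_norm_zero h1 (by simp))

/-- The mixed second derivative of the generating function `G`, a symmetric function. -/
def GenCoeffs.mixed (G : GenCoeffs) (s t : ℝ) : ℝ :=
  G.β + 3 * G.q * (s ^ 2 + t ^ 2) + 4 * G.m * (s * t) + 5 * G.e₁ * (s ^ 4 + t ^ 4)
    + 8 * G.e₂ * (s ^ 3 * t + s * t ^ 3) + 9 * G.e₃ * (s ^ 2 * t ^ 2)

theorem GenCoeffs.mixed_comm (G : GenCoeffs) (s t : ℝ) : G.mixed s t = G.mixed t s := by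
  unfold mixed; ring

theorem hasFDerivAt_momentum (G : GenCoeffs) (hf : DifferentiableAt ℝ f p)
    (hg : DifferentiableAt ℝ g p) : ∃ k : ℝ, HasFDerivAt (fun q => G.momentum (f q) (g q))
      (k • fderiv ℝ f p + G.mixed (f p) (g p) • fderiv ℝ g p) p := by
  have h1 := hf.hasFDerivAt
  have h2 := hg.hasFDerivAt
  have h := (((h1.const_mul G.α).add (h2.const_mul G.β)).add ((((h1.pow 3).const_mul (4 * G.p)).add
    (((((h1.pow 2).const_mul 3).mul h2).add (h2.pow 3)).const_mul G.q)).add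
    ((h1.const_mul (2 * G.m)).mul (h2.pow 2)))).add
    (((((h1.pow 5).const_mul (6 * G.e₀)).add
    (((((h1.pow 4).const_mul 5).mul h2).add (h2.pow 5)).const_mul G.e₁)).add
    (((((h1.pow 3).const_mul 4).mul (h2.pow 2)).add ((h1.const_mul 2).mul (h2.pow 4))).const_mul
      G.e₂)).add (((h1.pow 2).const_mul (3 * G.e₃)).mul (h2.pow 3)))
  refine ⟨G.α + (12 * G.p * f p ^ 2 + 6 * G.q * (f p * g p) + 2 * G.m * g p ^ 2) +
    (30 * G.e₀ * f p ^ 4 + 20 * G.e₁ * (f p ^ 3 * g p) + G.e₂ * (12 * f p ^ 2 * g p ^ 2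
      + 2 * g p ^ 4) + 6 * G.e₃ * (f p * g p ^ 3)), ?_⟩
  refine (h.congr_fderiv (ContinuousLinearMap.ext fun v => ?_)).congr_of_eventuallyEq
    (.of_forall fun q => ?_)
  · simp [GenCoeffs.mixed]
    ring
  · simp [GenCoeffs.momentum, cubicPart, quinticPart]

/-- The bracket `{f, ∂₁H (f, g)} = ∂₁∂₂H (f, g) {f, g}` for the generating function `H`. -/
theorem bracket_momentum (G : GenCoeffs) (hf : DifferentiableAt ℝ f p)
    (hg : DifferentiableAt ℝ g p) :
    bracket f (fun q => G.momentum (f q) (g q)) p = G.mixed (f p) (g p) * bracket f g p := by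
  obtain ⟨k, hk⟩ := hasFDerivAt_momentum G hf hg
  simp only [bracket, partial₁, partial₂, hk.fderiv]
  simp
  ring

theorem bracket_comm (f g : ℝ × ℝ → ℝ) (p : ℝ × ℝ) : bracket g f p = -bracket f g p := by
  unfold bracket; ring

end Poisson

end Billiard

namespace Billiard

/-! ### The Jacobian determinant of the normal form -/

section Jacobian

open Complex (I)

/-- The complex coordinate as a real-linear map. -/
noncomputable def zcL : ℝ × ℝ →L[ℝ] ℂ :=
  Complex.ofRealCLM.comp (ContinuousLinearMap.fst ℝ ℝ ℝ)
    + I • Complex.ofRealCLM.comp (ContinuousLinearMap.snd ℝ ℝ ℝ)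

/-- The conjugate coordinate as a real-linear map. -/
noncomputable def wcL : ℝ × ℝ →L[ℝ] ℂ :=
  Complex.ofRealCLM.comp (ContinuousLinearMap.fst ℝ ℝ ℝ)
    - I • Complex.ofRealCLM.comp (ContinuousLinearMap.snd ℝ ℝ ℝ)

theorem zcL_apply (p : ℝ × ℝ) : zcL p = zc p := by simp [zcL, zc, mul_comm]

theorem wcL_apply (p : ℝ × ℝ) : wcL p = wc p := by simp [wcL, wc, mul_comm]

theorem hasFDerivAt_zc (p : ℝ × ℝ) : HasFDerivAt zc zcL p := by
  simpa only [← funext zcL_apply] using zcL.hasFDerivAt (x := p)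

theorem hasFDerivAt_wc (p : ℝ × ℝ) : HasFDerivAt wc wcL p := by
  simpa only [← funext wcL_apply] using wcL.hasFDerivAt (x := p)

@[fun_prop]
theorem contDiff_zc {n : WithTop ℕ∞} : ContDiff ℝ n zc := by
  simpa only [← funext zcL_apply] using zcL.contDiff

@[fun_prop]
theorem contDiff_wc {n : WithTop ℕ∞} : ContDiff ℝ n wc := by
  simpa only [← funext wcL_apply] using wcL.contDiff

/-- The derivative of `oddPoly` with respect to `z`. -/
noncomputable def oddPolyZ (a b c d e f : ℝ) (p : ℝ × ℝ) : ℂ :=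
  a + (3 * b * zc p ^ 2 + 2 * c * (zc p * wc p))
    + (5 * d * zc p ^ 4 + 4 * e * (zc p ^ 3 * wc p) + 3 * f * (zc p ^ 2 * wc p ^ 2))

/-- The derivative of `oddPoly` with respect to `w`. -/
noncomputable def oddPolyW (c e f : ℝ) (p : ℝ × ℝ) : ℂ :=
  c * zc p ^ 2 + (e * zc p ^ 4 + 2 * f * (zc p ^ 3 * wc p))

theorem hasFDerivAt_oddPoly (a b c d e f : ℝ) (p : ℝ × ℝ) :
    HasFDerivAt (oddPoly a b c d e f) (oddPolyZ a b c d e f p • zcL + oddPolyW c e f p • wcL) p := by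
  have hz := hasFDerivAt_zc p
  have hw := hasFDerivAt_wc p
  have h := (((((hz.const_mul (a : ℂ)).add ((hz.pow 3).const_mul (b : ℂ))).add
    (((hz.pow 2).mul hw).const_mul (c : ℂ))).add ((hz.pow 5).const_mul (d : ℂ))).add
    (((hz.pow 4).mul hw).const_mul (e : ℂ))).add
    (((hz.pow 3).mul (hw.pow 2)).const_mul (f : ℂ))
  refine (h.congr_fderiv (ContinuousLinearMap.ext fun v => ?_)).congr_of_eventuallyEq
    (.of_forall fun q => ?_)
  · simp [oddPolyZ, oddPolyW, zcL_apply, wcL_apply]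
    ring
  · simp [oddPoly]

@[fun_prop]
theorem contDiff_oddPoly {n : WithTop ℕ∞} (a b c d e f : ℝ) :
    ContDiff ℝ n (oddPoly a b c d e f) := by
  unfold oddPoly; fun_prop

theorem evenJet_oddPolyZ (a b c d e f : ℝ) :
    EvenJet (𝓝 (0 : ℝ × ℝ)) (fun p => ‖p‖) (oddPolyZ a b c d e f) (fun _ => (a : ℂ))
      (fun p => 3 * b * zc p ^ 2 + 2 * c * (zc p * wc p))
      (fun p => 5 * d * zc p ^ 4 + 4 * e * (zc p ^ 3 * wc p) + 3 * f * (zc p ^ 2 * wc p ^ 2)) := by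
  refine ⟨.const _, Ord.of_homogeneous (by fun_prop) fun τ v => ?_,
    Ord.of_homogeneous (by fun_prop) fun τ v => ?_, Ord.zero.of_eq fun p => ?_⟩
  iterate 2 simp only [zc_smul, wc_smul]; ring
  simp only [oddPolyZ]; ring

theorem evenJet_oddPolyW (c e f : ℝ) :
    EvenJet (𝓝 (0 : ℝ × ℝ)) (fun p => ‖p‖) (oddPolyW c e f) (fun _ => 0)
      (fun p => c * zc p ^ 2) (fun p => e * zc p ^ 4 + 2 * f * (zc p ^ 3 * wc p)) := by
  refine ⟨.zero, Ord.of_homogeneous (by fun_prop) fun τ v => ?_,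
    Ord.of_homogeneous (by fun_prop) fun τ v => ?_, Ord.zero.of_eq fun p => ?_⟩
  iterate 2 simp only [zc_smul, wc_smul]; ring
  simp only [oddPolyW]; ring

theorem EvenJet.conj {α : Type*} {l : Filter α} {r : α → ℝ} {f f₀ f₂ f₄ : α → ℂ}
    (hf : EvenJet l r f f₀ f₂ f₄) : EvenJet l r (fun x => conj (f x)) (fun x => conj (f₀ x))
      (fun x => conj (f₂ x)) (fun x => conj (f₄ x)) :=
  ⟨hf.o0.conj, hf.o2.conj, hf.o4.conj, hf.rem.conj.of_eq fun x => by simp⟩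

variable {G : GenCoeffs} {x y : ℂ} {θ τ₁ τ₂ : ℝ} (nf : NormalForm G x y τ₁ τ₂)

@[fun_prop]
theorem NormalForm.contDiff_X {n : WithTop ℕ∞} : ContDiff ℝ n nf.X :=
  contDiff_const.mul (Complex.reCLM.contDiff.comp (contDiff_oddPoly ..))

@[fun_prop]
theorem NormalForm.contDiff_Y {n : WithTop ℕ∞} : ContDiff ℝ n nf.Y :=
  contDiff_const.mul (Complex.imCLM.contDiff.comp (contDiff_oddPoly ..))

/-- The Jacobian determinant of a normal form in complex coordinates. -/
theorem NormalForm.bracket_eq (p : ℝ × ℝ) :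
    let Pz := oddPolyZ nf.ξ nf.b nf.c nf.d nf.e nf.f p
    let Pw := oddPolyW nf.c nf.e nf.f p
    let Qz := oddPolyZ nf.ξ' nf.b' nf.c' nf.d' nf.e' nf.f' p
    let Qw := oddPolyW nf.c' nf.e' nf.f' p
    let K := Pz * conj Qz - Pw * conj Qw - Pz * Qw + Pw * Qz
    (bracket nf.X nf.Y p : ℂ) = 2 * (K + conj K) := by
  intro Pz Pw Qz Qw K
  have hX : HasFDerivAt nf.X ((2 : ℝ) • Complex.reCLM.comp (Pz • zcL + Pw • wcL)) p :=
    ((Complex.reCLM.hasFDerivAt.comp p (hasFDerivAt_oddPoly ..)).const_mul 2)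
  have hY : HasFDerivAt nf.Y ((2 : ℝ) • Complex.imCLM.comp (Qz • zcL + Qw • wcL)) p :=
    ((Complex.imCLM.hasFDerivAt.comp p (hasFDerivAt_oddPoly ..)).const_mul 2)
  have : bracket nf.X nf.Y p = 4 * K.re := by
    rw [bracket, partial₁, partial₂, partial₁, partial₂, hX.fderiv, hY.fderiv]
    simp [zcL_apply, wcL_apply, zc, wc, K]
    ring
  rw [Complex.add_conj, this]
  push_cast
  ring

/-- The expansion of the Jacobian determinant. -/
theorem NormalForm.bracket_expansion : ∃ j₂₀ j₄₀ j₃₁ : ℂ,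
    EvenJet (𝓝 (0 : ℝ × ℝ)) (fun p => ‖p‖) (fun p => (bracket nf.X nf.Y p : ℂ)) (fun _ => 1)
      (fun p => j₂₀ * (zc p ^ 2 + wc p ^ 2))
      (fun p => j₄₀ * (zc p ^ 4 + wc p ^ 4) + j₃₁ * (zc p ^ 3 * wc p + zc p * wc p ^ 3)) := by
  have hr := ord_norm_zero (E := ℝ × ℝ)
  have Pz := evenJet_oddPolyZ nf.ξ nf.b nf.c nf.d nf.e nf.f
  have Pw := evenJet_oddPolyW nf.c nf.e nf.f
  have Qz := evenJet_oddPolyZ nf.ξ' nf.b' nf.c' nf.d' nf.e' nf.f'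
  have Qw := evenJet_oddPolyW nf.c' nf.e' nf.f'
  have K := (((Pz.mul hr Qz.conj).sub (Pw.mul hr Qw.conj)).sub (Pz.mul hr Qw)).add (Pw.mul hr Qz)
  have J := (K.add K.conj).const_mul 2
  have d₀₀ : (4 * (nf.ξ * nf.ξ') : ℂ) = 1 := by exact_mod_cast nf.det₀₀
  have d₁₁ : (nf.ξ * nf.c' + nf.c * nf.ξ' : ℂ) = 0 := by exact_mod_cast nf.det₁₁
  have d₂₂ : (nf.ξ * nf.f' + nf.f * nf.ξ' + 3 * (nf.b * nf.b') + nf.c * nf.c' : ℂ) = 0 := by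
    exact_mod_cast nf.det₂₂
  refine ⟨2 * (3 * nf.ξ * nf.b' + 3 * nf.ξ' * nf.b - nf.ξ * nf.c' + nf.ξ' * nf.c),
    2 * (5 * nf.ξ' * nf.d - nf.ξ * nf.e' - 3 * nf.b * nf.c' + 3 * nf.b' * nf.c + nf.ξ' * nf.e
      + 5 * nf.ξ * nf.d'),
    2 * (6 * nf.b * nf.c' + 4 * nf.ξ' * nf.e - 2 * nf.ξ * nf.f' + 2 * nf.ξ' * nf.f
      + 4 * nf.ξ * nf.e' + 6 * nf.b' * nf.c),
    (J.congr (.of_forall fun p => (nf.bracket_eq p).symm)).cast (fun p => ?_) (fun p => ?_)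
      fun p => ?_⟩ <;>
  simp only [map_add, map_sub, map_mul, map_pow, map_zero, map_ofNat, Complex.conj_ofReal, conj_zc,
    conj_wc]
  · linear_combination d₀₀
  · linear_combination 8 * (zc p * wc p) * d₁₁
  · linear_combination 12 * (zc p ^ 2 * wc p ^ 2) * d₂₂

theorem contDiff_twistMap {n : WithTop ℕ∞} (θ τ₁ τ₂ : ℝ) : ContDiff ℝ n (twistMap θ τ₁ τ₂) := by
  unfold twistMap; fun_prop

theorem det_twistMap (θ τ₁ τ₂ : ℝ) (p : ℝ × ℝ) : (fderiv ℝ (twistMap θ τ₁ τ₂) p).det = 1 := by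
  have h1 : HasFDerivAt (fun p : ℝ × ℝ => p.1) (ContinuousLinearMap.fst ℝ ℝ ℝ) p := hasFDerivAt_fst
  have h2 : HasFDerivAt (fun p : ℝ × ℝ => p.2) (ContinuousLinearMap.snd ℝ ℝ ℝ) p := hasFDerivAt_snd
  have hq := (h1.pow 2).add (h2.pow 2)
  have hΘ := ((hq.const_mul τ₁).const_add θ).add ((hq.pow 2).const_mul τ₂)
  have hT := ((h1.mul hΘ.cos).sub (h2.mul hΘ.sin)).prodMk ((h1.mul hΘ.sin).add (h2.mul hΘ.cos))
  have hT' : HasFDerivAt (twistMap θ τ₁ τ₂) _ p := hT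
  rw [hT'.fderiv, det_prod]
  have hcs := Real.sin_sq_add_cos_sq (θ + τ₁ * (p.1 ^ 2 + p.2 ^ 2) + τ₂ * (p.1 ^ 2 + p.2 ^ 2) ^ 2)
  simp
  set c := Real.cos (θ + τ₁ * (p.1 ^ 2 + p.2 ^ 2) + τ₂ * (p.1 ^ 2 + p.2 ^ 2) ^ 2)
  set s := Real.sin (θ + τ₁ * (p.1 ^ 2 + p.2 ^ 2) + τ₂ * (p.1 ^ 2 + p.2 ^ 2) ^ 2)
  linear_combination hcs

end Jacobian

end Billiard

namespace Billiard

section Invariance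

open Complex (I)

theorem bracket_comp_twistMap {f g : ℝ × ℝ → ℝ} (hf : ContDiff ℝ ∞ f) (hg : ContDiff ℝ ∞ g)
    (θ τ₁ τ₂ : ℝ) (p : ℝ × ℝ) :
    bracket (fun p => f (twistMap θ τ₁ τ₂ p)) (fun p => g (twistMap θ τ₁ τ₂ p)) p =
      bracket f g (twistMap θ τ₁ τ₂ p) := by
  have hT := (contDiff_twistMap (n := ∞) θ τ₁ τ₂).differentiable (by simp)
  have hf' := hf.differentiable (by simp)
  have hg' := hg.differentiable (by simp)
  rw [bracket_eq_det (hf' _) (hg' _), bracket_eq_det (f := fun p => f (twistMap θ τ₁ τ₂ p))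
    (g := fun p => g (twistMap θ τ₁ τ₂ p)) ((hf' _).comp p (hT p)) ((hg' _).comp p (hT p))]
  have : fderiv ℝ (fun q => (f (twistMap θ τ₁ τ₂ q), g (twistMap θ τ₁ τ₂ q))) p =
      (fderiv ℝ (fun q => (f q, g q)) (twistMap θ τ₁ τ₂ p)).comp (fderiv ℝ (twistMap θ τ₁ τ₂) p) :=
    fderiv_comp (g := fun q => (f q, g q)) p ((hf' _).prodMk (hg' _)) (hT p)
  rw [this, det_comp, det_twistMap, mul_one]

theorem contDiff_momentum (G : GenCoeffs) {n : WithTop ℕ∞} {f g : ℝ × ℝ → ℝ}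
    (hf : ContDiff ℝ n f) (hg : ContDiff ℝ n g) :
    ContDiff ℝ n (fun p => G.momentum (f p) (g p)) := by
  unfold GenCoeffs.momentum cubicPart quinticPart; fun_prop

variable {G : GenCoeffs} {x y : ℂ} {θ τ₁ τ₂ : ℝ} (nf : NormalForm G x y τ₁ τ₂)

/-- The Jacobian determinant of a normal form is invariant under the twist map to order four, since
the map generated by `G` preserves the area. -/
theorem NormalForm.bracket_invariant (hx : x = Complex.exp (θ * I)) (hy : conj x = y) :
    Ord (𝓝 (0 : ℝ × ℝ)) (fun p => ‖p‖) 5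
      (fun p => bracket nf.X nf.Y (twistMap θ τ₁ τ₂ p) - bracket nf.X nf.Y p) := by
  set T := twistMap θ τ₁ τ₂ with hT
  have hTc : ContDiff ℝ ∞ T := contDiff_twistMap ..
  have hX : ContDiff ℝ ∞ nf.X := nf.contDiff_X
  have hY : ContDiff ℝ ∞ nf.Y := nf.contDiff_Y
  have hXT : ContDiff ℝ ∞ (fun p => nf.X (T p)) := hX.comp hTc
  have hYT : ContDiff ℝ ∞ (fun p => nf.Y (T p)) := hY.comp hTc
  have hU := contDiff_momentum G hX hXT
  have hV := contDiff_momentum G hXT hX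
  -- With the generating function `H`, both `{X, Y}` and `{X, Y} ∘ T` are `∂₁∂₂H {X, X ∘ T}` up to
  -- order four.
  have e1 := Ord.bracket hX.contDiffAt (hU.sub hY).contDiffAt (nf.momentum_eq hx hy)
  have e2 := Ord.bracket hXT.contDiffAt (hV.add hYT).contDiffAt (nf.momentum_eq' hx hy)
  refine (e2.add e1).of_eq fun p => ?_
  have d (f : ℝ × ℝ → ℝ) (hf : ContDiff ℝ ∞ f) : DifferentiableAt ℝ f p :=
    hf.differentiable (by simp) p
  have h1 := bracket_add (f := nf.X) (d _ (hU.sub hY)) (d _ hY)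
  have h2 := bracket_add (f := fun p => nf.X (T p)) (d _ hV) (d _ hYT)
  have h3 := bracket_momentum G (d _ hX) (d _ hXT)
  have h4 := bracket_momentum G (d _ hXT) (d _ hX)
  have h5 := bracket_comp_twistMap hX hY θ τ₁ τ₂ p
  rw [bracket_comm nf.X, G.mixed_comm] at h4
  simp only [sub_add_cancel] at h1
  rw [← h5, ← hT]
  rw [h4] at h2
  rw [h3] at h1
  change bracket _ (fun q => G.momentum (nf.X (T q)) (nf.X q) + nf.Y (T q)) p
    + bracket nf.X (fun q => G.momentum (nf.X q) (nf.X (T q)) - nf.Y q) p = _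
  rw [h2]
  have h1' : bracket nf.X (fun q => G.momentum (nf.X q) (nf.X (T q)) - nf.Y q) p
      = G.mixed (nf.X p) (nf.X (T p)) * bracket nf.X (fun q => nf.X (T q)) p
        - bracket nf.X nf.Y p := by rw [h1]; exact (add_sub_cancel_right _ _).symm
  rw [h1']
  ring

theorem quartic_coeff_zero {a b c d : ℂ} (h : ∀ p, a * zc p ^ 4 + b * (zc p ^ 3 * wc p)
    + c * (zc p * wc p ^ 3) + d * wc p ^ 4 = 0) : a = 0 ∧ b = 0 := by
  have h1 := h (1, 0)
  have h2 := h (0, 1)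
  have h3 := h (1, 1)
  have h4 := h (2, 1)
  simp only [zc, wc, Complex.ofReal_one, Complex.ofReal_zero, zero_mul, add_zero, sub_zero,
    mul_one, one_mul, zero_add, zero_sub, Complex.ofReal_ofNat, one_pow] at h1 h2 h3 h4
  have hI := Complex.I_sq
  have e2 : a - b - c + d = 0 := by
    linear_combination h2 - (a - b - c + d) * (I ^ 2 - 1) * hI
  have ead : a + d = 0 := by linear_combination (h1 + e2) / 2
  have ebc : b + c = 0 := by linear_combination (h1 - e2) / 2
  have hd : d = -a := by linear_combination ead
  have hc : c = -b := by linear_combination ebc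
  subst hd hc
  have hI3 : I ^ 3 = -I := by rw [pow_succ, hI]; ring
  have hI4 : I ^ 4 = 1 := by rw [show I ^ 4 = (I ^ 2) ^ 2 by ring, hI]; ring
  have hb : b = 0 := by
    have : 8 * I * b = 0 := by
      ring_nf at h3
      rw [hI3] at h3
      linear_combination h3
    simpa using this
  subst hb
  have ha : a = 0 := by
    have : 48 * I * a = 0 := by
      ring_nf at h4
      rw [hI3] at h4
      linear_combination h4
    simpa using this
  exact ⟨ha, rfl⟩

/-- A normal form is symplectic to order four. -/
theorem NormalForm.bracket_eq_one (hx : x = Complex.exp (θ * I)) (hy : conj x = y)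
    (h4 : x ^ 4 ≠ 1) :
    Ord (𝓝 (0 : ℝ × ℝ)) (fun p => ‖p‖) 5 (fun p => bracket nf.X nf.Y p - 1) := by
  have hr := ord_norm_zero (E := ℝ × ℝ)
  obtain ⟨j, k, l, hJ⟩ := nf.bracket_expansion
  have hinv := (nf.bracket_invariant hx hy).ofReal
  obtain ⟨t3, -⟩ := zc_twistMap_expansion θ τ₁ τ₂ (k := id) ord_zc
  have t3c := t3.conj
  simp only [id, map_sub, map_mul, conj_zc] at t3 t3c
  rw [← hx] at t3 t3c
  rw [hy] at t3c
  have t1 := Ord.comp_twistMap θ τ₁ τ₂ ord_zc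
  have t1c := Ord.comp_twistMap θ τ₁ τ₂ ord_wc
  have hz := ord_zc
  have hw := ord_wc
  have h2 : x ^ 2 - 1 ≠ 0 := fun h => h4 (by linear_combination (x ^ 2 + 1) * h)
  -- the squares of `z` and `w` along the twist map
  have s2 : Ord (𝓝 (0 : ℝ × ℝ)) (fun p => ‖p‖) 4
      (fun p => zc (twistMap θ τ₁ τ₂ p) ^ 2 - x ^ 2 * zc p ^ 2) :=
    (t3.mul_le hr (t1.add (hz.const_mul x)) (k := 4) (by norm_num)).of_eq fun p => by ring
  have s2c : Ord (𝓝 (0 : ℝ × ℝ)) (fun p => ‖p‖) 4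
      (fun p => wc (twistMap θ τ₁ τ₂ p) ^ 2 - y ^ 2 * wc p ^ 2) :=
    (t3c.mul_le hr (t1c.add (hw.const_mul y)) (k := 4) (by norm_num)).of_eq fun p => by ring
  have hJT := hJ.rem.comp_twistMap θ τ₁ τ₂
  -- an invariant function has no terms `z²`, `z⁴` and `z³ w`, since `x ^ 2 ≠ 1` and `x ^ 4 ≠ 1`
  have hj : j = 0 := by
    have o4 := (hJ.o4.sub (hJ.o4.comp_twistMap θ τ₁ τ₂)).mono hr (by norm_num : 3 ≤ 4)
    have h := (quadratic_zero_of_ord (a := j * (x ^ 2 - 1)) (b := 0) (c := j * (y ^ 2 - 1))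
      (((((hinv.mono hr (by norm_num : 3 ≤ 5)).sub ((hJT.sub hJ.rem).mono hr
        (by norm_num : 3 ≤ 6))).add o4).sub
        (((s2.add s2c).const_mul j).mono hr (by norm_num : 3 ≤ 4))).of_eq fun p => by
          push_cast; ring)).1
    exact (mul_eq_zero.1 h).resolve_right h2
  subst hj
  have hkl : k = 0 ∧ l = 0 := by
    have hi (p : ℝ × ℝ) := zc_mul_wc_twistMap θ τ₁ τ₂ p
    have f1 := s2.mul_le hr ((t1.pow 2).add ((hz.pow 2).const_mul (x ^ 2))) (k := 5) (by norm_num)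
    have f2 := s2c.mul_le hr ((t1c.pow 2).add ((hw.pow 2).const_mul (y ^ 2))) (k := 5) (by norm_num)
    have f3 := s2.mul_le hr ord_zw (k := 5) (by norm_num)
    have f4 := s2c.mul_le hr ord_zw (k := 5) (by norm_num)
    have hord : Ord (𝓝 (0 : ℝ × ℝ)) (fun p => ‖p‖) 5 (fun p => k * (x ^ 4 - 1) * zc p ^ 4
        + l * (x ^ 2 - 1) * (zc p ^ 3 * wc p) + l * (y ^ 2 - 1) * (zc p * wc p ^ 3)
        + k * (y ^ 4 - 1) * wc p ^ 4) := by
      refine ((hinv.sub ((hJT.sub hJ.rem).mono hr (by norm_num : 5 ≤ 6))).sub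
        (((f1.add f2).const_mul k).add ((f3.add f4).const_mul l))).of_eq fun p => ?_
      push_cast
      linear_combination (l * (zc (twistMap θ τ₁ τ₂ p) ^ 2 + wc (twistMap θ τ₁ τ₂ p) ^ 2)) * hi p
    have := quartic_coeff_zero (eq_zero_of_homogeneous (n := 4)
      (fun τ v => by simp only [zc_smul, wc_smul]; ring) hord)
    exact ⟨(mul_eq_zero.1 this.1).resolve_right (sub_ne_zero.2 h4),
      (mul_eq_zero.1 this.2).resolve_right h2⟩
  obtain ⟨rfl, rfl⟩ := hkl
  refine Ord.of_ofReal ((hJ.rem.mono hr (by norm_num : 5 ≤ 6)).of_eq fun p => ?_)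
  push_cast
  ring

end Invariance

end Billiard

namespace Billiard

/-! ### Primitives of the Jacobian determinant -/

section Primitive

/-- The functions `f` on the plane such that all products `yʲ f` have a smooth primitive with
respect to `y` that vanishes on the `x`-axis. -/
def HasPrimitives (f : ℝ × ℝ → ℂ) : Prop := ∀ j : ℕ, ∃ K : ℝ × ℝ → ℂ, ContDiff ℝ ∞ K ∧
  (∀ x, K (x, 0) = 0) ∧ ∀ x y : ℝ, HasDerivAt (fun y => K (x, y)) ((y : ℂ) ^ j * f (x, y)) y

namespace HasPrimitives

variable {f g : ℝ × ℝ → ℂ}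

theorem one : HasPrimitives (fun _ => 1) := by
  intro j
  refine ⟨fun p => (p.2 : ℂ) ^ (j + 1) / (j + 1), ?_, fun x => by simp, fun x y => ?_⟩
  · have : ContDiff ℝ ∞ (fun p : ℝ × ℝ => (p.2 : ℂ)) := Complex.ofRealCLM.contDiff.comp contDiff_snd
    exact (this.pow _).div_const _
  · have h := (((hasDerivAt_id y).ofReal_comp.pow (j + 1)).div_const ((j : ℂ) + 1))
    have hj : (j : ℂ) + 1 ≠ 0 := by exact_mod_cast j.succ_ne_zero
    refine h.congr_deriv ?_
    simp
    field_simp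

theorem add (hf : HasPrimitives f) (hg : HasPrimitives g) : HasPrimitives (fun p => f p + g p) := by
  intro j
  obtain ⟨K, h1, h2, h3⟩ := hf j
  obtain ⟨K', h1', h2', h3'⟩ := hg j
  exact ⟨fun p => K p + K' p, h1.add h1', fun x => by simp [h2, h2'],
    fun x y => ((h3 x y).add (h3' x y)).congr_deriv (by ring)⟩

theorem const_mul (hf : HasPrimitives f) (c : ℂ) : HasPrimitives (fun p => c * f p) := by
  intro j
  obtain ⟨K, h1, h2, h3⟩ := hf j
  exact ⟨fun p => c * K p, contDiff_const.mul h1, fun x => by simp [h2],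
    fun x y => ((h3 x y).const_mul c).congr_deriv (by ring)⟩

theorem fst_mul (hf : HasPrimitives f) : HasPrimitives (fun p => p.1 * f p) := by
  intro j
  obtain ⟨K, h1, h2, h3⟩ := hf j
  have : ContDiff ℝ ∞ (fun p : ℝ × ℝ => (p.1 : ℂ)) := Complex.ofRealCLM.contDiff.comp contDiff_fst
  exact ⟨fun p => p.1 * K p, this.mul h1, fun x => by simp [h2],
    fun x y => ((h3 x y).const_mul (x : ℂ)).congr_deriv (by ring)⟩

theorem snd_mul (hf : HasPrimitives f) : HasPrimitives (fun p => p.2 * f p) := by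
  intro j
  obtain ⟨K, h1, h2, h3⟩ := hf (j + 1)
  exact ⟨K, h1, h2, fun x y => (h3 x y).congr_deriv (by ring)⟩

theorem zc_mul (hf : HasPrimitives f) : HasPrimitives (fun p => zc p * f p) := by
  convert hf.fst_mul.add (hf.snd_mul.const_mul Complex.I) using 2 with p
  rw [zc]; ring

theorem wc_mul (hf : HasPrimitives f) : HasPrimitives (fun p => wc p * f p) := by
  convert hf.fst_mul.add (hf.snd_mul.const_mul (-Complex.I)) using 2 with p
  rw [wc]; ring

end HasPrimitives

/-- The algebra of multipliers of the functions with primitives. It contains the polynomials in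
`z` and `w`. -/
def primitiveAlgebra : Subalgebra ℂ (ℝ × ℝ → ℂ) where
  carrier := {m | ∀ f, HasPrimitives f → HasPrimitives (fun p => m p * f p)}
  mul_mem' := fun {m m'} h h' f hf => by simpa [mul_assoc] using h _ (h' f hf)
  add_mem' := fun {m m'} h h' f hf => by simpa [add_mul] using (h f hf).add (h' f hf)
  algebraMap_mem' := fun c f hf => hf.const_mul c

theorem zc_mem_primitiveAlgebra : zc ∈ primitiveAlgebra := fun _ hf => hf.zc_mul

theorem wc_mem_primitiveAlgebra : wc ∈ primitiveAlgebra := fun _ hf => hf.wc_mul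

theorem const_mem_primitiveAlgebra (c : ℂ) : (fun _ => c) ∈ primitiveAlgebra :=
  primitiveAlgebra.algebraMap_mem c

theorem oddPolyZ_mem_primitiveAlgebra (a b c d e f : ℝ) :
    oddPolyZ a b c d e f ∈ primitiveAlgebra ∧
      (fun p => conj (oddPolyZ a b c d e f p)) ∈ primitiveAlgebra := by
  have hz := zc_mem_primitiveAlgebra
  have hw := wc_mem_primitiveAlgebra
  have key {z w : ℝ × ℝ → ℂ} (hz : z ∈ primitiveAlgebra) (hw : w ∈ primitiveAlgebra) :
      (fun p => (a : ℂ) + (3 * b * z p ^ 2 + 2 * c * (z p * w p))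
        + (5 * d * z p ^ 4 + 4 * e * (z p ^ 3 * w p) + 3 * f * (z p ^ 2 * w p ^ 2)))
        ∈ primitiveAlgebra := by
    have c1 := const_mem_primitiveAlgebra
    exact add_mem (add_mem (c1 a) (add_mem (mul_mem (c1 (3 * b)) (pow_mem hz 2))
      (mul_mem (c1 (2 * c)) (mul_mem hz hw))))
      (add_mem (add_mem (mul_mem (c1 (5 * d)) (pow_mem hz 4))
      (mul_mem (c1 (4 * e)) (mul_mem (pow_mem hz 3) hw)))
      (mul_mem (c1 (3 * f)) (mul_mem (pow_mem hz 2) (pow_mem hw 2))))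
  refine ⟨key hz hw, ?_⟩
  convert key hw hz using 2 with p
  simp only [oddPolyZ, map_add, map_mul, map_pow, map_ofNat, Complex.conj_ofReal, conj_zc,
    conj_wc]

theorem oddPolyW_mem_primitiveAlgebra (c e f : ℝ) :
    oddPolyW c e f ∈ primitiveAlgebra ∧ (fun p => conj (oddPolyW c e f p)) ∈ primitiveAlgebra := by
  have hz := zc_mem_primitiveAlgebra
  have hw := wc_mem_primitiveAlgebra
  have key {z w : ℝ × ℝ → ℂ} (hz : z ∈ primitiveAlgebra) (hw : w ∈ primitiveAlgebra) :
      (fun p => (c : ℂ) * z p ^ 2 + (e * z p ^ 4 + 2 * f * (z p ^ 3 * w p)))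
        ∈ primitiveAlgebra := by
    have c1 := const_mem_primitiveAlgebra
    exact add_mem (mul_mem (c1 c) (pow_mem hz 2)) (add_mem (mul_mem (c1 e) (pow_mem hz 4))
      (mul_mem (c1 (2 * f)) (mul_mem (pow_mem hz 3) hw)))
  refine ⟨key hz hw, ?_⟩
  convert key hw hz using 2 with p
  simp only [oddPolyW, map_add, map_mul, map_pow, map_ofNat, Complex.conj_ofReal, conj_zc,
    conj_wc]

variable {G : GenCoeffs} {x y : ℂ} {τ₁ τ₂ : ℝ} (nf : NormalForm G x y τ₁ τ₂)

/-- A primitive of the Jacobian determinant of a normal form. -/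
theorem NormalForm.exists_primitive : ∃ K : ℝ × ℝ → ℝ, ContDiff ℝ ∞ K ∧ (∀ x, K (x, 0) = 0) ∧
    ∀ x y : ℝ, HasDerivAt (fun y => K (x, y)) (bracket nf.X nf.Y (x, y)) y := by
  have hJ : (fun p => (bracket nf.X nf.Y p : ℂ)) ∈ primitiveAlgebra := by
    obtain ⟨h1, h1'⟩ := oddPolyZ_mem_primitiveAlgebra nf.ξ nf.b nf.c nf.d nf.e nf.f
    obtain ⟨h2, h2'⟩ := oddPolyZ_mem_primitiveAlgebra nf.ξ' nf.b' nf.c' nf.d' nf.e' nf.f'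
    obtain ⟨h3, h3'⟩ := oddPolyW_mem_primitiveAlgebra nf.c nf.e nf.f
    obtain ⟨h4, h4'⟩ := oddPolyW_mem_primitiveAlgebra nf.c' nf.e' nf.f'
    have e1 := add_mem (sub_mem (sub_mem (mul_mem h1 h2') (mul_mem h3 h4')) (mul_mem h1 h4))
      (mul_mem h3 h2)
    have e2 := add_mem (sub_mem (sub_mem (mul_mem h1' h2) (mul_mem h3' h4)) (mul_mem h1' h4'))
      (mul_mem h3' h2')
    convert mul_mem (const_mem_primitiveAlgebra 2) (add_mem e1 e2) using 1
    funext p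
    rw [nf.bracket_eq]
    simp
  obtain ⟨K, h1, h2, h3⟩ := hJ _ HasPrimitives.one 0
  refine ⟨fun p => (K p).re, Complex.reCLM.contDiff.comp h1, fun x => by simp [h2], fun x y => ?_⟩
  exact (Complex.reCLM.hasFDerivAt.comp_hasDerivAt y (h3 x y)).congr_deriv (by simp)

end Primitive

end Billiard

namespace Billiard

/-! ### Existence of the twist coefficients -/

section Existence

open Complex (I)

/-- An area-preserving perturbation of a map which is area-preserving to order four: its
composition with the inverse of `(x, y) ↦ (x, ∫₀^y J)`, where `J` is the Jacobian determinant. -/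
theorem exists_symplectic_correction {H : ℝ × ℝ → ℝ × ℝ} (hH : ContDiff ℝ ∞ H) (hH0 : H 0 = 0)
    {K : ℝ × ℝ → ℝ} (hK : ContDiff ℝ ∞ K) (hK0 : ∀ x, K (x, 0) = 0)
    (hKJ : ∀ x y : ℝ, HasDerivAt (fun y => K (x, y)) (fderiv ℝ H (x, y)).det y)
    (hJ : Ord (𝓝 (0 : ℝ × ℝ)) (fun p => ‖p‖) 5 (fun p => (fderiv ℝ H p).det - 1)) :
    ∃ h, IsSymplecticGerm h ∧ (fun p => h p - H p) =O[𝓝 (0 : ℝ × ℝ)] fun p => ‖p‖ ^ 6 := by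
  let ψ : ℝ × ℝ → ℝ × ℝ := fun p => (p.1, K p)
  have hψ : ContDiff ℝ ∞ ψ := contDiff_fst.prodMk hK
  have hψ0 : ψ 0 = 0 := by simp only [ψ]; exact Prod.ext rfl (hK0 0)
  have hKd := hK.differentiable (by simp)
  have hdet (p : ℝ × ℝ) : (fderiv ℝ ψ p).det = (fderiv ℝ H p).det := by
    have h1 : fderiv ℝ K p (0, 1) = (fderiv ℝ H p).det := by
      have h2 : HasDerivAt (fun y : ℝ => (p.1, y)) (0, 1) p.2 :=
        (hasDerivAt_const _ _).prodMk (hasDerivAt_id _)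
      exact ((hKd p).hasFDerivAt.comp_hasDerivAt p.2 h2).unique (hKJ p.1 p.2)
    have h2 : fderiv ℝ ψ p = (ContinuousLinearMap.fst ℝ ℝ ℝ).prod (fderiv ℝ K p) :=
      (hasFDerivAt_fst.prodMk (hKd p).hasFDerivAt).fderiv
    rw [det_prod, h2]
    simp [h1]
  have hdet0 : (fderiv ℝ H 0).det = 1 := by
    obtain ⟨C, hC⟩ := IsBigO.bound hJ
    have := hC.self_of_nhds
    simpa [sub_eq_zero] using this
  obtain ⟨χ, hχ, hχ0, hψχ, hχψ⟩ := exists_smooth_inverse hψ.contDiffAt hψ0 (by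
    rw [hdet, hdet0]; exact one_ne_zero)
  have hχt : Tendsto χ (𝓝 0) (𝓝 0) := by simpa [hχ0] using hχ.continuousAt.tendsto
  have hψt : Tendsto ψ (𝓝 0) (𝓝 0) := by simpa [hψ0] using hψ.continuous.tendsto 0
  have hHd := hH.differentiable (by simp)
  have hψd := hψ.differentiable (by simp)
  -- the change of the second coordinate is of order six
  have hKy : (fun p : ℝ × ℝ => K p - p.2) =O[𝓝 0] fun p => ‖p‖ ^ 6 := by
    obtain ⟨C, hC⟩ := IsBigO.bound hJ
    obtain ⟨ε, hε, hball⟩ := Metric.eventually_nhds_iff.1 hC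
    refine IsBigO.of_bound |C| ?_
    filter_upwards [Metric.ball_mem_nhds 0 hε] with p hp
    rw [mem_ball_zero_iff] at hp
    have hy : ∀ y ∈ Set.uIcc 0 p.2, ‖(p.1, y)‖ ≤ ‖p‖ := by
      intro y hy
      have h1 : |y| ≤ |p.2| := by simpa using Set.abs_sub_left_of_mem_uIcc hy
      rw [Prod.norm_def, Prod.norm_def]
      exact max_le_max le_rfl h1
    have h := (convex_uIcc (0 : ℝ) p.2).norm_image_sub_le_of_norm_hasDerivWithin_le
      (f := fun y => K (p.1, y) - y) (f' := fun y => (fderiv ℝ H (p.1, y)).det - 1)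
      (C := |C| * ‖p‖ ^ 5)
      (fun y _ => ((hKJ p.1 y).sub (hasDerivAt_id y)).hasDerivWithinAt)
      (fun y hy' => by
        have h1 := hball (y := (p.1, y)) (by
          rw [dist_zero_right]; exact (hy y hy').trans_lt hp)
        rw [norm_pow, norm_norm] at h1
        exact h1.trans (mul_le_mul (le_abs_self C) (pow_le_pow_left₀ (norm_nonneg _) (hy y hy') 5)
          (by positivity) (abs_nonneg C)))
      Set.left_mem_uIcc Set.right_mem_uIcc
    simp only [hK0, sub_zero] at h
    rw [norm_pow, norm_norm]
    refine h.trans ?_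
    calc |C| * ‖p‖ ^ 5 * ‖p.2‖ ≤ |C| * ‖p‖ ^ 5 * ‖p‖ := by gcongr; exact norm_snd_le p
      _ = |C| * ‖p‖ ^ 6 := by ring
  have hψid : (fun p => p - ψ p) =O[𝓝 (0 : ℝ × ℝ)] fun p => ‖p‖ ^ 6 := by
    refine IsBigO.trans (IsBigO.of_bound 1 (.of_forall fun p => ?_)) hKy
    have : p - ψ p = (0, p.2 - K p) := by simp [ψ, Prod.ext_iff]
    rw [this, Prod.norm_def, norm_zero, one_mul, ← norm_neg, neg_sub]
    exact max_le (norm_nonneg _) le_rfl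
  have hχid : (fun p => χ p - p) =O[𝓝 (0 : ℝ × ℝ)] fun p => ‖p‖ ^ 6 := by
    refine ((isBigO_sub_of_contDiffAt hχ tendsto_id hψt).trans hψid).congr' ?_ .rfl
    filter_upwards [hχψ] with p hp
    simp only [id, hp]
  refine ⟨fun p => H (χ p), ⟨by simp only [hχ0, hH0], ContDiffAt.comp 0 (by
    rw [hχ0]; exact hH.contDiffAt) hχ, ?_⟩, ?_⟩
  · filter_upwards [hψχ.eventually_nhds, (hχ.of_le (m := 1) (by simp)).eventually (by simp)]
      with p h2 h3
    have hχd := h3.differentiableAt one_ne_zero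
    have hid : fderiv ℝ (fun p => ψ (χ p)) p = ContinuousLinearMap.id ℝ _ := by
      rw [EventuallyEq.fderiv_eq (f := fun p => p) h2, fderiv_fun_id]
    have hc : fderiv ℝ (fun p => ψ (χ p)) p = (fderiv ℝ ψ (χ p)).comp (fderiv ℝ χ p) :=
      fderiv_comp p (hψd _) hχd
    have hc' : fderiv ℝ (fun p => H (χ p)) p = (fderiv ℝ H (χ p)).comp (fderiv ℝ χ p) :=
      fderiv_comp p (hHd _) hχd
    rw [hc', det_comp, ← hdet, ← det_comp, ← hc, hid]
    simp [ContinuousLinearMap.det]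
  · exact (isBigO_sub_of_contDiffAt hH.contDiffAt hχt tendsto_id).trans hχid

/-- Existence of the twist coefficients of a billiard map. -/
theorem hasTwistCoefficients (Q : SymmetricTable) (hR : 0 < Q.Rad 0) {F : ℝ × ℝ → ℝ × ℝ}
    (hFs : ContDiffAt ℝ ∞ F 0) (hF0 : F 0 = 0) (hF : ∀ᶠ p in 𝓝 0, F (Q.chart p) = Q.image p)
    {G : GenCoeffs} (hG : G = genCoeffs Q.L (Q.Rad 0) (Q.Rad 2) (Q.Rad 4)) {x y : ℂ}
    {θ τ₁ τ₂ : ℝ} (nf : NormalForm G x y τ₁ τ₂) (hx : x = Complex.exp (θ * I)) (hy : conj x = y)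
    (h4 : x ^ 4 ≠ 1) :
    ∃ h, IsSymplecticGerm h ∧ (fun p => F (h p) - h (twistMap θ τ₁ τ₂ p))
      =O[𝓝 (0 : ℝ × ℝ)] fun p => ‖p‖ ^ 6 := by
  set T := twistMap θ τ₁ τ₂
  have hX : ContDiff ℝ ∞ nf.X := nf.contDiff_X
  have hY : ContDiff ℝ ∞ nf.Y := nf.contDiff_Y
  let H : ℝ × ℝ → ℝ × ℝ := fun p => (nf.X p, nf.Y p)
  have hH : ContDiff ℝ ∞ H := hX.prodMk hY
  have z0 : zc 0 = 0 := by simp [zc]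
  have hX0 : nf.X 0 = 0 := by simp [NormalForm.X, oddPoly, z0]
  have hY0 : nf.Y 0 = 0 := by simp [NormalForm.Y, oddPoly, z0]
  have hH0 : H 0 = 0 := by simp [H, hX0, hY0]
  have hdet (p : ℝ × ℝ) : (fderiv ℝ H p).det = bracket nf.X nf.Y p :=
    (bracket_eq_det (hX.differentiable (by simp) p) (hY.differentiable (by simp) p)).symm
  obtain ⟨K, hK, hK0, hKJ⟩ := nf.exists_primitive
  obtain ⟨h, hh, hhH⟩ := exists_symplectic_correction hH hH0 hK hK0
    (fun x y => by rw [hdet]; exact hKJ x y)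
    ((nf.bracket_eq_one hx hy h4).of_eq fun p => by rw [hdet])
  have hTt := tendsto_twistMap θ τ₁ τ₂
  have hHt : Tendsto H (𝓝 0) (𝓝 0) := by simpa [hH0] using hH.continuous.tendsto 0
  -- the image of `H` under `F`
  have ord_one {f : ℝ × ℝ → ℝ} (hf : ContDiff ℝ ∞ f) (h0 : f 0 = 0) :
      Ord (𝓝 (0 : ℝ × ℝ)) (fun p => ‖p‖) 1 f := by
    have := isBigO_sub_of_contDiffAt (hf.contDiffAt (x := 0)) tendsto_id
      (tendsto_const_nhds (x := (0 : ℝ × ℝ)) (f := 𝓝 (0 : ℝ × ℝ)))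
    simpa [Ord, h0] using this.norm_right
  have hoX := ord_one hX hX0
  have hoXT : Ord (𝓝 (0 : ℝ × ℝ)) (fun p => ‖p‖) 1 (fun p => nf.X (T p)) :=
    (hoX.comp hTt).gauge (ord_twistMap θ τ₁ τ₂)
  obtain ⟨u, v, huv, hu, hv⟩ := Q.exists_momentum_expansion hR hF tendsto_norm_zero hoX hoXT hG
  have huY : Ord (𝓝 (0 : ℝ × ℝ)) (fun p => ‖p‖) 6 (fun p => nf.Y p - u p) :=
    (hu.rem.add (nf.momentum_eq hx hy)).neg.of_eq fun p => by
      simp only [GenCoeffs.momentum, T]; ring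
  have hvY : Ord (𝓝 (0 : ℝ × ℝ)) (fun p => ‖p‖) 6 (fun p => v p - nf.Y (T p)) :=
    (hv.rem.sub (nf.momentum_eq' hx hy)).of_eq fun p => by
      simp only [GenCoeffs.momentum, T]; ring
  have hu1 := hu.ord ord_norm_zero
  have hut : Tendsto (fun p => (nf.X p, u p)) (𝓝 0) (𝓝 0) := by
    refine Tendsto.prodMk_nhds ?_ ?_
    · exact IsBigO.trans_tendsto hoX (by simpa using tendsto_norm_zero)
    · exact IsBigO.trans_tendsto hu1 (by simpa using tendsto_norm_zero)
  have e1 : (fun p => F (H p) - F (nf.X p, u p)) =O[𝓝 (0 : ℝ × ℝ)] fun p => ‖p‖ ^ 6 := by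
    refine (isBigO_sub_of_contDiffAt hFs hHt hut).trans ?_
    exact IsBigO.trans (IsBigO.of_bound 1 (.of_forall fun p => by simp [H, Prod.norm_def])) huY
  have e2 : (fun p => F (nf.X p, u p) - H (T p)) =O[𝓝 (0 : ℝ × ℝ)] fun p => ‖p‖ ^ 6 := by
    refine IsBigO.trans (IsBigO.of_bound 1 ?_) hvY
    filter_upwards [huv] with p hp
    rw [hp]
    simp [H, Prod.norm_def]
  -- `h` may be replaced by `H` on both sides
  have hFt : Tendsto F (𝓝 0) (𝓝 0) := by simpa [hF0] using hFs.continuousAt.tendsto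
  have e3 : (fun p => F (h p) - F (H p)) =O[𝓝 (0 : ℝ × ℝ)] fun p => ‖p‖ ^ 6 :=
    (isBigO_sub_of_contDiffAt hFs hh.tendsto hHt).trans hhH
  have e4 : (fun p => h (T p) - H (T p)) =O[𝓝 (0 : ℝ × ℝ)] fun p => ‖p‖ ^ 6 :=
    (hhH.comp_tendsto hTt).trans
      (((ord_twistMap θ τ₁ τ₂).pow 6).congr (fun _ => rfl) fun _ => by simp)
  refine ⟨h, hh, (((e3.add e1).add e2).sub e4).congr_left fun p => ?_⟩
  abel

end Existence

end Billiard

namespace Billiard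

/-! ### The second twist coefficient of a table -/

section Table

open Complex (I)

/-- The real part of the multiplier of the period-two orbit. -/
noncomputable def multRe (L R : ℝ) : ℝ := L / R - 1

/-- The imaginary part of the multiplier of the period-two orbit. -/
noncomputable def multIm (L R : ℝ) : ℝ := -(√L * √(2 * R - L)) / R

variable {L R : ℝ}

theorem multIm_neg (hL : 0 < L) (hR : 0 < R) (h : L < 2 * R) : multIm L R < 0 := by
  have h1 := Real.sqrt_pos.2 hL
  have h2 := Real.sqrt_pos.2 (sub_pos.2 h)
  exact div_neg_of_neg_of_pos (neg_neg_of_pos (mul_pos h1 h2)) hR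

theorem multIm_sq (hL : 0 < L) (h : L < 2 * R) : multIm L R ^ 2 = L * (2 * R - L) / R ^ 2 := by
  rw [multIm, div_pow, neg_sq, mul_pow, Real.sq_sqrt hL.le, Real.sq_sqrt (sub_pos.2 h).le]

theorem multRe_sq_add (hL : 0 < L) (hR : 0 < R) (h : L < 2 * R) :
    multRe L R ^ 2 + multIm L R ^ 2 = 1 := by
  rw [multIm_sq hL h, multRe]
  field_simp
  ring

theorem genCoeffs_α (hL : 0 < L) (P Q : ℝ) :
    (genCoeffs L R P Q).α = -((genCoeffs L R P Q).β * multRe L R) := by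
  simp only [genCoeffs, multRe]
  field_simp
  ring

/-- The second twist coefficient as a function of `(L, R, R'', R⁽⁴⁾)`. -/
noncomputable def secondTwist (x : ℝ × ℝ × ℝ × ℝ) : ℝ :=
  (genCoeffs x.1 x.2.1 x.2.2.1 x.2.2.2).twist₂ (multRe x.1 x.2.1) (multIm x.1 x.2.1)

/-- Every billiard map agrees near the origin with the smooth one. -/
theorem IsBilliardMap.smooth {Q : SymmetricTable} {F : ℝ × ℝ → ℝ × ℝ} (hF : IsBilliardMap Q F) :
    ContDiffAt ℝ ∞ F 0 ∧ F 0 = 0 ∧ ∀ᶠ p in 𝓝 0, F (Q.chart p) = Q.image p := by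
  obtain ⟨F₀, hs, -, hu, hc⟩ := Q.exists_billiardGerm
  have hFF := hu F hF
  have ht : Tendsto Q.chart (𝓝 0) (𝓝 0) := by
    simpa using Q.contDiffAt_chart.continuousAt.tendsto
  have hc' : ∀ᶠ p in 𝓝 0, F (Q.chart p) = Q.image p := by
    filter_upwards [hc, ht.eventually hFF] with p h1 h2
    rw [h2, h1]
  exact ⟨hs.congr_of_eventuallyEq hFF, by simpa using hc'.self_of_nhds, hc'⟩

/-- The second twist coefficient of a billiard map off resonance. -/
theorem isSecondTwistCoefficient_iff {Q : SymmetricTable} (hQ : Q.IsElliptic) (h1 : Q.A1)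
    (h2 : Q.A2) {F : ℝ × ℝ → ℝ × ℝ} (hF : IsBilliardMap Q F) (τ : ℝ) :
    IsSecondTwistCoefficient F τ ↔ τ = secondTwist (Q.L, Q.Rad 0, Q.Rad 2, Q.Rad 4) := by
  obtain ⟨hR, hLR⟩ := hQ
  have hL := Q.L_pos
  obtain ⟨hFs, hF0, hFc⟩ := hF.smooth
  set R := Q.Rad 0 with hRdef
  set C := multRe Q.L R with hC
  set S := multIm Q.L R with hS
  have hCS : C ^ 2 + S ^ 2 = 1 := multRe_sq_add hL hR hLR
  have hSneg : S < 0 := multIm_neg hL hR hLR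
  have hC0 : C ≠ 0 := fun h => h1 (by rw [hC, multRe] at h; linarith)
  set x : ℂ := C + S * I with hx
  have h4 : x ^ 4 ≠ 1 := by
    intro h
    have : (x ^ 2 - 1) * (x ^ 2 + 1) = 0 := by linear_combination h
    have him : (x ^ 2).im = 2 * C * S := by rw [hx]; simp [pow_succ]; ring
    have hne : (x ^ 2).im ≠ 0 := by
      rw [him]; exact mul_ne_zero (mul_ne_zero two_ne_zero hC0) hSneg.ne
    rcases mul_eq_zero.1 this with h' | h'
    · exact hne (by rw [sub_eq_zero.1 h']; simp)
    · exact hne (by rw [eq_neg_of_add_eq_zero_left h']; simp)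
  have h6 : x ^ 6 ≠ 1 := by
    intro h
    have : (x ^ 3 - 1) * (x ^ 3 + 1) = 0 := by linear_combination h
    have him : (x ^ 3).im = S * ((2 * C - 1) * (2 * C + 1)) := by
      rw [hx]; simp [pow_succ]; linear_combination -S * hCS
    have hne : (x ^ 3).im ≠ 0 := by
      rw [him]
      refine mul_ne_zero hSneg.ne (mul_ne_zero (fun h => h2.2 ?_) fun h => h2.1 ?_) <;>
      · rw [hC, multRe] at h; linarith
    rcases mul_eq_zero.1 this with h' | h'
    · exact hne (by rw [sub_eq_zero.1 h']; simp)
    · exact hne (by rw [eq_neg_of_add_eq_zero_left h']; simp)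
  have hexp : x = Complex.exp (x.arg * I) := by
    have hn : ‖x‖ = 1 := by
      have : ‖x‖ ^ 2 = 1 := by
        rw [← Complex.normSq_eq_norm_sq, hx, Complex.normSq_add_mul_I, hCS]
      nlinarith [norm_nonneg x]
    have := Complex.norm_mul_exp_arg_mul_I x
    rw [hn] at this
    simpa using this.symm
  have hconj : conj x = C - S * I := by rw [hx]; simp [sub_eq_add_neg]
  have hβ : 0 < (genCoeffs Q.L R (Q.Rad 2) (Q.Rad 4)).β := by
    simp only [genCoeffs]; positivity
  obtain ⟨nf⟩ := exists_normalForm (genCoeffs Q.L R (Q.Rad 2) (Q.Rad 4)) hCS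
    (genCoeffs_α hL _ _) hβ.ne' (mul_neg_of_pos_of_neg hβ hSneg) hC0 hx rfl h4 h6
  obtain ⟨h, hh, hN⟩ := hasTwistCoefficients Q hR hFs hF0 hFc rfl nf hexp hconj h4
  constructor
  · intro hτ
    exact second_twist_unique hFs hF0 hh (by rwa [← hexp]) (by rwa [← hexp]) hN hτ
  · rintro rfl
    exact ⟨_, _, h, hh, hN⟩

end Table

end Billiard

namespace Billiard

/-! ### The coefficient `c₀₃` -/

section ThreeJet

open Complex (I)

/-- The coefficients of the terms of order one and three of the map generated by `G`, in its first
component. -/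
noncomputable def jetCoeff₁ (G : GenCoeffs) (C : ℝ) (j k : ℕ) : ℝ :=
  match j, k with
  | 1, 0 => C
  | 0, 1 => 1 / G.β
  | 3, 0 => -(4 * G.p + 3 * G.q * C + G.q * C ^ 3 + 2 * G.m * C ^ 2) / G.β
  | 2, 1 => -(3 * G.q + 3 * G.q * C ^ 2 + 4 * G.m * C) / G.β ^ 2
  | 1, 2 => -(3 * G.q * C + 2 * G.m) / G.β ^ 3
  | 0, 3 => -G.q / G.β ^ 4
  | _, _ => 0

/-- The coefficients of the terms of order one and three of the map generated by `G`, in its second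
component. -/
noncomputable def jetCoeff₂ (G : GenCoeffs) (C : ℝ) (j k : ℕ) : ℝ :=
  match j, k with
  | 1, 0 => G.β * (C ^ 2 - 1)
  | 0, 1 => C
  | 3, 0 => -(C * (4 * G.p + 3 * G.q * C + G.q * C ^ 3 + 2 * G.m * C ^ 2))
      - (4 * G.p * C ^ 3 + G.q * (3 * C ^ 2 + 1) + 2 * G.m * C)
  | 2, 1 => (-(C * (3 * G.q + 3 * G.q * C ^ 2 + 4 * G.m * C))
      - (12 * G.p * C ^ 2 + 6 * G.q * C + 2 * G.m)) / G.β
  | 1, 2 => (-(C * (3 * G.q * C + 2 * G.m)) - (12 * G.p * C + 3 * G.q)) / G.β ^ 2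
  | 0, 3 => (-(C * G.q) - 4 * G.p) / G.β ^ 3
  | _, _ => 0

/-- The Taylor coefficients of a billiard map up to order three: the equation
`u = α s + β t + cubicPart s t + ⋯` is solved for `t`, with `t = C s + u / β + ⋯`. -/
theorem taylorCoeff_billiard {Q : SymmetricTable} (hR : 0 < Q.Rad 0) {F : ℝ × ℝ → ℝ × ℝ}
    (hF : IsBilliardMap Q F) {G : GenCoeffs}
    (hG : G = genCoeffs Q.L (Q.Rad 0) (Q.Rad 2) (Q.Rad 4)) {j k : ℕ} (hjk : j + k < 4) :
    taylorCoeff (fun p => (F p).1) j k = jetCoeff₁ G (multRe Q.L (Q.Rad 0)) j k ∧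
      taylorCoeff (fun p => (F p).2) j k = jetCoeff₂ G (multRe Q.L (Q.Rad 0)) j k := by
  obtain ⟨hFs, hF0, hFc⟩ := hF.smooth
  have hr := ord_norm_zero (E := ℝ × ℝ)
  have hα : G.α = -(G.β * multRe Q.L (Q.Rad 0)) := by rw [hG]; exact genCoeffs_α Q.L_pos _ _
  have hβ : G.β ≠ 0 := by
    rw [hG]; simp only [genCoeffs]; exact (one_div_pos.2 Q.L_pos).ne'
  set C := multRe Q.L (Q.Rad 0)
  have hs := ord_fst
  have hu := ord_snd
  -- the next arc length, to the orders one and three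
  let t₁ : ℝ × ℝ → ℝ := fun p => C * p.1 + p.2 / G.β
  let t₃ : ℝ × ℝ → ℝ := fun p => -(cubicPart G.p G.q G.m p.1 (t₁ p) / G.β)
  have h1 : Ord (𝓝 (0 : ℝ × ℝ)) (fun p => ‖p‖) 1 t₁ :=
    ((hs.const_mul C).add (hu.const_mul (1 / G.β))).of_eq fun p => by simp only [t₁]; ring
  have hcub {f g : ℝ × ℝ → ℝ} (hf : Ord (𝓝 (0 : ℝ × ℝ)) (fun p => ‖p‖) 1 f)
      (hg : Ord (𝓝 (0 : ℝ × ℝ)) (fun p => ‖p‖) 1 g) :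
      Ord (𝓝 (0 : ℝ × ℝ)) (fun p => ‖p‖) 3 (fun p => cubicPart G.p G.q G.m (f p) (g p)) :=
    (((hf.pow 3).const_mul (4 * G.p)).add (((((hf.pow 2).mul hg).const_mul 3).add
      (hg.pow 3)).const_mul G.q)).add ((hf.mul (hg.pow 2)).const_mul (2 * G.m)) |>.of_eq
      fun p => by simp only [cubicPart]; ring
  have h3 : Ord (𝓝 (0 : ℝ × ℝ)) (fun p => ‖p‖) 3 t₃ :=
    ((hcub hs h1).const_mul (-(1 / G.β))).of_eq fun p => by simp only [t₃]; ring
  have jt : OddJet (𝓝 (0 : ℝ × ℝ)) (fun p => ‖p‖) (fun p => t₁ p + t₃ p) t₁ t₃ (fun _ => 0) :=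
    ⟨h1, h3, .zero, Ord.zero.of_eq fun p => by ring⟩
  have js : OddJet (𝓝 (0 : ℝ × ℝ)) (fun p => ‖p‖) (fun p => p.1) (fun p => p.1) (fun _ => 0)
      (fun _ => 0) := ⟨hs, .zero, .zero, Ord.zero.of_eq fun p => by ring⟩
  obtain ⟨u, v, huv, hju, hjv⟩ := Q.exists_momentum_expansion hR hFc tendsto_norm_zero hs
    (jt.ord hr) hG
  have c1 := (js.cubicPart hr jt G.p G.q G.m).ord₅ hr
  have c2 := (jt.cubicPart hr js G.p G.q G.m).ord₅ hr
  have hu4 : Ord (𝓝 (0 : ℝ × ℝ)) (fun p => ‖p‖) 4 (fun p => p.2 - u p) := by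
    refine (((hju.ord₅ hr).add c1).neg.mono hr (by norm_num : 4 ≤ 5)).of_eq fun p => ?_
    simp only [t₃, t₁, hα]
    field_simp
    ring
  have hv4 : Ord (𝓝 (0 : ℝ × ℝ)) (fun p => ‖p‖) 4 (fun p => v p - (G.β * C * t₁ p - G.β * p.1
      + G.β * C * t₃ p - cubicPart G.p G.q G.m (t₁ p) p.1)) := by
    refine (((hjv.ord₅ hr).sub c2).mono hr (by norm_num : 4 ≤ 5)).of_eq fun p => ?_
    simp only [hα]
    ring
  have hut : Tendsto (fun p : ℝ × ℝ => (p.1, u p)) (𝓝 0) (𝓝 0) := by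
    refine Tendsto.prodMk_nhds (continuous_fst.tendsto' _ _ rfl) ?_
    exact IsBigO.trans_tendsto (hju.ord hr) (by simpa using tendsto_norm_zero)
  have e1 : (fun p => F p - F (p.1, u p)) =O[𝓝 (0 : ℝ × ℝ)] fun p => ‖p‖ ^ 4 := by
    refine (isBigO_sub_of_contDiffAt hFs tendsto_id hut).trans ?_
    exact IsBigO.trans (IsBigO.of_bound 1 (.of_forall fun p => by simp [Prod.norm_def])) hu4
  have e1a : Ord (𝓝 (0 : ℝ × ℝ)) (fun p => ‖p‖) 4 (fun p => (F p).1 - (F (p.1, u p)).1) :=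
    IsBigO.trans (IsBigO.of_bound 1 (.of_forall fun p => by
      simpa using norm_fst_le (F p - F (p.1, u p)))) e1
  have e1b : Ord (𝓝 (0 : ℝ × ℝ)) (fun p => ‖p‖) 4 (fun p => (F p).2 - (F (p.1, u p)).2) :=
    IsBigO.trans (IsBigO.of_bound 1 (.of_forall fun p => by
      simpa using norm_snd_le (F p - F (p.1, u p)))) e1
  have hF1 : ContDiffAt ℝ ∞ (fun p => (F p).1) 0 := contDiffAt_fst.comp 0 hFs
  have hF2 : ContDiffAt ℝ ∞ (fun p => (F p).2) 0 := contDiffAt_snd.comp 0 hFs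
  constructor
  · refine taylorCoeff_eq_of_ord hF1 (n := 4) (e1a.congr' ?_) hjk
    filter_upwards [huv] with p hp
    rw [hp, planePoly_four]
    simp only [jetCoeff₁, t₃, t₁, cubicPart]
    field_simp
    ring
  · refine taylorCoeff_eq_of_ord hF2 (n := 4) ((e1b.add hv4).congr' ?_) hjk
    filter_upwards [huv] with p hp
    rw [hp, planePoly_four]
    simp only [jetCoeff₂, t₃, t₁, cubicPart]
    field_simp
    ring

/-- The combination of the quartic coefficients of the generating function that enters `c₀₃`. -/
def GenCoeffs.resonant (G : GenCoeffs) (C : ℝ) : ℝ :=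
  2 * G.p * (2 * C ^ 2 - 1) + 2 * G.q * C + G.m

/-- The coefficient `c₀₃` as a function of `(L, R, R'')`. -/
noncomputable def resonantCoeff (L R P : ℝ) : ℂ :=
  -(I / 2) * (genCoeffs L R P 0).resonant (multRe L R) * (multRe L R - multIm L R * I) ^ 2
    * (L * R ^ 2 / (2 * R - L) : ℝ)

/-- The coefficient `c₀₃` of a billiard map, from its three-jet and `η² = -1 / (β S)`. -/
theorem c03_eq {Q : SymmetricTable} (hQ : Q.IsElliptic) {F : ℝ × ℝ → ℝ × ℝ}
    (hF : IsBilliardMap Q F) : c03 F = resonantCoeff Q.L (Q.Rad 0) (Q.Rad 2) := by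
  obtain ⟨hR, hLR⟩ := hQ
  have hL := Q.L_pos
  obtain ⟨G, hG⟩ : ∃ G, G = genCoeffs Q.L (Q.Rad 0) (Q.Rad 2) (Q.Rad 4) := ⟨_, rfl⟩
  have hco {j k : ℕ} (hjk : j + k < 4) := taylorCoeff_billiard hR hF hG hjk
  have hβ : 0 < G.β := by rw [hG]; simp only [genCoeffs]; positivity
  have hβL : G.β = 1 / Q.L := by rw [hG]; rfl
  have hres : (genCoeffs Q.L (Q.Rad 0) (Q.Rad 2) 0).resonant = G.resonant := by rw [hG]; rfl
  have hCS := multRe_sq_add hL hR hLR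
  have hS := multIm_neg hL hR hLR
  have hS2 : Q.L * Q.Rad 0 ^ 2 / (2 * Q.Rad 0 - Q.L) = 1 / (G.β * multIm Q.L (Q.Rad 0)) ^ 2 := by
    have : 0 < 2 * Q.Rad 0 - Q.L := sub_pos.2 hLR
    rw [mul_pow, multIm_sq hL hLR, hβL]
    field_simp
  rw [resonantCoeff, hS2, hres]
  set C := multRe Q.L (Q.Rad 0)
  set S := multIm Q.L (Q.Rad 0)
  have hC2 : C ^ 2 - 1 = -S ^ 2 := by linear_combination hCS
  have a10 := (hco (j := 1) (k := 0) (by norm_num)).1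
  have a01 := (hco (j := 0) (k := 1) (by norm_num)).1
  have b10 := (hco (j := 1) (k := 0) (by norm_num)).2
  simp only [jetCoeff₁, jetCoeff₂] at a10 a01 b10
  have heta4 : eta F ^ 2 = -1 / (G.β * S) := by
    have hpos : 0 < -1 / (G.β * S) := div_pos_of_neg_of_neg (by norm_num) (mul_neg_of_pos_of_neg hβ hS)
    have h : -taylorCoeff (fun p => (F p).1) 0 1 / taylorCoeff (fun p => (F p).2) 1 0
        = (-1 / (G.β * S)) ^ 2 := by
      rw [a01, b10, hC2]; field_simp
    rw [eta, h, ← Real.rpow_natCast, ← Real.rpow_mul (by positivity), ← Real.rpow_natCast,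
      ← Real.rpow_mul hpos.le]
    norm_num
  have hE : eta F ^ 2 ≠ 0 := by
    rw [heta4]; exact div_ne_zero (by norm_num) (mul_ne_zero hβ.ne' hS.ne)
  have heig : eigenvalue F = C + S * I := by
    have : -taylorCoeff (fun p => (F p).1) 0 1 * taylorCoeff (fun p => (F p).2) 1 0 = (-S) ^ 2 := by
      rw [a01, b10, hC2]; field_simp
    rw [eigenvalue, this, a10, Real.sqrt_sq (by linarith)]
    push_cast; ring
  have z4 : eta F ^ (4 : ℤ) = (eta F ^ 2) ^ 2 := by
    rw [← pow_mul]; norm_cast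
  have zm2 : eta F ^ (-2 : ℤ) = (eta F ^ 2)⁻¹ := by rw [zpow_neg]; norm_cast
  have zm4 : eta F ^ (-4 : ℤ) = ((eta F ^ 2) ^ 2)⁻¹ := by rw [zpow_neg, z4]
  have z2 : eta F ^ (2 : ℤ) = eta F ^ 2 := by norm_cast
  have A30 : aCoeff F 3 0 = eta F ^ 2 * jetCoeff₁ G C 3 0 := by
    rw [aCoeff, (hco (by norm_num)).1]; norm_num [z2]
  have A21 : aCoeff F 2 1 = jetCoeff₁ G C 2 1 := by
    rw [aCoeff, (hco (by norm_num)).1]; norm_num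
  have A12 : aCoeff F 1 2 = (eta F ^ 2)⁻¹ * jetCoeff₁ G C 1 2 := by
    rw [aCoeff, (hco (by norm_num)).1, ← zm2]; norm_num
  have A03 : aCoeff F 0 3 = ((eta F ^ 2) ^ 2)⁻¹ * jetCoeff₁ G C 0 3 := by
    rw [aCoeff, (hco (by norm_num)).1, ← zm4]; norm_num
  have B30 : bCoeff F 3 0 = (eta F ^ 2) ^ 2 * jetCoeff₂ G C 3 0 := by
    rw [bCoeff, (hco (by norm_num)).2, ← z4]; norm_num
  have B21 : bCoeff F 2 1 = eta F ^ 2 * jetCoeff₂ G C 2 1 := by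
    rw [bCoeff, (hco (by norm_num)).2, ← z2]; norm_num
  have B12 : bCoeff F 1 2 = jetCoeff₂ G C 1 2 := by
    rw [bCoeff, (hco (by norm_num)).2]; norm_num
  have B03 : bCoeff F 0 3 = (eta F ^ 2)⁻¹ * jetCoeff₂ G C 0 3 := by
    rw [bCoeff, (hco (by norm_num)).2, ← zm2]; norm_num
  have hβ0 := hβ.ne'
  have hS0 := hS.ne
  have hre : aCoeff F 3 0 - bCoeff F 2 1 - aCoeff F 1 2 + bCoeff F 0 3
      = -(4 * G.resonant C / (G.β ^ 2 * S)) := by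
    rw [A30, A12, B21, B03, heta4]
    simp only [jetCoeff₁, jetCoeff₂, GenCoeffs.resonant]
    field_simp
    grind
  have him : bCoeff F 3 0 + aCoeff F 2 1 - bCoeff F 1 2 - aCoeff F 0 3
      = -(4 * G.resonant C * C / (G.β ^ 2 * S ^ 2)) := by
    rw [A21, A03, B30, B12, heta4]
    simp only [jetCoeff₁, jetCoeff₂, GenCoeffs.resonant]
    field_simp
    grind
  have hsum : (aCoeff F 3 0 : ℂ) + I * bCoeff F 3 0 + I * aCoeff F 2 1 - bCoeff F 2 1
      - aCoeff F 1 2 - I * bCoeff F 1 2 - I * aCoeff F 0 3 + bCoeff F 0 3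
      = ((-(4 * G.resonant C / (G.β ^ 2 * S)) : ℝ) : ℂ)
        + I * ((-(4 * G.resonant C * C / (G.β ^ 2 * S ^ 2)) : ℝ) : ℂ) := by
    rw [← hre, ← him]; push_cast; ring
  rw [c03, hsum, heig]
  have hβc : (G.β : ℂ) ≠ 0 := by exact_mod_cast hβ0
  have hSc : (S : ℂ) ≠ 0 := by exact_mod_cast hS0
  simp only [map_add, map_mul, Complex.conj_ofReal, Complex.conj_I]
  push_cast
  field_simp
  linear_combination (-(8 * (G.resonant C : ℂ) * S * (C - I * S))) * Complex.I_sq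

end ThreeJet

end Billiard

namespace Billiard

/-! ### Regular functions -/

section Regular

variable {𝕜 : Type} [RCLike 𝕜] {f g : ℝ × ℝ × ℝ × ℝ → 𝕜}

theorem isOpen_locus : IsOpen locus := by
  refine (isOpen_lt continuous_const continuous_fst).inter
    ((isOpen_lt continuous_const (by fun_prop : Continuous fun p : ℝ × ℝ × ℝ × ℝ => p.2.1)).inter
    (isOpen_lt continuous_const (by fun_prop : Continuous fun p : ℝ × ℝ × ℝ × ℝ => 2 * p.2.1 - p.1)))

namespace IsRegular

theorem congr (hf : IsRegular f) (h : ∀ p ∈ locus, f p = g p) : IsRegular g := by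
  obtain ⟨A, B, hAB⟩ := hf
  exact ⟨A, B, fun p hp => ⟨(hAB p hp).1, by rw [← h p hp, (hAB p hp).2]⟩⟩

theorem const (c : 𝕜) : IsRegular (fun _ => c) :=
  ⟨MvPolynomial.C c, 1, fun p _ => by simp⟩

theorem generator (i : Fin 6) : IsRegular (fun p => (generators p i : 𝕜)) :=
  ⟨MvPolynomial.X i, 1, fun p _ => by simp⟩

theorem add (hf : IsRegular f) (hg : IsRegular g) : IsRegular (fun p => f p + g p) := by
  obtain ⟨A, B, hAB⟩ := hf
  obtain ⟨A', B', hAB'⟩ := hg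
  refine ⟨A * B' + A' * B, B * B', fun p hp => ?_⟩
  obtain ⟨h1, h2⟩ := hAB p hp
  obtain ⟨h1', h2'⟩ := hAB' p hp
  refine ⟨by simpa using ⟨h1, h1'⟩, ?_⟩
  beta_reduce
  rw [h2, h2']
  simp only [map_add, map_mul]
  field_simp

theorem mul (hf : IsRegular f) (hg : IsRegular g) : IsRegular (fun p => f p * g p) := by
  obtain ⟨A, B, hAB⟩ := hf
  obtain ⟨A', B', hAB'⟩ := hg
  refine ⟨A * A', B * B', fun p hp => ?_⟩
  obtain ⟨h1, h2⟩ := hAB p hp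
  obtain ⟨h1', h2'⟩ := hAB' p hp
  refine ⟨by simpa using ⟨h1, h1'⟩, ?_⟩
  beta_reduce
  rw [h2, h2']
  simp only [map_mul]
  field_simp

theorem neg (hf : IsRegular f) : IsRegular (fun p => -f p) :=
  ((const (-1 : 𝕜)).mul hf).congr fun p _ => by ring

theorem sub (hf : IsRegular f) (hg : IsRegular g) : IsRegular (fun p => f p - g p) :=
  (hf.add hg.neg).congr fun p _ => by ring

theorem pow (hf : IsRegular f) (n : ℕ) : IsRegular (fun p => f p ^ n) := by
  induction n with
  | zero => exact (const 1).congr fun p _ => by simp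
  | succ n ih => exact (ih.mul hf).congr fun p _ => by ring

theorem inv (hf : IsRegular f) (h : ∀ p ∈ locus, f p ≠ 0) : IsRegular (fun p => (f p)⁻¹) := by
  obtain ⟨A, B, hAB⟩ := hf
  refine ⟨B, A, fun p hp => ⟨fun h0 => h p hp ?_, ?_⟩⟩
  · rw [(hAB p hp).2, h0, zero_div]
  · beta_reduce
    rw [(hAB p hp).2, inv_div]

theorem div (hf : IsRegular f) (hg : IsRegular g) (h : ∀ p ∈ locus, g p ≠ 0) :
    IsRegular (fun p => f p / g p) :=
  (hf.mul (hg.inv h)).congr fun p _ => by rw [div_eq_mul_inv]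

theorem ofReal {f : ℝ × ℝ × ℝ × ℝ → ℝ} (hf : IsRegular f) : IsRegular (fun p => (f p : ℂ)) := by
  obtain ⟨A, B, hAB⟩ := hf
  refine ⟨MvPolynomial.map Complex.ofRealHom A, MvPolynomial.map Complex.ofRealHom B,
    fun p hp => ?_⟩
  have h (P : MvPolynomial (Fin 6) ℝ) : MvPolynomial.eval (fun i => ((generators p i : ℝ) : ℂ))
      (MvPolynomial.map Complex.ofRealHom P) = (MvPolynomial.eval (generators p) P : ℝ) := by
    induction P using MvPolynomial.induction_on with
    | C a => simp
    | add P Q hP hQ => simp [hP, hQ]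
    | mul_X P i hP => simp [hP]
  obtain ⟨h1, h2⟩ := hAB p hp
  refine ⟨fun h0 => h1 ?_, ?_⟩
  · exact_mod_cast (h B).symm.trans h0
  · refine Eq.trans ?_ (congrArg₂ (· / ·) (h A) (h B)).symm
    beta_reduce
    rw [h2]
    exact Complex.ofReal_div _ _

theorem analyticAt {f : ℝ × ℝ × ℝ × ℝ → ℝ} (hf : IsRegular f) {p : ℝ × ℝ × ℝ × ℝ}
    (hp : p ∈ locus) : AnalyticAt ℝ f p := by
  obtain ⟨A, B, hAB⟩ := hf
  have hgen (i : Fin 6) : AnalyticAt ℝ (fun p => generators p i) p := by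
    have h1 : AnalyticAt ℝ (fun p : ℝ × ℝ × ℝ × ℝ => p.1) p := analyticAt_fst
    have h2 : AnalyticAt ℝ (fun p : ℝ × ℝ × ℝ × ℝ => p.2.1) p :=
      (by fun_prop : ContDiffAt ℝ ω (fun p : ℝ × ℝ × ℝ × ℝ => p.2.1) p).analyticAt
    have h3 : AnalyticAt ℝ (fun p : ℝ × ℝ × ℝ × ℝ => p.2.2.1) p :=
      (by fun_prop : ContDiffAt ℝ ω (fun p : ℝ × ℝ × ℝ × ℝ => p.2.2.1) p).analyticAt
    have h4 : AnalyticAt ℝ (fun p : ℝ × ℝ × ℝ × ℝ => p.2.2.2) p :=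
      (by fun_prop : ContDiffAt ℝ ω (fun p : ℝ × ℝ × ℝ × ℝ => p.2.2.2) p).analyticAt
    have h5 : AnalyticAt ℝ (fun p : ℝ × ℝ × ℝ × ℝ => √p.1) p :=
      (h1.contDiffAt.sqrt hp.1.ne').analyticAt
    have h6 : AnalyticAt ℝ (fun p : ℝ × ℝ × ℝ × ℝ => √(2 * p.2.1 - p.1)) p :=
      (((analyticAt_const.mul h2).sub h1).contDiffAt.sqrt hp.2.2.ne').analyticAt
    fin_cases i <;> assumption
  have hev (P : MvPolynomial (Fin 6) ℝ) :
      AnalyticAt ℝ (fun p => MvPolynomial.eval (generators p) P) p := by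
    simpa [MvPolynomial.coe_aeval_eq_eval] using AnalyticAt.aeval_mvPolynomial hgen P
  refine ((hev A).div (hev B) (hAB p hp).1).congr ?_
  filter_upwards [isOpen_locus.mem_nhds hp] with q hq
  exact (hAB q hq).2.symm

end IsRegular

end Regular

end Billiard

namespace Billiard

/-! ### The polar part of the second twist coefficient -/

section PolarPart

open Complex (I)

/-- The coefficients of the chord length as functions of `p = (L, R, R'', R⁽⁴⁾)`. -/
noncomputable def chordCoeffs (p : ℝ × ℝ × ℝ × ℝ) : GenCoeffs :=
  genCoeffs p.1 p.2.1 p.2.2.1 p.2.2.2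

namespace IsRegular

variable {𝕜 : Type} [RCLike 𝕜]

theorem sqrt_length : IsRegular fun p : ℝ × ℝ × ℝ × ℝ => √p.1 := generator 0

theorem sqrt_sub : IsRegular fun p : ℝ × ℝ × ℝ × ℝ => √(2 * p.2.1 - p.1) := generator 1

theorem length : IsRegular fun p : ℝ × ℝ × ℝ × ℝ => p.1 := generator 2

theorem radius₀ : IsRegular fun p : ℝ × ℝ × ℝ × ℝ => p.2.1 := generator 3

theorem radius₂ : IsRegular fun p : ℝ × ℝ × ℝ × ℝ => p.2.2.1 := generator 4

theorem radius₄ : IsRegular fun p : ℝ × ℝ × ℝ × ℝ => p.2.2.2 := generator 5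

theorem multRe : IsRegular fun p : ℝ × ℝ × ℝ × ℝ => multRe p.1 p.2.1 :=
  (length.div radius₀ fun _ h => h.2.1.ne').sub (const 1)

theorem multIm : IsRegular fun p : ℝ × ℝ × ℝ × ℝ => multIm p.1 p.2.1 :=
  (sqrt_length.mul sqrt_sub).neg.div radius₀ fun _ h => h.2.1.ne'

theorem chordCoeffs_quartic : IsRegular (fun x => (chordCoeffs x).β) ∧
    IsRegular (fun x => (chordCoeffs x).p) ∧ IsRegular (fun x => (chordCoeffs x).q) ∧
    IsRegular (fun x => (chordCoeffs x).m) := by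
  simp only [chordCoeffs, genCoeffs]
  refine ⟨?_, ?_, ?_, ?_⟩
  all_goals
    repeat' first
      | exact length | exact radius₀ | exact radius₂ | exact const _
      | apply div | apply sub | apply add | apply neg | apply pow | apply mul
  all_goals
    rintro x ⟨h1, h2, -⟩
    positivity

theorem chordCoeffs_sextic : IsRegular (fun x => (chordCoeffs x).e₀) ∧
    IsRegular (fun x => (chordCoeffs x).e₁) ∧ IsRegular (fun x => (chordCoeffs x).e₂) ∧
    IsRegular (fun x => (chordCoeffs x).e₃) := by
  simp only [chordCoeffs, genCoeffs]
  refine ⟨?_, ?_, ?_, ?_⟩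
  all_goals
    repeat' first
      | exact length | exact radius₀ | exact radius₂ | exact radius₄ | exact const _
      | apply div | apply sub | apply add | apply neg | apply pow | apply mul
  all_goals
    rintro x ⟨h1, h2, -⟩
    positivity

end IsRegular

/-- The part of the second twist coefficient that has no pole along `L = R`. -/
noncomputable def secondTwistRest (x : ℝ × ℝ × ℝ × ℝ) : ℝ :=
  let G := chordCoeffs x
  let C := multRe x.1 x.2.1
  let S := multIm x.1 x.2.1
  G.sextic C / (16 * G.β ^ 3 * S ^ 3)
    + 3 * (6 * G.q + 4 * G.m * C) * G.twist₁ C S / (4 * G.β ^ 2 * S)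
    - 3 * C * G.twist₁ C S ^ 2 / (2 * S)

theorem IsRegular.secondTwistRest : IsRegular secondTwistRest := by
  obtain ⟨hβ, hp, hq, hm⟩ := chordCoeffs_quartic
  obtain ⟨h0, h1, h2, h3⟩ := chordCoeffs_sextic
  have hS0 : ∀ x ∈ locus, Billiard.multIm x.1 x.2.1 ≠ 0 := fun x ⟨h1, h2, h3⟩ =>
    (multIm_neg h1 h2 (by linarith)).ne
  have hβ0 : ∀ x ∈ locus, (chordCoeffs x).β ≠ 0 := fun x h => (one_div_pos.2 h.1).ne'
  unfold Billiard.secondTwistRest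
  simp only [GenCoeffs.sextic, GenCoeffs.twist₁, GenCoeffs.g]
  repeat' first
    | exact multRe | exact multIm | exact hβ | exact hp | exact hq | exact hm | exact h0
    | exact h1 | exact h2 | exact h3 | exact const _
    | apply div | apply sub | apply add | apply neg | apply pow | apply mul
  all_goals
    intro x hx
    have := hS0 x hx
    have := hβ0 x hx
    positivity

/-- The second twist coefficient has only a simple pole, since `C = (L - R) / R` occurs once in its
denominator. -/
theorem secondTwist_eq {L R R2 R4 : ℝ} (hL : 0 < L) (hR : 0 < R) (h : 0 < 2 * R - L)
    (hLR : L ≠ R) : secondTwist (L, R, R2, R4) =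
      3 * (genCoeffs L R R2 R4).N (multRe L R) ^ 2 * √L ^ 3 * R ^ 6
        / (64 * √(2 * R - L) ^ 5 * (R - L)) + secondTwistRest (L, R, R2, R4) := by
  have h0 : R - L ≠ 0 := sub_ne_zero.2 hLR.symm
  have ha : √L ≠ 0 := (Real.sqrt_pos.2 hL).ne'
  have hy : √(2 * R - L) ≠ 0 := (Real.sqrt_pos.2 h).ne'
  have hpol : 3 * (genCoeffs L R R2 R4).N (multRe L R) ^ 2
      / (64 * (genCoeffs L R R2 R4).β ^ 4 * multRe L R * multIm L R ^ 5) =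
      3 * (genCoeffs L R R2 R4).N (multRe L R) ^ 2 * √L ^ 3 * R ^ 6
        / (64 * √(2 * R - L) ^ 5 * (R - L)) := by
    have hβ : (genCoeffs L R R2 R4).β = 1 / √L ^ 2 := by rw [Real.sq_sqrt hL.le]; rfl
    have hC : multRe L R = -(R - L) / R := by rw [multRe]; field_simp; ring
    have hd : 64 * (genCoeffs L R R2 R4).β ^ 4 * multRe L R * multIm L R ^ 5
        = 64 * √(2 * R - L) ^ 5 * (R - L) / (√L ^ 3 * R ^ 6) := by
      rw [hβ, hC, multIm]
      generalize √L = a at *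
      generalize √(2 * R - L) = y at *
      field_simp
    rw [hd]
    field_simp
  rw [secondTwist, GenCoeffs.twist₂, hpol, secondTwistRest]
  simp only [chordCoeffs]
  ring

theorem rpow_five_halves {x : ℝ} (hx : 0 ≤ x) : x ^ (5 / 2 : ℝ) = √x ^ 5 := by
  rw [Real.sqrt_eq_rpow, ← Real.rpow_natCast, ← Real.rpow_mul hx]
  norm_num

end PolarPart

end Billiard

namespace Billiard

/-! ### The pole along `L = R` -/

section Resonance

open Complex (I)

/-- The cofactor of `C` in `N + 2 * resonant`; so `N² - 4 * resonant²` vanishes along `L = R`. -/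
def GenCoeffs.cofactor (G : GenCoeffs) (C : ℝ) : ℝ :=
  4 * (2 * G.p * C + G.q * C ^ 2 + G.q + G.m * C)

theorem GenCoeffs.N_add_resonant (G : GenCoeffs) (C : ℝ) :
    G.N C + 2 * G.resonant C = C * G.cofactor C := by
  simp only [N, resonant, cofactor]
  ring

/-- The value at `L = R` of the combination `GenCoeffs.resonant`. -/
noncomputable def resonantAt (R P : ℝ) : ℝ := -1 / (4 * R ^ 3) - P / (12 * R ^ 2)

theorem resonantCoeff_self {R : ℝ} (hR : 0 < R) (P : ℝ) :
    resonantCoeff R R P = I / 2 * (resonantAt R P * R ^ 2 : ℝ) := by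
  have h1 : multRe R R = 0 := by rw [multRe, div_self hR.ne', sub_self]
  have h2 : multIm R R = -1 := by
    rw [multIm, show 2 * R - R = R by ring, Real.mul_self_sqrt hR.le, neg_div, div_self hR.ne']
  have h3 : (genCoeffs R R P 0).resonant 0 = resonantAt R P := by
    simp only [GenCoeffs.resonant, genCoeffs, resonantAt]
    field_simp
    ring
  have h4 : R * R ^ 2 / (2 * R - R) = R ^ 2 := by
    rw [show 2 * R - R = R by ring]; field_simp
  rw [resonantCoeff, h1, h2, h3, h4]
  push_cast
  linear_combination (-(I / 2) * (resonantAt R P : ℂ) * R ^ 2) * Complex.I_sq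

theorem resonantCoeff_self_ne_zero {R : ℝ} (hR : 0 < R) (P : ℝ) :
    resonantCoeff R R P ≠ 0 ↔ resonantAt R P ≠ 0 := by
  rw [resonantCoeff_self hR]
  simp [hR.ne']

/-- At resonance `C = 0`, and `N` reduces to a multiple of the combination in `c₀₃`. -/
theorem N_self {R : ℝ} (hR : 0 < R) (P Q : ℝ) :
    (genCoeffs R R P Q).N (multRe R R) = -2 * resonantAt R P := by
  have h1 : multRe R R = 0 := by rw [multRe, div_self hR.ne', sub_self]
  rw [h1]
  simp only [GenCoeffs.N, genCoeffs, resonantAt]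
  field_simp
  ring

/-- The quotient of `L * N + 2 * R * resonantAt R P` by `L - R`. -/
noncomputable def resonantQuotient (x : ℝ × ℝ × ℝ × ℝ) : ℝ :=
  -(x.2.1 + x.1) / (x.1 ^ 2 * x.2.1 ^ 2) + 1 / (6 * x.2.1 ^ 3) + x.2.2.1 / (6 * x.2.1 ^ 2)
    + (4 * (chordCoeffs x).m * multRe x.1 x.2.1 * x.1
      + 4 * (chordCoeffs x).q * multRe x.1 x.2.1 ^ 2 * x.1) / x.2.1

theorem mul_resonantQuotient {L R : ℝ} (hL : 0 < L) (hR : 0 < R) (P Q : ℝ) :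
    L * (genCoeffs L R P Q).N (multRe L R) + 2 * R * resonantAt R P
      = (L - R) * resonantQuotient (L, R, P, Q) := by
  simp only [GenCoeffs.N, genCoeffs, resonantAt, resonantQuotient, chordCoeffs, multRe]
  field_simp
  ring

/-- The regular part of the second twist coefficient, if the polar part is expressed by `c₀₃`. -/
noncomputable def regularPart (x : ℝ × ℝ × ℝ × ℝ) : ℂ :=
  let G := chordCoeffs x
  let C := multRe x.1 x.2.1
  let μ : ℂ := C - multIm x.1 x.2.1 * I
  3 * (√x.1 : ℂ) ^ 3 * (x.2.1 : ℂ) ^ 6 / (64 * (√(2 * x.2.1 - x.1) : ℂ) ^ 9)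
    * ((G.N C : ℂ) ^ 2 * (3 * (x.2.1 : ℂ) - x.1)
      - x.2.1 * ((G.N C : ℂ) - 2 * G.resonant C) * G.cofactor C
      - 8 * x.2.1 * (G.resonant C : ℂ) ^ 2 * μ * (1 - μ ^ 2))
    + secondTwistRest x

/-- The regular part of the second twist coefficient, if the polar part is expressed by the value
of `c₀₃` at resonance. -/
noncomputable def regularPartAt (x : ℝ × ℝ × ℝ × ℝ) : ℝ :=
  3 * x.2.1 ^ 6 / (64 * √x.1 * √(2 * x.2.1 - x.1) ^ 5)
    * (((chordCoeffs x).N (multRe x.1 x.2.1) * x.1 - 2 * x.2.1 * resonantAt x.2.1 x.2.2.1)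
      * -resonantQuotient x) + secondTwistRest x

/-- The second twist coefficient, multiplied by `R - L`. -/
noncomputable def residuePart (x : ℝ × ℝ × ℝ × ℝ) : ℝ :=
  3 * (chordCoeffs x).N (multRe x.1 x.2.1) ^ 2 * √x.1 ^ 3 * x.2.1 ^ 6
    / (64 * √(2 * x.2.1 - x.1) ^ 5) + (x.2.1 - x.1) * secondTwistRest x

namespace IsRegular

theorem resonantAt : IsRegular fun x : ℝ × ℝ × ℝ × ℝ => resonantAt x.2.1 x.2.2.1 := by
  unfold Billiard.resonantAt
  repeat' first
    | exact radius₀ | exact radius₂ | exact const _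
    | apply div | apply sub | apply pow | apply mul
  all_goals
    rintro x ⟨h1, h2, -⟩
    positivity

theorem resonantQuotient : IsRegular resonantQuotient := by
  obtain ⟨hβ, hp, hq, hm⟩ := chordCoeffs_quartic
  unfold Billiard.resonantQuotient
  repeat' first
    | exact length | exact radius₀ | exact radius₂ | exact multRe | exact hq | exact hm
    | exact const _ | apply div | apply sub | apply add | apply neg | apply pow | apply mul
  all_goals
    rintro x ⟨h1, h2, -⟩
    positivity

theorem N : IsRegular fun x : ℝ × ℝ × ℝ × ℝ => (chordCoeffs x).N (Billiard.multRe x.1 x.2.1) := by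
  obtain ⟨hβ, hp, hq, hm⟩ := chordCoeffs_quartic
  unfold GenCoeffs.N
  repeat' first
    | exact multRe | exact hp | exact hq | exact hm | exact const _
    | apply sub | apply add | apply pow | apply mul

theorem resonant : IsRegular fun x : ℝ × ℝ × ℝ × ℝ =>
    (chordCoeffs x).resonant (Billiard.multRe x.1 x.2.1) := by
  obtain ⟨hβ, hp, hq, hm⟩ := chordCoeffs_quartic
  unfold GenCoeffs.resonant
  repeat' first
    | exact multRe | exact hp | exact hq | exact hm | exact const _
    | apply sub | apply add | apply pow | apply mul

theorem cofactor : IsRegular fun x : ℝ × ℝ × ℝ × ℝ =>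
    (chordCoeffs x).cofactor (Billiard.multRe x.1 x.2.1) := by
  obtain ⟨hβ, hp, hq, hm⟩ := chordCoeffs_quartic
  unfold GenCoeffs.cofactor
  repeat' first
    | exact multRe | exact hp | exact hq | exact hm | exact const _
    | apply sub | apply add | apply pow | apply mul

theorem regularPart : IsRegular regularPart := by
  unfold Billiard.regularPart
  repeat' first
    | exact sqrt_length.ofReal | exact sqrt_sub.ofReal | exact length.ofReal
    | exact radius₀.ofReal | exact multRe.ofReal | exact multIm.ofReal | exact N.ofReal
    | exact resonant.ofReal | exact cofactor.ofReal | exact secondTwistRest.ofReal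
    | exact const _ | apply div | apply sub | apply add | apply neg | apply pow | apply mul
  rintro x ⟨-, -, h⟩
  have := (Real.sqrt_pos.2 h).ne'
  exact mul_ne_zero (by norm_num) (pow_ne_zero _ (by exact_mod_cast this))

theorem regularPartAt : IsRegular regularPartAt := by
  unfold Billiard.regularPartAt
  repeat' first
    | exact sqrt_length | exact sqrt_sub | exact length | exact radius₀ | exact multRe
    | exact N | exact resonantAt | exact resonantQuotient | exact secondTwistRest
    | exact const _ | apply div | apply sub | apply add | apply neg | apply pow | apply mul
  rintro x ⟨h1, -, h⟩
  have := Real.sqrt_pos.2 h1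
  have := Real.sqrt_pos.2 h
  positivity

theorem residuePart : IsRegular residuePart := by
  unfold Billiard.residuePart
  repeat' first
    | exact sqrt_length | exact sqrt_sub | exact length | exact radius₀ | exact multRe
    | exact N | exact secondTwistRest
    | exact const _ | apply div | apply sub | apply add | apply neg | apply pow | apply mul
  rintro x ⟨-, -, h⟩
  have := Real.sqrt_pos.2 h
  positivity

end IsRegular

variable {L R R2 R4 : ℝ}

/-- The difference of the polar part of the second twist coefficient and of its expression by `c₀₃`
has no pole: `N² y⁴ - 4 R² T² μ⁴` is divisible by `R - L`, since `y⁴ - R²`, `N² - 4 T²` and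
`1 - μ⁴` are. Here `a`, `y` are the square roots of `L`, `2 R - L`, the multiplier has real part `C`
and conjugate `μ`, and `T` is the combination `GenCoeffs.resonant`. -/
theorem polarPart_identity {a y L R N T K C μ : ℂ} (ha : a ≠ 0) (hy : y ≠ 0)
    (hRL : R - L ≠ 0) (hL : a ^ 2 = L) (hy2 : y ^ 2 = 2 * R - L) (hC : C * R = L - R)
    (hN : N + 2 * T = C * K) (hμ : 1 + μ ^ 2 = 2 * C * μ) :
    3 * N ^ 2 * a ^ 3 * R ^ 6 / (64 * y ^ 5 * (R - L)) =
      -(3 * R ^ 4 * (-(I / 2) * T * μ ^ 2 * (L * R ^ 2 / (2 * R - L))) ^ 2)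
        / (4 * a * y ^ 5 * (R - L))
      + 3 * a ^ 3 * R ^ 6 / (64 * y ^ 9) * (N ^ 2 * (3 * R - L) - R * (N - 2 * T) * K
        - 8 * R * T ^ 2 * μ * (1 - μ ^ 2)) := by
  have key : N ^ 2 * y ^ 4 - 4 * R ^ 2 * T ^ 2 * μ ^ 4 = (R - L) * (N ^ 2 * (3 * R - L)
      - R * (N - 2 * T) * K - 8 * R * T ^ 2 * μ * (1 - μ ^ 2)) := by
    linear_combination N ^ 2 * (y ^ 2 + (2 * R - L)) * hy2 + R ^ 2 * (N - 2 * T) * hN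
      + 4 * R ^ 2 * T ^ 2 * (1 - μ ^ 2) * hμ
      + (R * (N - 2 * T) * K + 8 * R * T ^ 2 * μ * (1 - μ ^ 2)) * hC
  have hB : N ^ 2 * (3 * R - L) - R * (N - 2 * T) * K - 8 * R * T ^ 2 * μ * (1 - μ ^ 2)
      = (N ^ 2 * y ^ 4 - 4 * R ^ 2 * T ^ 2 * μ ^ 4) / (R - L) := by
    rw [key]; field_simp
  rw [hB, ← hy2, ← hL]
  rw [← hL] at hRL
  field_simp
  linear_combination (64 * R ^ 8 * T ^ 2 * μ ^ 4) * Complex.I_sq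

theorem secondTwist_eq_regularPart (hL : 0 < L) (hR : 0 < R) (h : 0 < 2 * R - L) (hLR : L ≠ R) :
    (secondTwist (L, R, R2, R4) : ℂ) =
      -(3 * (R : ℂ) ^ 4 * resonantCoeff L R R2 ^ 2) /
        ((4 * √L * (2 * R - L) ^ (5 / 2 : ℝ) * (R - L) : ℝ) : ℂ)
        + regularPart (L, R, R2, R4) := by
  have hRc : (R : ℂ) ≠ 0 := by exact_mod_cast hR.ne'
  have hCS := multRe_sq_add hL hR (sub_pos.1 h)
  have key := polarPart_identity (a := √L) (y := √(2 * R - L)) (L := L) (R := R)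
    (N := (genCoeffs L R R2 R4).N (multRe L R)) (T := (genCoeffs L R R2 R4).resonant (multRe L R))
    (K := (genCoeffs L R R2 R4).cofactor (multRe L R)) (C := multRe L R)
    (μ := multRe L R - multIm L R * I)
    (by exact_mod_cast (Real.sqrt_pos.2 hL).ne') (by exact_mod_cast (Real.sqrt_pos.2 h).ne')
    (by exact_mod_cast sub_ne_zero.2 hLR.symm) (by exact_mod_cast Real.sq_sqrt hL.le)
    (by exact_mod_cast Real.sq_sqrt h.le)
    (by rw [multRe]; push_cast; field_simp)
    (by exact_mod_cast GenCoeffs.N_add_resonant _ _)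
    (by
      have : (multRe L R : ℂ) ^ 2 + (multIm L R : ℂ) ^ 2 = 1 := by exact_mod_cast hCS
      linear_combination (multIm L R : ℂ) ^ 2 * Complex.I_sq - this)
  have hres : (genCoeffs L R R2 0).resonant = (genCoeffs L R R2 R4).resonant := rfl
  rw [secondTwist_eq hL hR h hLR, resonantCoeff, regularPart, rpow_five_halves h.le, hres]
  simp only [chordCoeffs]
  push_cast
  rw [key]
  ring

theorem secondTwist_eq_regularPartAt (hL : 0 < L) (hR : 0 < R) (h : 0 < 2 * R - L)
    (hLR : L ≠ R) : (secondTwist (L, R, R2, R4) : ℂ) =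
      -(3 * (R : ℂ) ^ 4 * resonantCoeff R R R2 ^ 2) /
        ((4 * √L * (2 * R - L) ^ (5 / 2 : ℝ) * (R - L) : ℝ) : ℂ)
        + (regularPartAt (L, R, R2, R4) : ℂ) := by
  have hsq : resonantCoeff R R R2 ^ 2 = (-(resonantAt R R2 * R ^ 2) ^ 2 / 4 : ℝ) := by
    rw [resonantCoeff_self hR]
    push_cast
    linear_combination ((resonantAt R R2 : ℂ) * R ^ 2) ^ 2 / 4 * Complex.I_sq
  have key : secondTwist (L, R, R2, R4) =
      -(3 * R ^ 4 * (-(resonantAt R R2 * R ^ 2) ^ 2 / 4)) /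
        (4 * √L * (2 * R - L) ^ (5 / 2 : ℝ) * (R - L)) + regularPartAt (L, R, R2, R4) := by
    have h0 : R - L ≠ 0 := sub_ne_zero.2 hLR.symm
    have ha := (Real.sqrt_pos.2 hL).ne'
    have hy := (Real.sqrt_pos.2 h).ne'
    have hM : resonantQuotient (L, R, R2, R4) = -(L * (genCoeffs L R R2 R4).N (multRe L R)
        + 2 * R * resonantAt R R2) / (R - L) := by
      rw [mul_resonantQuotient hL hR]; field_simp; ring
    rw [secondTwist_eq hL hR h hLR, regularPartAt, rpow_five_halves h.le, hM]
    simp only [chordCoeffs]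
    have hL2 : L = √L ^ 2 := (Real.sq_sqrt hL.le).symm
    generalize (genCoeffs L R R2 R4).N (multRe L R) = N
    generalize √(2 * R - L) = y at *
    generalize √L = a at *
    subst hL2
    field_simp
    ring
  rw [key, hsq]
  push_cast
  ring

theorem secondTwist_eq_div (hL : 0 < L) (hR : 0 < R) (h : 0 < 2 * R - L) (hLR : L ≠ R) :
    secondTwist (L, R, R2, R4) = residuePart (L, R, R2, R4) / (R - L) := by
  have h0 : R - L ≠ 0 := sub_ne_zero.2 hLR.symm
  have hy := (Real.sqrt_pos.2 h).ne'
  rw [secondTwist_eq hL hR h hLR, residuePart]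
  simp only [chordCoeffs]
  field_simp

theorem residuePart_self_ne_zero (hR : 0 < R) :
    residuePart (R, R, R2, R4) ≠ 0 ↔ resonantAt R R2 ≠ 0 := by
  have hs := (Real.sqrt_pos.2 hR).ne'
  have hN : (chordCoeffs (R, R, R2, R4)).N (multRe R R) = -2 * resonantAt R R2 := N_self hR R2 R4
  rw [residuePart]
  simp only [show 2 * R - R = R by ring, hN]
  simp [hs, hR.ne']

/-- The pole along `L = R` is simple exactly where `c₀₃` does not vanish: the numerator of the
polar part is determined by continuity from its values off `L = R`. -/
theorem hasSimplePoleAt_secondTwist_iff (hR : 0 < R) :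
    HasSimplePoleAt secondTwist (R, R, R2, R4) ↔ resonantCoeff R R R2 ≠ 0 := by
  rw [resonantCoeff_self_ne_zero hR, ← residuePart_self_ne_zero (R4 := R4) hR]
  have hp : ((R, R, R2, R4) : ℝ × ℝ × ℝ × ℝ) ∈ locus := ⟨hR, hR, by show 0 < 2 * R - R; linarith⟩
  have han := IsRegular.residuePart.analyticAt hp
  have heq : ∀ᶠ x in 𝓝 ((R, R, R2, R4) : ℝ × ℝ × ℝ × ℝ), x.1 ≠ x.2.1 →
      secondTwist x = residuePart x / (x.2.1 - x.1) := by
    filter_upwards [isOpen_locus.mem_nhds hp] with x hx hne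
    exact secondTwist_eq_div hx.1 hx.2.1 hx.2.2 hne
  refine ⟨?_, fun h => ⟨residuePart, han, h, heq⟩⟩
  rintro ⟨g, hg, hg0, hgT⟩
  let c : ℝ → ℝ × ℝ × ℝ × ℝ := fun t => (t, R, R2, R4)
  have hc : Tendsto c (𝓝[≠] R) (𝓝 (R, R, R2, R4)) :=
    ((by fun_prop : Continuous c).tendsto R).mono_left nhdsWithin_le_nhds
  have hlim : Tendsto (g ∘ c) (𝓝[≠] R) (𝓝 (residuePart (R, R, R2, R4))) := by
    refine (han.continuousAt.tendsto.comp hc).congr' ?_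
    filter_upwards [hc.eventually heq, hc.eventually hgT, self_mem_nhdsWithin] with t h1 h2 ht
    have h0 : R - t ≠ 0 := sub_ne_zero.2 (Ne.symm ht)
    exact (div_left_inj' h0).1 ((h1 ht).symm.trans (h2 ht))
  rwa [← tendsto_nhds_unique (hg.continuousAt.tendsto.comp hc) hlim]

end Resonance

end Billiard

theorem mainTheorem4 :
    ∃ (τ₂ : ℝ × ℝ × ℝ × ℝ → ℝ) (c : ℝ → ℝ → ℝ → ℂ),
      -- `c₀₃` is a function of `(L, R, R'')`, and `τ₂` one of `(L, R, R'', R⁽⁴⁾)`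
      (∀ Q : Billiard.SymmetricTable, Q.IsElliptic →
        (∃ F, Billiard.IsBilliardMap Q F) ∧
        ∀ F, Billiard.IsBilliardMap Q F →
          Billiard.c03 F = c Q.L (Q.Rad 0) (Q.Rad 2) ∧
          (Q.A1 → Q.A2 → ∀ τ : ℝ, Billiard.IsSecondTwistCoefficient F τ ↔
            τ = τ₂ (Q.L, Q.Rad 0, Q.Rad 2, Q.Rad 4))) ∧
      -- the polar part, with `c₀₃` taken at `(L, R, R'')`
      (∃ ρ : ℝ × ℝ × ℝ × ℝ → ℂ, Billiard.IsRegular ρ ∧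
        ∀ L R R2 R4 : ℝ, 0 < L → 0 < R → 0 < 2 * R - L → L ≠ R →
          (τ₂ (L, R, R2, R4) : ℂ) =
            -(3 * (R : ℂ) ^ 4 * c L R R2 ^ 2) /
              ((4 * Real.sqrt L * (2 * R - L) ^ (5 / 2 : ℝ) * (R - L) : ℝ) : ℂ)
              + ρ (L, R, R2, R4)) ∧
      -- the polar part, with `c₀₃` taken at resonance, that is, at `(R, R, R'')`
      (∃ ρ : ℝ × ℝ × ℝ × ℝ → ℝ, Billiard.IsRegular ρ ∧
        ∀ L R R2 R4 : ℝ, 0 < L → 0 < R → 0 < 2 * R - L → L ≠ R →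
          (τ₂ (L, R, R2, R4) : ℂ) =
            -(3 * (R : ℂ) ^ 4 * c R R R2 ^ 2) /
              ((4 * Real.sqrt L * (2 * R - L) ^ (5 / 2 : ℝ) * (R - L) : ℝ) : ℂ)
              + (ρ (L, R, R2, R4) : ℂ)) ∧
      -- there is a simple pole along `L = R` exactly where `c₀₃ ≠ 0`
      (∀ R R2 R4 : ℝ, 0 < R →
        (Billiard.HasSimplePoleAt τ₂ (R, R, R2, R4) ↔ c R R R2 ≠ 0)) := by
  refine ⟨Billiard.secondTwist, Billiard.resonantCoeff, fun Q hQ => ⟨?_, fun F hF => ⟨?_, ?_⟩⟩,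
    ⟨_, Billiard.IsRegular.regularPart, ?_⟩, ⟨_, Billiard.IsRegular.regularPartAt, ?_⟩, ?_⟩
  · obtain ⟨F, -, hF, -⟩ := Q.exists_billiardGerm
    exact ⟨F, hF⟩
  · exact Billiard.c03_eq hQ hF
  · exact fun h1 h2 τ => Billiard.isSecondTwistCoefficient_iff hQ h1 h2 hF τ
  · exact fun L R R2 R4 hL hR h hLR => Billiard.secondTwist_eq_regularPart hL hR h hLR
  · exact fun L R R2 R4 hL hR h hLR => Billiard.secondTwist_eq_regularPartAt hL hR h hLR
  · exact fun R R2 R4 hR => Billiard.hasSimplePoleAt_secondTwist_iff hR
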